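/- Let $(X,\omega)$ be a compact Kähler manifold of complex dimension $n$, let $E\to X$ be a smooth complex vector bundle of finite rank, and let $D$ be a smooth non-Hermitian Yang–Mills (NHYM) connection on $E$: its curvature satisfies $F_D=D^2\in\Omega^{1,1}(\mathrm{End}\,E)$ and $\sqrt{-1}\Lambda_\omega F_D=\lambda\,\mathrm{Id}_E$ for a constant $\lambda\in\mathbb R$. For a smooth Hermitian metric $H$ on $E$ write $D=D_H+\psi_H$, where $D_H$ preserves $H$ and $\psi_H\in\Omega^1(\mathrm{End}\,E)$ is $H$-self-adjoint. Let $\bar\partial_H$ be the $(0,1)$-part of $D_H$, let $\psi_H^{1,0}$ be the $(1,0)$-part of $\psi_H$, and let $G_H=(\bar\partial_H+\psi_H^{1,0})^2\in\Omega^2(\mathrm{End}\,E)$ be the pseudo-curvature. For smooth Hermitian metrics $K,L$ on $E$ and a piecewise smooth path $H(s)$, $s\in[0,1]$, of smooth Hermitian metrics with $H(0)=K$ and $H(1)=L$ (piecewise smooth: $[0,1]$ is divided into finitely many closed intervals $I$ such that $H$ is smooth in $(s,x)$ on each $I\times X$), put $$\mathcal M(K,L)=\int_0^1\int_X \mathrm{tr}\Big(-4\sqrt{-1}\,\Lambda_\omega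 G_{H(s)}\cdot H(s)^{-1}\frac{\partial H(s)}{\partial s}\Big)\frac{\omega^n}{n!}\,ds .$$ Then any two Hermitian metrics are joined by such a path, the inner integral converges for almost every $s$ and is integrable in $s$, and the value $\mathcal M(K,L)$ does not depend on the path $H(s)$ joining $K$ to $L$. Consequently $\mathcal M$ is a well-defined function of pairs of Hermitian metrics, and for all Hermitian metrics $K,J,L$ on $E$, $$\mathcal M(K,J)+\mathcal M(J,L)=\mathcal M(K,L).$$ -/

import Mathlib

open Bundle MeasureTheory
open scoped Manifold ContDiff

noncomputable section

namespace NHYM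

section Restriction

/-! A complex manifold is in particular a smooth real manifold, and a complex vector bundle is in
particular a real vector bundle. -/

variable {V : Type*} [NormedAddCommGroup V] [NormedSpace ℂ V]
  {X : Type*} [TopologicalSpace X] [ChartedSpace V X]

instance isManifold_real {n : ℕ∞ω} [IsManifold 𝓘(ℂ, V) n X] : IsManifold 𝓘(ℝ, V) n X := by
  apply isManifold_of_contDiffOn
  intro e e' he he'
  have h := (contDiffGroupoid n 𝓘(ℂ, V)).compatible he he'
  rw [contDiffGroupoid] at h
  exact ContDiffOn.restrict_scalars ℝ (mem_groupoid_of_pregroupoid.1 h).1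

variable {F : Type*} [NormedAddCommGroup F] [NormedSpace ℂ F]
  {E : X → Type*} [∀ x, AddCommGroup (E x)] [∀ x, Module ℂ (E x)]
  [∀ x, TopologicalSpace (E x)] [TopologicalSpace (TotalSpace F E)] [FiberBundle F E]

instance continuousSMul_real {M : Type*} [AddCommGroup M] [Module ℂ M] [TopologicalSpace M]
    [ContinuousSMul ℂ M] : ContinuousSMul ℝ M :=
  IsScalarTower.continuousSMul ℂ

instance vectorBundle_real [VectorBundle ℂ F E] : VectorBundle ℝ F E where
  trivialization_linear' e _ := by
    have := VectorBundle.trivialization_linear' (R := ℂ) (F := F) (E := E) e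
    refine ⟨fun b hb => ⟨(this.linear b hb).map_add, fun c x => ?_⟩⟩
    have h := (this.linear b hb).map_smul (c : ℂ) x
    simpa using h
  continuousOn_coordChange' e e' _ _ := by
    have hc := VectorBundle.continuousOn_coordChange' (R := ℂ) (F := F) (E := E) e e'
    refine ((ContinuousLinearMap.restrictScalarsL ℂ F F ℝ ℝ).continuous.comp_continuousOn
      hc).congr fun b hb => ?_
    ext v
    simp [Trivialization.coordChangeL_apply _ _ hb]

end Restriction

section Kahler

variable {V : Type*} [NormedAddCommGroup V] [NormedSpace ℂ V]
  {X : Type*} [TopologicalSpace X] [ChartedSpace V X]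

/-- The complex structure of a complex manifold: multiplication by `√-1` on each tangent space,
which is the model space `V` through the preferred holomorphic chart. -/
def complexStructure (x : X) : TangentSpace 𝓘(ℝ, V) x →L[ℝ] TangentSpace 𝓘(ℝ, V) x :=
  show V →L[ℝ] V from Complex.I • ContinuousLinearMap.id ℝ V

variable (V X) in
/-- A Kähler metric on a complex manifold: a smooth Riemannian metric `g` for which the complex
structure `J` is orthogonal and whose fundamental form `ω(u, v) = g(J u, v)` is closed.
Closedness is `(dω)(A, B, C) = 0` for all locally smooth vector fields. -/
structure KahlerMetric [IsManifold 𝓘(ℂ, V) ω X] extends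
    ContMDiffRiemannianMetric 𝓘(ℝ, V) ∞ V (fun x : X => TangentSpace 𝓘(ℝ, V) x) where
  orthogonal (x : X) (u v : TangentSpace 𝓘(ℝ, V) x) :
    inner x (complexStructure x u) (complexStructure x v) = inner x u v
  closed (x : X) (A B C : Π y : X, TangentSpace 𝓘(ℝ, V) y)
    (hA : ContMDiffAt 𝓘(ℝ, V) (𝓘(ℝ, V).prod 𝓘(ℝ, V)) ∞ (fun y => TotalSpace.mk' V y (A y)) x)
    (hB : ContMDiffAt 𝓘(ℝ, V) (𝓘(ℝ, V).prod 𝓘(ℝ, V)) ∞ (fun y => TotalSpace.mk' V y (B y)) x)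
    (hC : ContMDiffAt 𝓘(ℝ, V) (𝓘(ℝ, V).prod 𝓘(ℝ, V)) ∞ (fun y => TotalSpace.mk' V y (C y)) x) :
    mvfderiv 𝓘(ℝ, V) (fun y => inner y (complexStructure y (B y)) (C y)) x (A x)
      + mvfderiv 𝓘(ℝ, V) (fun y => inner y (complexStructure y (C y)) (A y)) x (B x)
      + mvfderiv 𝓘(ℝ, V) (fun y => inner y (complexStructure y (A y)) (B y)) x (C x)
      - inner x (complexStructure x (VectorField.mlieBracket 𝓘(ℝ, V) A B x)) (C x)
      - inner x (complexStructure x (VectorField.mlieBracket 𝓘(ℝ, V) B C x)) (A x)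
      - inner x (complexStructure x (VectorField.mlieBracket 𝓘(ℝ, V) C A x)) (B x) = 0

variable [FiniteDimensional ℂ V]

variable (V) in
/-- A fixed real basis of the model space. -/
def modelBasis : Module.Basis (Fin (Module.finrank ℝ V)) ℝ V := Module.finBasis ℝ V

variable [IsManifold 𝓘(ℂ, V) ω X]

/-- The coordinate vector fields of the chart at `x₀`. -/
def coordField (x₀ : X) (a : Fin (Module.finrank ℝ V)) (y : X) : TangentSpace 𝓘(ℝ, V) y :=
  (trivializationAt V (fun x : X => TangentSpace 𝓘(ℝ, V) x) x₀).symm y (modelBasis V a)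

/-- The matrix `g_{ab} = g(∂_a, ∂_b)` at `y` of the metric in the chart at `x₀`. -/
def gram (g : KahlerMetric V X) (x₀ y : X) :
    Matrix (Fin (Module.finrank ℝ V)) (Fin (Module.finrank ℝ V)) ℝ :=
  Matrix.of fun a b => g.inner y (coordField x₀ a y) (coordField x₀ b y)

/-- The contraction `Λ_ω` with the Kähler form, adjoint to `ω ∧ ·`, on 2-forms at `x` with values
in a complex vector space: `Λ_ω γ = ½ ∑_a γ(f_a, J f_a)` for a real `g`-orthonormal basis `f`,
that is, `½ ∑_{a,b} g^{ab} γ(∂_a, J ∂_b)` for any basis. Thus `Λ_ω ω = dim_ℂ X`. -/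
def contract {W : Type*} [AddCommGroup W] [Module ℂ W] (g : KahlerMetric V X) (x : X)
    (γ : TangentSpace 𝓘(ℝ, V) x → TangentSpace 𝓘(ℝ, V) x → W) : W :=
  (1 / 2 : ℂ) • ∑ a, ∑ b, (((gram g x x)⁻¹ a b : ℝ) : ℂ) •
    γ (coordField x a x) (complexStructure x (coordField x b x))

variable [T2Space X] [CompactSpace X]

variable (V X) in
/-- A smooth partition of unity subordinate to the charts. -/
def chartPartition : SmoothPartitionOfUnity X 𝓘(ℝ, V) X Set.univ :=
  (SmoothPartitionOfUnity.exists_isSubordinate_chartAt_source 𝓘(ℝ, V) X).choose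

/-- The volume measure `ω^n / n!` of a compact Kähler manifold, which is the Riemannian volume of
`g`: in each chart it has density `√det (g_{ab})` with respect to the Lebesgue measure of the chosen
basis, and the charts are patched by a partition of unity. -/
def kahlerVolume [MeasurableSpace V] [BorelSpace V] [MeasurableSpace X]
    (g : KahlerMetric V X) : Measure X :=
  Measure.sum fun i : X =>
    (((modelBasis V).addHaar.restrict (chartAt V i).target).withDensity fun z =>
      ENNReal.ofReal (chartPartition V X i ((chartAt V i).symm z) *
        Real.sqrt (gram g i ((chartAt V i).symm z)).det)).map (chartAt V i).symm

end Kahler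

section Types

variable {V : Type*} [NormedAddCommGroup V] [NormedSpace ℂ V]
  {X : Type*} [TopologicalSpace X] [ChartedSpace V X]
  {W : Type*} [AddCommGroup W] [Module ℂ W] {x : X}

/-- The `(1,0)`-part of a complex-valued real-linear form. -/
def part10 (β : TangentSpace 𝓘(ℝ, V) x → W) (v : TangentSpace 𝓘(ℝ, V) x) : W :=
  (1 / 2 : ℂ) • (β v - Complex.I • β (complexStructure x v))

/-- The `(0,1)`-part of a complex-valued real-linear form. -/
def part01 (β : TangentSpace 𝓘(ℝ, V) x → W) (v : TangentSpace 𝓘(ℝ, V) x) : W :=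
  (1 / 2 : ℂ) • (β v + Complex.I • β (complexStructure x v))

/-- The `(1,1)`-part of a 2-form. -/
def part11 (γ : TangentSpace 𝓘(ℝ, V) x → TangentSpace 𝓘(ℝ, V) x → W)
    (u v : TangentSpace 𝓘(ℝ, V) x) : W :=
  (1 / 2 : ℂ) • (γ u v + γ (complexStructure x u) (complexStructure x v))

/-- The `(0,2)`-part of a 2-form. -/
def part02 (γ : TangentSpace 𝓘(ℝ, V) x → TangentSpace 𝓘(ℝ, V) x → W)
    (u v : TangentSpace 𝓘(ℝ, V) x) : W :=
  (1 / 4 : ℂ) • (γ u v - γ (complexStructure x u) (complexStructure x v)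
    + Complex.I • (γ (complexStructure x u) v + γ u (complexStructure x v)))

end Types

section Bundles

variable (V : Type*) [NormedAddCommGroup V] [NormedSpace ℂ V]
  {X : Type*} [TopologicalSpace X] [ChartedSpace V X]
  (F : Type*) [NormedAddCommGroup F] [NormedSpace ℂ F]
  (E : X → Type*) [∀ x, AddCommGroup (E x)] [∀ x, Module ℂ (E x)]
  [∀ x, TopologicalSpace (E x)] [TopologicalSpace (TotalSpace F E)] [FiberBundle F E]

/-- A smooth Hermitian metric on a complex vector bundle, linear in the first argument and
conjugate-linear in the second. -/
structure HermitianMetric where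
  form (x : X) : E x →ₗ[ℂ] E x →ₗ⋆[ℂ] ℂ
  conj_symm (x : X) (e f : E x) : starRingEnd ℂ (form x e f) = form x f e
  pos (x : X) (e : E x) (he : e ≠ 0) : 0 < (form x e e).re
  smooth (x : X) (σ τ : Π y, E y)
    (hσ : ContMDiffAt 𝓘(ℝ, V) (𝓘(ℝ, V).prod 𝓘(ℝ, F)) ∞ (fun y => TotalSpace.mk' F y (σ y)) x)
    (hτ : ContMDiffAt 𝓘(ℝ, V) (𝓘(ℝ, V).prod 𝓘(ℝ, F)) ∞ (fun y => TotalSpace.mk' F y (τ y)) x) :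
    ContMDiffAt 𝓘(ℝ, V) 𝓘(ℝ, ℂ) ∞ (fun y => form y (σ y) (τ y)) x

variable {V F E} in
/-- A piecewise smooth path of Hermitian metrics from `K` to `L`, parametrized by `[0, 1]`: for some
subdivision `0 = t 0 ≤ … ≤ t m = 1`, the metric is smooth in `(s, x)` on each
`[t i, t (i + 1)] × X`. (The closed pieces overlap, so the path is continuous.) -/
structure MetricPath (K L : HermitianMetric V F E) where
  metric : ℝ → HermitianMetric V F E
  source : metric 0 = K
  target : metric 1 = L
  piecewise_smooth : ∃ (m : ℕ) (t : ℕ → ℝ), Monotone t ∧ t 0 = 0 ∧ t m = 1 ∧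
    ∀ i < m, ∀ s ∈ Set.Icc (t i) (t (i + 1)), ∀ (x : X) (σ τ : Π y, E y),
      ContMDiffAt 𝓘(ℝ, V) (𝓘(ℝ, V).prod 𝓘(ℝ, F)) ∞ (fun y => TotalSpace.mk' F y (σ y)) x →
      ContMDiffAt 𝓘(ℝ, V) (𝓘(ℝ, V).prod 𝓘(ℝ, F)) ∞ (fun y => TotalSpace.mk' F y (τ y)) x →
      ContMDiffWithinAt (𝓘(ℝ, ℝ).prod 𝓘(ℝ, V)) 𝓘(ℝ, ℂ) ∞
        (fun p : ℝ × X => (metric p.1).form p.2 (σ p.2) (τ p.2))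
        (Set.Icc (t i) (t (i + 1)) ×ˢ Set.univ) (s, x)

variable [IsManifold 𝓘(ℂ, V) ω X] [VectorBundle ℂ F E]
  [∀ x, IsTopologicalAddGroup (E x)] [∀ x, ContinuousSMul ℂ (E x)]

/-- A smooth connection on a complex vector bundle; `D σ x v` is `(D_v σ)(x)`. -/
structure ComplexConnection extends CovariantDerivative 𝓘(ℝ, V) F E where
  smul_I (σ : Π y, E y) (x : X)
    (hσ : MDifferentiableAt 𝓘(ℝ, V) (𝓘(ℝ, V).prod 𝓘(ℝ, F)) (fun y => TotalSpace.mk' F y (σ y)) x)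
    (v : TangentSpace 𝓘(ℝ, V) x) :
    toFun (fun y => Complex.I • σ y) x v = Complex.I • toFun σ x v
  smooth : CovariantDerivative.ContMDiffCovariantDerivative toCovariantDerivative ∞

variable {V F E}

/-- The exterior covariant derivative on `E`-valued 1-forms of a first-order operator `nabla`,
`(d^∇ β)(u, v) = ∇_u (β(v)) - ∇_v (β(u)) - β([u, v])`, with `u`, `v` extended to local vector
fields. -/
def extDerivForm (nabla : (Π y, E y) → Π y : X, TangentSpace 𝓘(ℝ, V) y → E y)
    (β : Π y : X, TangentSpace 𝓘(ℝ, V) y → E y) (x : X) (u v : TangentSpace 𝓘(ℝ, V) x) : E x :=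
  nabla (fun y => β y (FiberBundle.extend V v y)) x u
    - nabla (fun y => β y (FiberBundle.extend V u y)) x v
    - β x (VectorField.mlieBracket 𝓘(ℝ, V) (FiberBundle.extend V u) (FiberBundle.extend V v) x)

/-- The curvature `F_D = D²`, applied to `u, v ∈ T_x X` and `e ∈ E_x`
(`e` is extended to a local section). -/
def curvature (D : ComplexConnection V F E) (x : X) (u v : TangentSpace 𝓘(ℝ, V) x) (e : E x) :
    E x :=
  extDerivForm (fun σ y w => D.toFun σ y w) (fun y w => D.toFun (FiberBundle.extend F e) y w) x u v

/-- `D` is a non-Hermitian Yang-Mills connection: its curvature is of type `(1,1)` and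
`√-1 Λ_ω F_D = λ Id` for a real constant `λ`. -/
def IsNHYM [FiniteDimensional ℂ V] (g : KahlerMetric V X) (D : ComplexConnection V F E) : Prop :=
  (∀ (x : X) (u v : TangentSpace 𝓘(ℝ, V) x) (e : E x),
    curvature D x (complexStructure x u) (complexStructure x v) e = curvature D x u v e) ∧
  ∃ lam : ℝ, ∀ (x : X) (e : E x),
    Complex.I • contract g x (fun u v => curvature D x u v e) = (lam : ℂ) • e

variable [FiniteDimensional ℂ F]

variable (F E) in
/-- A complex basis of the fibre `E_x`. -/
def fiberBasis (x : X) : Module.Basis (Fin (Module.finrank ℂ F)) ℂ (E x) :=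
  (trivializationAt F E x).basisAt (Module.finBasis ℂ F)
    (FiberBundle.mem_baseSet_trivializationAt F E x)

/-- For a sesquilinear form `B` on `E_x`, the endomorphism `H⁻¹ B` of `E_x`, determined by
`H(H⁻¹ B e, f) = B(e, f)`: in a basis it is the matrix product `H⁻¹ B`. -/
def invMul (H : HermitianMetric V F E) (x : X) (B : E x → E x → ℂ) : E x →ₗ[ℂ] E x :=
  Matrix.toLin (fiberBasis F E x) (fiberBasis F E x)
    ((Matrix.of fun i j => H.form x (fiberBasis F E x j) (fiberBasis F E x i))⁻¹ *
      Matrix.of fun i j => B (fiberBasis F E x j) (fiberBasis F E x i))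

/-- The `H`-self-adjoint part `ψ_H` of `D`: the unique `ψ_H ∈ Ω¹(End E)` self-adjoint with respect
to `H` for which `D - ψ_H` preserves `H`, that is
`2 H(ψ_H(v) e, f) = H(D_v e, f) + H(e, D_v f) - v (H(e, f))`. -/
def psi (D : ComplexConnection V F E) (H : HermitianMetric V F E) (x : X)
    (v : TangentSpace 𝓘(ℝ, V) x) : E x →ₗ[ℂ] E x :=
  invMul H x fun e f => (1 / 2 : ℂ) *
    (H.form x (D.toFun (FiberBundle.extend F e) x v) f
      + H.form x e (D.toFun (FiberBundle.extend F f) x v)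
      - mvfderiv 𝓘(ℝ, V)
          (fun y => H.form y (FiberBundle.extend F e y) (FiberBundle.extend F f y)) x v)

/-- The unitary connection `D_H = D - ψ_H`. -/
def unitaryPart (D : ComplexConnection V F E) (H : HermitianMetric V F E) (σ : Π y, E y) (x : X)
    (v : TangentSpace 𝓘(ℝ, V) x) : E x :=
  D.toFun σ x v - psi D H x v (σ x)

/-- `D''_H = ∂̄_H + ψ_H^{1,0}` on sections of `E`. -/
def dSecond₀ (D : ComplexConnection V F E) (H : HermitianMetric V F E) (σ : Π y, E y) (x : X)
    (v : TangentSpace 𝓘(ℝ, V) x) : E x :=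
  part01 (unitaryPart D H σ x) v + part10 (psi D H x) v (σ x)

/-- `∂̄_H` on `E`-valued 1-forms: the `(1,1)`-part of `D_H β^{1,0}` plus the `(0,2)`-part of
`D_H β^{0,1}`. -/
def delbar₁ (D : ComplexConnection V F E) (H : HermitianMetric V F E)
    (β : Π y : X, TangentSpace 𝓘(ℝ, V) y → E y) (x : X) (u v : TangentSpace 𝓘(ℝ, V) x) : E x :=
  part11 (extDerivForm (unitaryPart D H) (fun y => part10 (β y)) x) u v
    + part02 (extDerivForm (unitaryPart D H) (fun y => part01 (β y)) x) u v

/-- `D''_H = ∂̄_H + ψ_H^{1,0} ∧ ·` on `E`-valued 1-forms. -/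
def dSecond₁ (D : ComplexConnection V F E) (H : HermitianMetric V F E)
    (β : Π y : X, TangentSpace 𝓘(ℝ, V) y → E y) (x : X) (u v : TangentSpace 𝓘(ℝ, V) x) : E x :=
  delbar₁ D H β x u v
    + (part10 (psi D H x) u (β x v) - part10 (psi D H x) v (β x u))

/-- The pseudo-curvature `G_H = (D''_H)² ∈ Ω²(End E)`: the endomorphism of `E_x` which on a basis
is given by applying `D''_H` twice to local extensions. -/
def pseudoCurvature (D : ComplexConnection V F E) (H : HermitianMetric V F E) (x : X)
    (u v : TangentSpace 𝓘(ℝ, V) x) : E x →ₗ[ℂ] E x :=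
  (fiberBasis F E x).constr ℂ fun i =>
    dSecond₁ D H (dSecond₀ D H (FiberBundle.extend F (fiberBasis F E x i))) x u v

/-- The endomorphism `H(s)⁻¹ ∂H(s)/∂s` along a path. -/
def logDeriv {K L : HermitianMetric V F E} (γ : MetricPath K L) (s : ℝ) (x : X) :
    E x →ₗ[ℂ] E x :=
  invMul (γ.metric s) x fun e f =>
    derivWithin (fun r => (γ.metric r).form x e f) (Set.Icc 0 1) s

variable [FiniteDimensional ℂ V]

/-- The integrand `tr(-4 √-1 Λ_ω G_{H(s)} · H(s)⁻¹ ∂H(s)/∂s)` at `x ∈ X`. -/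
def donaldsonIntegrand (g : KahlerMetric V X) (D : ComplexConnection V F E)
    {K L : HermitianMetric V F E} (γ : MetricPath K L) (s : ℝ) (x : X) : ℂ :=
  LinearMap.trace ℂ (E x)
    (((-4 * Complex.I) • contract g x (pseudoCurvature D (γ.metric s) x)) ∘ₗ logDeriv γ s x)

/-- The Donaldson functional computed along a path from `K` to `L`. -/
def donaldsonAlong [T2Space X] [CompactSpace X] [MeasurableSpace V] [BorelSpace V]
    [MeasurableSpace X] (g : KahlerMetric V X) (D : ComplexConnection V F E)
    {K L : HermitianMetric V F E} (γ : MetricPath K L) : ℂ :=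
  ∫ s in (0 : ℝ)..1, ∫ x, donaldsonIntegrand g D γ s x ∂(kahlerVolume g)

end Bundles

end NHYM

end

/-! The functional is exact: it is the difference of the values of a potential at the two ends of
the path. The potential is `energy`, the integral over $X$ of
$e(H)=2\,\mathrm{tr}_g\,\mathrm{tr}(\psi_H\otimes\psi_H)$. Once $\mathcal M(K,L)=\mathcal
E(L)-\mathcal E(K)$ is known along every path, path independence and the cocycle identity are
immediate.

Write $h=H^{-1}\partial_sH$. The core is the pointwise identity
`IsSmoothFamily.trace_pseudoCurvature_comp_logField`, $\mathrm{tr}(-4\sqrt{-1}\,\Lambda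
G_H\,h)=\Lambda\,d\beta+\partial_s e(H(s))$ with $\beta=-2\,\mathrm{tr}(h\,\psi_H\circ J)$. It rests
on three facts.

(1) $\Lambda D_H\psi_H=0$ (`kahlerTrace_covExt_psi`). The connection $D_H-\psi_H$ is the $H$-adjoint
of $D=D_H+\psi_H$, so its curvature is minus the $H$-adjoint of $F_D$. Since $\lambda$ is real, both
curvatures have contraction $-\sqrt{-1}\lambda\,\mathrm{Id}$, while they differ by $2D_H\psi_H$.

(2) $\Lambda G_H=-\tfrac{\sqrt{-1}}2\Lambda D_H(\psi_H\circ J)$ (`kahlerTrace_pseudoCurvature`). The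
contraction kills the parts of type $(2,0)$ and $(0,2)$, so only $D_H\psi_H^{1,0}$ counts, with
$\psi_H^{1,0}=\tfrac12(\psi_H-\sqrt{-1}\,\psi_H\circ J)$, and (1) removes its first half. Moving the
derivative onto $h$ gives $\mathrm{tr}(-4\sqrt{-1}\,\Lambda G_H h)=\Lambda
d\beta-2\,\mathrm{tr}_g\mathrm{tr}(D_Hh\,\psi_H)$.

(3) $2\,\partial_s\psi_H=-(D_Hh-[\psi_H,h])$ (`IsSmoothFamily.matrixDeriv_familyPsi`). The
commutator drops out of the trace, so $\partial_s e=-2\,\mathrm{tr}_g\mathrm{tr}(D_Hh\,\psi_H)$,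
which is the remaining term of (2).

The exact term integrates to zero by Stokes' theorem in the form $\int\Lambda d\beta=0$
(`integral_contract_dform`). In a chart, $\Lambda d\beta$ times the volume density is a Euclidean
divergence, and closedness of $\omega$ is what makes this so. Differentiation under the integral and
the fundamental theorem of calculus on each smooth piece then give the energy difference, and the
pieces telescope. -/

open Bundle MeasureTheory
open scoped Manifold ContDiff

noncomputable section

namespace NHYM

open Set Filter Topology
set_option linter.unusedSectionVars false

/-! ### Coordinate vector fields and holomorphic changes of chart -/

section TangentCharts

variable {V : Type*} [NormedAddCommGroup V] [NormedSpace ℂ V]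
  {X : Type*} [TopologicalSpace X] [ChartedSpace V X]

/-- The change of coordinates from the chart at `p` to the chart at `q`. -/
def transition (p q : X) : V → V := chartAt V q ∘ (chartAt V p).symm

theorem transition_apply {p q y : X} (hp : y ∈ (chartAt V p).source) :
    transition p q (chartAt V p y) = chartAt V q y := by
  simp [transition, hp]

theorem transition_contDiffAt_field {𝕜 : Type*} [NontriviallyNormedField 𝕜] [NormedSpace 𝕜 V]
    {n : ℕ∞ω} [IsManifold 𝓘(𝕜, V) n X] {p q y : X}
    (hp : y ∈ (chartAt V p).source) (hq : y ∈ (chartAt V q).source) :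
    ContDiffAt 𝕜 n (transition p q) (chartAt V p y) := by
  have h := ModelWithCorners.contDiffWithinAt_extendCoordChange' (𝕜 := 𝕜) (I := 𝓘(𝕜, V)) (n := n)
    (IsManifold.chart_mem_maximalAtlas (I := 𝓘(𝕜, V)) (n := n) p)
    (IsManifold.chart_mem_maximalAtlas (I := 𝓘(𝕜, V)) (n := n) q) hp hq
  rw [modelWithCornersSelf_coe, range_id, contDiffWithinAt_univ] at h
  exact h

variable [IsManifold 𝓘(ℂ, V) ω X]

theorem transition_contDiffAt {p q y : X} {n : ℕ∞ω}
    (hp : y ∈ (chartAt V p).source) (hq : y ∈ (chartAt V q).source) :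
    ContDiffAt ℝ n (transition p q) (chartAt V p y) :=
  (transition_contDiffAt_field (𝕜 := ℝ) (n := ω) hp hq).of_le le_top

theorem transition_differentiableAt {p q y : X}
    (hp : y ∈ (chartAt V p).source) (hq : y ∈ (chartAt V q).source) :
    DifferentiableAt ℝ (transition p q) (chartAt V p y) :=
  (transition_contDiffAt (n := 1) hp hq).differentiableAt one_ne_zero

/-- The atlas is holomorphic, so the real derivative of a transition map is the restriction of
scalars of a complex-linear map. -/
theorem fderiv_transition_smul_I {p q y : X}
    (hp : y ∈ (chartAt V p).source) (hq : y ∈ (chartAt V q).source) (v : V) :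
    fderiv ℝ (transition p q) (chartAt V p y) (Complex.I • v) =
      Complex.I • fderiv ℝ (transition p q) (chartAt V p y) v := by
  have h : DifferentiableAt ℂ (transition p q) (chartAt V p y) :=
    (transition_contDiffAt_field (𝕜 := ℂ) (n := ω) hp hq).differentiableAt (by simp)
  rw [h.fderiv_restrictScalars ℝ]
  simp

theorem fderiv_transition_self {p y : X} (hp : y ∈ (chartAt V p).source) :
    fderiv ℝ (transition p p) (chartAt V p y) = ContinuousLinearMap.id ℝ V := by
  have h : transition p p =ᶠ[𝓝 (chartAt V p y)] id := by
    filter_upwards [(chartAt V p).open_target.mem_nhds ((chartAt V p).map_source hp)] with z hz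
    simp [transition, hz]
  rw [h.fderiv_eq, fderiv_id]

theorem fderiv_transition_comp {p q r y : X} (hp : y ∈ (chartAt V p).source)
    (hq : y ∈ (chartAt V q).source) (hr : y ∈ (chartAt V r).source) (v : V) :
    fderiv ℝ (transition q r) (chartAt V q y) (fderiv ℝ (transition p q) (chartAt V p y) v) =
      fderiv ℝ (transition p r) (chartAt V p y) v := by
  have h : transition p r =ᶠ[𝓝 (chartAt V p y)] transition q r ∘ transition p q := by
    filter_upwards [(chartAt V p).open_target.mem_nhds ((chartAt V p).map_source hp),
      ((chartAt V p).continuousAt_symm ((chartAt V p).map_source hp)).preimage_mem_nhds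
        ((chartAt V q).open_source.mem_nhds
          (by simpa [(chartAt V p).left_inv hp] using hq))] with z hz hz'
    simp only [transition, Function.comp_apply]
    rw [(chartAt V q).left_inv hz']
  rw [h.fderiv_eq, fderiv_comp _ _ (transition_differentiableAt hp hq), transition_apply hp]
  · rfl
  · rw [transition_apply hp]
    exact transition_differentiableAt hq hr

/-- The vector field with constant coordinates `v` in the chart at `p`. -/
def constField (p : X) (v : V) (y : X) : TangentSpace 𝓘(ℝ, V) y :=
  (trivializationAt V (fun x : X => TangentSpace 𝓘(ℝ, V) x) p).symm y v

/-- The tangent space at `y` is the model space through the preferred chart at `y`, not the one at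
`p`. This turns coordinate fields into derivatives of transition maps, on which all later chart
computations rest. -/
theorem constField_eq_fderiv {p y : X} (hy : y ∈ (chartAt V p).source) (v : V) :
    constField p v y = fderiv ℝ (transition p y) (chartAt V p y) v := by
  have := TangentBundle.symmL_trivializationAt_eq_core (𝕜 := ℝ) (I := 𝓘(ℝ, V)) (M := X) hy
  have h2 := congrArg (fun f : V →L[ℝ] V => f v) this
  simp at h2
  refine Eq.trans ?_ h2
  exact (Trivialization.symmL_apply (R := ℝ) (trivializationAt V (fun x : X => TangentSpace 𝓘(ℝ, V) x) p) hy v).symm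

theorem constField_self (p : X) (v : V) : constField p v p = v := by
  rw [constField_eq_fderiv (mem_chart_source V p), fderiv_transition_self (mem_chart_source V p)]
  rfl

theorem constField_eq_constField {p q y : X} (hp : y ∈ (chartAt V p).source)
    (hq : y ∈ (chartAt V q).source) (v : V) :
    constField p v y = constField q (fderiv ℝ (transition p q) (chartAt V p y) v) y := by
  rw [constField_eq_fderiv hp, constField_eq_fderiv hq,
    fderiv_transition_comp hp hq (mem_chart_source V y)]

theorem complexStructure_constField {p y : X} (hp : y ∈ (chartAt V p).source) (v : V) :
    complexStructure y (constField p v y) = constField p (Complex.I • v) y := by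
  rw [constField_eq_fderiv hp, constField_eq_fderiv hp]
  exact (fderiv_transition_smul_I hp (mem_chart_source V y) v).symm

theorem constField_add {p y : X} (hp : y ∈ (chartAt V p).source) (u v : V) :
    constField p (u + v) y = constField p u y + constField p v y := by
  rw [constField_eq_fderiv hp, constField_eq_fderiv hp, constField_eq_fderiv hp]
  exact map_add _ u v

theorem constField_smul {p y : X} (hp : y ∈ (chartAt V p).source) (c : ℝ) (v : V) :
    constField p (c • v) y = c • constField p v y := by
  rw [constField_eq_fderiv hp, constField_eq_fderiv hp]
  exact map_smul _ c v

theorem exists_constField_eq {p y : X} (hp : y ∈ (chartAt V p).source)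
    (w : TangentSpace 𝓘(ℝ, V) y) : ∃ v : V, constField p v y = w := by
  refine ⟨fderiv ℝ (transition y p) (chartAt V y y) w, ?_⟩
  have h := constField_eq_constField (mem_chart_source V y) hp (show V from w)
  exact h.symm.trans (constField_self y _)

/-- The exterior covariant derivative is defined through these extensions; identifying them with
coordinate fields makes the bracket terms vanish. -/
theorem extend_eq_constField {x : X} (v : TangentSpace 𝓘(ℝ, V) x) (y : X) :
    FiberBundle.extend V v y = constField (V := V) x v y := by
  have h : (trivializationAt V (fun x : X => TangentSpace 𝓘(ℝ, V) x) x ⟨x, v⟩).2 = v := by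
    have := fderiv_transition_self (V := V) (mem_chart_source V x)
    rw [TangentBundle.trivializationAt_apply, modelWithCornersSelf_coe, range_id]
    rw [← fderivWithin_univ] at this
    exact congrArg (fun f : V →L[ℝ] V => f v) this
  unfold FiberBundle.extend constField
  rw [h]

theorem contMDiffAt_constField {n : ℕ∞ω} {p y : X} (hp : y ∈ (chartAt V p).source) (v : V) :
    ContMDiffAt 𝓘(ℝ, V) (𝓘(ℝ, V).prod 𝓘(ℝ, V)) n
      (fun y => TotalSpace.mk' V y (constField p v y)) y := by
  have hm : ContMDiffVectorBundle n V (fun x : X => TangentSpace 𝓘(ℝ, V) x) 𝓘(ℝ, V) :=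
    TangentBundle.contMDiffVectorBundle
  rw [Trivialization.contMDiffAt_section_iff
    (e := trivializationAt V (fun x : X => TangentSpace 𝓘(ℝ, V) x) p) hp]
  refine (contMDiffAt_const (c := v)).congr_of_eventuallyEq ?_
  filter_upwards [(chartAt V p).open_source.mem_nhds hp] with z hz
  exact congrArg Prod.snd
    ((trivializationAt V (fun x : X => TangentSpace 𝓘(ℝ, V) x) p).apply_mk_symm hz v)

theorem differentiableAt_comp_chart_symm {W : Type*} [NormedAddCommGroup W] [NormedSpace ℝ W]
    {f : X → W} {p y : X} (hp : y ∈ (chartAt V p).source)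
    (hf : MDifferentiableAt 𝓘(ℝ, V) 𝓘(ℝ, W) f y) :
    DifferentiableAt ℝ (f ∘ (chartAt V p).symm) (chartAt V p y) := by
  rw [← mdifferentiableAt_iff_differentiableAt]
  have h1 : MDifferentiableAt 𝓘(ℝ, V) 𝓘(ℝ, V) (extChartAt 𝓘(ℝ, V) p).symm (chartAt V p y) := by
    have := (mdifferentiableWithinAt_extChartAt_symm (I := 𝓘(ℝ, V)) (x := p) (z := chartAt V p y)
      (by simpa using (chartAt V p).map_source hp))
    rwa [modelWithCornersSelf_coe, range_id, mdifferentiableWithinAt_univ] at this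
  have h2 : MDifferentiableAt 𝓘(ℝ, V) 𝓘(ℝ, W) f ((chartAt V p).symm (chartAt V p y)) := by
    rwa [(chartAt V p).left_inv hp]
  exact MDifferentiableAt.comp (chartAt V p y) h2 h1

theorem mvfderiv_constField {W : Type*} [NormedAddCommGroup W] [NormedSpace ℝ W] {f : X → W}
    {p y : X} (hp : y ∈ (chartAt V p).source) (hf : MDifferentiableAt 𝓘(ℝ, V) 𝓘(ℝ, W) f y)
    (v : V) :
    mvfderiv 𝓘(ℝ, V) f y (constField p v y) =
      fderiv ℝ (f ∘ (chartAt V p).symm) (chartAt V p y) v := by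
  have hd := differentiableAt_comp_chart_symm (mem_chart_source V y) hf
  have h : f ∘ (chartAt V p).symm =ᶠ[𝓝 (chartAt V p y)]
      (f ∘ (chartAt V y).symm) ∘ transition p y := by
    filter_upwards [((chartAt V p).continuousAt_symm ((chartAt V p).map_source hp)).preimage_mem_nhds
        ((chartAt V y).open_source.mem_nhds
          (by simp [(chartAt V p).left_inv hp]))] with z hz'
    simp only [transition, Function.comp_apply]
    rw [(chartAt V y).left_inv hz']
  rw [hf.mvfderiv, constField_eq_fderiv hp, h.fderiv_eq,
    fderiv_comp _ _ (transition_differentiableAt hp (mem_chart_source V y)), transition_apply hp,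
    modelWithCornersSelf_coe, range_id, fderivWithin_univ]
  · rfl
  · rwa [transition_apply hp]

theorem mfderiv_extChartAt_eq {p w : X} (hw : w ∈ (chartAt V p).source) :
    mfderiv 𝓘(ℝ, V) 𝓘(ℝ, V) (extChartAt 𝓘(ℝ, V) p) w =
      fderiv ℝ (transition w p) (chartAt V w w) := by
  have hd : MDifferentiableAt 𝓘(ℝ, V) 𝓘(ℝ, V) (extChartAt 𝓘(ℝ, V) p) w :=
    mdifferentiableAt_extChartAt hw
  rw [hd.mfderiv, modelWithCornersSelf_coe, range_id, fderivWithin_univ]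
  rfl

/-- A constant vector field on the model space. -/
def flatField (u : V) (z : V) : TangentSpace 𝓘(ℝ, V) z := u

theorem mlieBracket_flatField (u v z : V) :
    VectorField.mlieBracket 𝓘(ℝ, V) (flatField u) (flatField v) z = 0 := by
  rw [← VectorField.mlieBracketWithin_univ, VectorField.mlieBracketWithin_eq_lieBracketWithin]
  have h : ∀ u w : V, fderivWithin ℝ (fun _ : V => u) univ z w = 0 := fun u w => by simp
  change fderivWithin ℝ (fun _ : V => v) univ z u - fderivWithin ℝ (fun _ : V => u) univ z v =
    (0 : V)
  rw [h, h, sub_zero]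

/-- Near `y` a coordinate field is the pullback by the chart of a constant field on the model space;
pullback commutes with the bracket, and constant fields commute. -/
theorem mlieBracket_constField [CompleteSpace V] {p y : X}
    (hp : y ∈ (chartAt V p).source) (u v : V) :
    VectorField.mlieBracket 𝓘(ℝ, V) (constField p u) (constField p v) y = 0 := by
  have key : ∀ u : V, constField p u =ᶠ[𝓝 y] VectorField.mpullback 𝓘(ℝ, V) 𝓘(ℝ, V)
      (extChartAt 𝓘(ℝ, V) p) (flatField u) := by
    intro u
    filter_upwards [(chartAt V p).open_source.mem_nhds hp] with w hw
    have hinv : (mfderiv 𝓘(ℝ, V) 𝓘(ℝ, V) (extChartAt 𝓘(ℝ, V) p) w).inverse =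
        fderiv ℝ (transition p w) (chartAt V p w) := by
      rw [mfderiv_extChartAt_eq hw]
      apply ContinuousLinearMap.inverse_eq
      · ext v
        have := fderiv_transition_comp hw (mem_chart_source V w) hw v
        rw [fderiv_transition_self hw] at this
        exact this
      · ext v
        have := fderiv_transition_comp (mem_chart_source V w) hw (mem_chart_source V w) v
        rw [fderiv_transition_self (mem_chart_source V w)] at this
        exact this
    rw [constField_eq_fderiv hw, ← hinv]
    rfl
  rw [Filter.EventuallyEq.mlieBracket_vectorField_eq (key u) (key v)]
  have hc : ∀ (u z : V), MDifferentiableAt 𝓘(ℝ, V) (𝓘(ℝ, V).prod 𝓘(ℝ, V))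
      (fun z : V => (TotalSpace.mk' V z (flatField u z) : TangentBundle 𝓘(ℝ, V) V)) z := fun u z =>
    (contMDiffAt_vectorSpace_iff_contDiffAt (n := 1) (V := flatField u).2
      contDiffAt_const).mdifferentiableAt one_ne_zero
  have h := VectorField.mpullback_mlieBracket (𝕜 := ℝ) (I := 𝓘(ℝ, V)) (I' := 𝓘(ℝ, V)) (n := ω)
    (f := extChartAt 𝓘(ℝ, V) p) (x₀ := y)
    (V := flatField u) (W := flatField v) (hc u _) (hc v _) (contMDiffAt_extChartAt' hp) (by simp)
  refine h.symm.trans ?_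
  rw [VectorField.mpullback_apply]
  rw [mlieBracket_flatField]
  exact map_zero _

end TangentCharts

/-! ### Invariance of the trace $g^{ab}q_{ab}$ under linear changes of basis -/

section GramAlgebra

open Matrix

variable {V W ι : Type*} [AddCommGroup V] [Module ℝ V] [AddCommGroup W] [Module ℝ W]
  [Fintype ι] [DecidableEq ι]

theorem sum_inv_congr (G S : Matrix ι ι ℝ) (hS : IsUnit S.det) (Q : ι → ι → W) :
    ∑ a, ∑ c, ((Sᵀ * G * S)⁻¹ a c) • ∑ i, ∑ j, (S i a * S j c) • Q i j =
      ∑ i, ∑ j, (G⁻¹ i j) • Q i j := by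
  have h1 : S * (Sᵀ * G * S)⁻¹ * Sᵀ = G⁻¹ := by
    rw [Matrix.mul_inv_rev, Matrix.mul_inv_rev]
    have hSt : IsUnit Sᵀ.det := by rwa [Matrix.det_transpose]
    calc S * (S⁻¹ * (G⁻¹ * Sᵀ⁻¹)) * Sᵀ = (S * S⁻¹) * G⁻¹ * (Sᵀ⁻¹ * Sᵀ) := by
          simp only [Matrix.mul_assoc]
      _ = G⁻¹ := by rw [Matrix.mul_nonsing_inv _ hS, Matrix.nonsing_inv_mul _ hSt, one_mul, mul_one]
  have sw : ∀ f : ι → ι → ι → ι → W,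
      ∑ a, ∑ c, ∑ i, ∑ j, f a c i j = ∑ i, ∑ j, ∑ c, ∑ a, f a c i j := fun f => by
    calc _ = ∑ a, ∑ i, ∑ c, ∑ j, f a c i j := Finset.sum_congr rfl fun _ _ => Finset.sum_comm
      _ = ∑ i, ∑ a, ∑ c, ∑ j, f a c i j := Finset.sum_comm
      _ = ∑ i, ∑ a, ∑ j, ∑ c, f a c i j :=
        Finset.sum_congr rfl fun _ _ => Finset.sum_congr rfl fun _ _ => Finset.sum_comm
      _ = ∑ i, ∑ j, ∑ a, ∑ c, f a c i j := Finset.sum_congr rfl fun _ _ => Finset.sum_comm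
      _ = _ := Finset.sum_congr rfl fun _ _ => Finset.sum_congr rfl fun _ _ => Finset.sum_comm
  simp only [Finset.smul_sum]
  rw [sw]
  refine Finset.sum_congr rfl fun i _ => Finset.sum_congr rfl fun j _ => ?_
  rw [← h1]
  simp only [Matrix.mul_apply, Matrix.transpose_apply, Finset.sum_mul, Finset.sum_smul, smul_smul]
  refine Finset.sum_congr rfl fun c _ => Finset.sum_congr rfl fun a _ => ?_
  congr 1
  ring

theorem IsBilinearMap.apply_sum_smul {q : V → V → W} (hq : IsBilinearMap ℝ q)
    (s t : ι → ℝ) (b : ι → V) :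
    q (∑ i, s i • b i) (∑ j, t j • b j) = ∑ i, ∑ j, (s i * t j) • q (b i) (b j) := by
  have e : ∀ x y, q x y = hq.toLinearMap x y := fun _ _ => rfl
  simp only [e]
  simp only [map_sum, LinearMap.sum_apply, map_smul, LinearMap.smul_apply, Finset.smul_sum,
    smul_smul]
  rw [Finset.sum_comm]
  simp only [mul_comm]

/-- With `S` the matrix of `T`, the Gram matrix becomes $S^{T}GS$ and its inverse
$S^{-1}G^{-1}S^{-T}$, which cancels the two factors of `S` in `q`. Used both with a change of chart
and with `T` equal to the complex structure. -/
theorem sum_gram_inv_comp (b : Module.Basis ι ℝ V) (B : V → V → ℝ) (hB : IsBilinearMap ℝ B)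
    (q : V → V → W) (hq : IsBilinearMap ℝ q) (T : V →ₗ[ℝ] V) (hT : Function.Injective T) :
    ∑ a, ∑ c, ((Matrix.of fun a c => B (T (b a)) (T (b c)))⁻¹ a c) • q (T (b a)) (T (b c)) =
      ∑ a, ∑ c, ((Matrix.of fun a c => B (b a) (b c))⁻¹ a c) • q (b a) (b c) := by
  set S := LinearMap.toMatrix b b T with hSdef
  have hTb : ∀ a, T (b a) = ∑ i, S i a • b i := fun a => by
    conv_lhs => rw [← b.sum_repr (T (b a))]
    simp [hSdef, LinearMap.toMatrix_apply]
  have hG : (Matrix.of fun a c => B (T (b a)) (T (b c))) =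
      Sᵀ * (Matrix.of fun a c => B (b a) (b c)) * S := by
    ext a c
    rw [Matrix.of_apply, hTb, hTb, IsBilinearMap.apply_sum_smul hB]
    simp only [Matrix.mul_apply, Matrix.transpose_apply, Matrix.of_apply, Finset.sum_mul, smul_eq_mul]
    rw [Finset.sum_comm]
    exact Finset.sum_congr rfl fun i _ => Finset.sum_congr rfl fun j _ => by ring
  have hS : IsUnit S.det := by
    have := Module.Finite.of_basis b
    exact LinearEquiv.isUnit_det (LinearEquiv.ofInjectiveEndo T hT) b b
  rw [hG, ← sum_inv_congr (Matrix.of fun a c => B (b a) (b c)) S hS fun i j => q (b i) (b j)]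
  exact Finset.sum_congr rfl fun a _ => Finset.sum_congr rfl fun c _ => by
    rw [hTb, hTb, IsBilinearMap.apply_sum_smul hq]

end GramAlgebra

/-! ### The metric trace and the contraction on tangent spaces -/

section MetricTrace

variable {V : Type*} [NormedAddCommGroup V] [NormedSpace ℂ V] [FiniteDimensional ℂ V]
  {X : Type*} [TopologicalSpace X] [ChartedSpace V X] [IsManifold 𝓘(ℂ, V) ω X]
  {W : Type*} [AddCommGroup W] [Module ℂ W]

/-- The trace of a bilinear form on `T_x X` with respect to the metric. -/
def metricTrace (g : KahlerMetric V X) (x : X) (q : V → V → W) : W :=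
  ∑ a, ∑ b, ((gram g x x)⁻¹ a b) • q (modelBasis V a) (modelBasis V b)

theorem coordField_eq_constField (p y : X) (a : Fin (Module.finrank ℝ V)) :
    coordField p a y = constField p (modelBasis V a) y := rfl

theorem contract_eq_metricTrace (g : KahlerMetric V X) (x : X)
    (γ : TangentSpace 𝓘(ℝ, V) x → TangentSpace 𝓘(ℝ, V) x → W) :
    contract g x γ = (1 / 2 : ℂ) • metricTrace g x (fun u v => γ u (Complex.I • v : V)) := by
  unfold contract metricTrace
  simp only [coordField_eq_constField, constField_self, Complex.coe_smul]
  rfl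

/-- The metric at `y` as a form on the model space. -/
def metricForm (g : KahlerMetric V X) (y : X) (u v : V) : ℝ :=
  g.inner y (show TangentSpace 𝓘(ℝ, V) y from u) (show TangentSpace 𝓘(ℝ, V) y from v)

theorem isBilinearMap_metricForm (g : KahlerMetric V X) (y : X) :
    IsBilinearMap ℝ (metricForm g y) where
  add_left a b c := by
    have := congrArg (fun f => f c) ((g.inner y).map_add a b)
    exact this
  smul_left r a c := by
    have := congrArg (fun f => f c) ((g.inner y).map_smul r a)
    exact this
  add_right a b c := (g.inner y a).map_add b c
  smul_right r a c := (g.inner y a).map_smul r c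

theorem gram_apply (g : KahlerMetric V X) {p y : X} (hp : y ∈ (chartAt V p).source)
    (a b : Fin (Module.finrank ℝ V)) :
    gram g p y a b = metricForm g y (fderiv ℝ (transition p y) (chartAt V p y) (modelBasis V a))
      (fderiv ℝ (transition p y) (chartAt V p y) (modelBasis V b)) := by
  unfold gram metricForm
  rw [Matrix.of_apply, coordField_eq_constField, coordField_eq_constField,
    constField_eq_fderiv hp, constField_eq_fderiv hp]

theorem fderiv_transition_injective {p q y : X} (hp : y ∈ (chartAt V p).source)
    (hq : y ∈ (chartAt V q).source) :
    Function.Injective (fderiv ℝ (transition p q) (chartAt V p y)) := by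
  intro u v h
  have h2 := congrArg (fderiv ℝ (transition q p) (chartAt V q y)) h
  rwa [fderiv_transition_comp hp hq hp, fderiv_transition_comp hp hq hp,
    fderiv_transition_self hp] at h2

theorem gram_self_apply (g : KahlerMetric V X) (x : X) (a b : Fin (Module.finrank ℝ V)) :
    gram g x x a b = metricForm g x (modelBasis V a) (modelBasis V b) := by
  rw [gram_apply g (mem_chart_source V x), fderiv_transition_self (mem_chart_source V x)]
  rfl

theorem gram_self_eq (g : KahlerMetric V X) (x : X) :
    gram g x x = Matrix.of fun a b => metricForm g x (modelBasis V a) (modelBasis V b) := by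
  ext a b
  exact gram_self_apply g x a b

theorem metricTrace_eq_chart (g : KahlerMetric V X) {p y : X} (hp : y ∈ (chartAt V p).source)
    (q : V → V → W) (hq : IsBilinearMap ℝ q) :
    metricTrace g y q = ∑ a, ∑ b, ((gram g p y)⁻¹ a b) •
      q (constField p (modelBasis V a) y) (constField p (modelBasis V b) y) := by
  have h := sum_gram_inv_comp (modelBasis V) (metricForm g y) (isBilinearMap_metricForm g y) q hq
    (fderiv ℝ (transition p y) (chartAt V p y)).toLinearMap
    (fderiv_transition_injective hp (mem_chart_source V y))
  unfold metricTrace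
  rw [gram_self_eq, ← h]
  have hg : gram g p y = Matrix.of fun a b => metricForm g y
      ((fderiv ℝ (transition p y) (chartAt V p y)).toLinearMap (modelBasis V a))
      ((fderiv ℝ (transition p y) (chartAt V p y)).toLinearMap (modelBasis V b)) := by
    ext a b
    exact gram_apply g hp a b
  rw [hg]
  simp only [constField_eq_fderiv hp]
  rfl

/-- The complex structure is an isometry, so the change of basis by it leaves the Gram matrix
unchanged. -/
theorem metricTrace_smul_I (g : KahlerMetric V X) (x : X)
    (q : V → V → W) (hq : IsBilinearMap ℝ q) :
    metricTrace g x (fun u v => q (Complex.I • u) (Complex.I • v)) = metricTrace g x q := by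
  have h := sum_gram_inv_comp (modelBasis V) (metricForm g x) (isBilinearMap_metricForm g x) q hq
    (Complex.I • LinearMap.id) (fun u v h => by simpa using h)
  have hJ : ∀ u v : V, metricForm g x (Complex.I • u) (Complex.I • v) = metricForm g x u v :=
    fun u v => g.orthogonal x u v
  unfold metricTrace
  rw [gram_self_eq, ← h]
  simp only [LinearMap.smul_apply, LinearMap.id_apply, hJ]

theorem gram_comm (g : KahlerMetric V X) (p y : X) (a b : Fin (Module.finrank ℝ V)) :
    gram g p y a b = gram g p y b a := g.symm y _ _

theorem gram_isSymm (g : KahlerMetric V X) (p y : X) : (gram g p y).IsSymm := by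
  ext a b
  exact gram_comm g p y b a

/-- The quadratic form of the Gram matrix evaluates `g` on a combination of coordinate vectors, and
these are independent because the transition derivative is injective. -/
theorem gram_posDef (g : KahlerMetric V X) {p y : X} (hp : y ∈ (chartAt V p).source) :
    (gram g p y).PosDef := by
  set T := fderiv ℝ (transition p y) (chartAt V p y)
  refine Matrix.PosDef.of_dotProduct_mulVec_pos ?_ fun x hx => ?_
  · rw [Matrix.IsHermitian, Matrix.conjTranspose_eq_transpose_of_trivial]
    exact (gram_isSymm g p y).eq
  · have h1 : star x ⬝ᵥ (gram g p y).mulVec x =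
        metricForm g y (∑ a, x a • T (modelBasis V a)) (∑ a, x a • T (modelBasis V a)) := by
      rw [IsBilinearMap.apply_sum_smul (isBilinearMap_metricForm g y)]
      simp only [dotProduct, Matrix.mulVec, gram_apply g hp, Pi.star_apply, star_trivial,
        Finset.mul_sum, smul_eq_mul]
      exact Finset.sum_congr rfl fun a _ => Finset.sum_congr rfl fun b _ => by ring
    rw [h1]
    refine g.pos y _ fun h0 => hx ?_
    have h2 : T (∑ a, x a • modelBasis V a) = T 0 := by
      rw [map_sum, map_zero]
      simp only [map_smul]
      exact h0
    have h3 := fderiv_transition_injective hp (mem_chart_source V y) h2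
    funext a
    exact Fintype.linearIndependent_iff.1 (modelBasis V).linearIndependent x h3 a

theorem gram_inv_comm (g : KahlerMetric V X) (p y : X) (a b : Fin (Module.finrank ℝ V)) :
    (gram g p y)⁻¹ a b = (gram g p y)⁻¹ b a := by
  conv_lhs => rw [← (gram_isSymm g p y).eq, ← Matrix.transpose_nonsing_inv]
  rfl

theorem metricTrace_swap (g : KahlerMetric V X) (x : X) (q : V → V → W) :
    metricTrace g x (fun u v => q v u) = metricTrace g x q := by
  unfold metricTrace
  rw [Finset.sum_comm]
  exact Finset.sum_congr rfl fun a _ => Finset.sum_congr rfl fun b _ => by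
    rw [gram_inv_comm g x x]

theorem metricTrace_add (g : KahlerMetric V X) (x : X) (q q' : V → V → W) :
    metricTrace g x (fun u v => q u v + q' u v) = metricTrace g x q + metricTrace g x q' := by
  simp [metricTrace, Finset.sum_add_distrib]

theorem metricTrace_sub (g : KahlerMetric V X) (x : X) (q q' : V → V → W) :
    metricTrace g x (fun u v => q u v - q' u v) = metricTrace g x q - metricTrace g x q' := by
  simp [metricTrace, Finset.sum_sub_distrib, smul_sub]

theorem metricTrace_map (g : KahlerMetric V X) (x : X) {W' : Type*} [AddCommGroup W'] [Module ℂ W']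
    (f : W →ₗ[ℂ] W') (q : V → V → W) :
    metricTrace g x (fun u v => f (q u v)) = f (metricTrace g x q) := by
  simp only [metricTrace, map_sum]
  exact Finset.sum_congr rfl fun a _ => Finset.sum_congr rfl fun b _ => by
    rw [← Complex.coe_smul, ← Complex.coe_smul, map_smul]

theorem contMDiffAt_gram (g : KahlerMetric V X) {p y : X} (hp : y ∈ (chartAt V p).source)
    (a b : Fin (Module.finrank ℝ V)) :
    ContMDiffAt 𝓘(ℝ, V) 𝓘(ℝ, ℝ) ∞ (fun y => gram g p y a b) y := by
  have := ContMDiffAt.clm_bundle_apply₂ (F₁ := V) (F₂ := V) (F₃ := ℝ)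
    (E₁ := fun x : X => TangentSpace 𝓘(ℝ, V) x) (E₂ := fun x : X => TangentSpace 𝓘(ℝ, V) x)
    (E₃ := Bundle.Trivial X ℝ) (b := fun y : X => y) (g.contMDiff y)
    (contMDiffAt_constField hp (modelBasis V a)) (contMDiffAt_constField hp (modelBasis V b))
  rw [contMDiffAt_totalSpace] at this
  exact this.2

end MetricTrace

/-! ### The Riemannian volume measure in a single chart -/

section Volume

open scoped ENNReal

variable {V : Type*} [NormedAddCommGroup V] [NormedSpace ℂ V] [FiniteDimensional ℂ V]
  {X : Type*} [TopologicalSpace X] [ChartedSpace V X] [IsManifold 𝓘(ℂ, V) ω X]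

theorem gram_eq_chart (g : KahlerMetric V X) {p q y : X} (hp : y ∈ (chartAt V p).source)
    (hq : y ∈ (chartAt V q).source) :
    gram g p y = (LinearMap.toMatrix (modelBasis V) (modelBasis V)
      (fderiv ℝ (transition p q) (chartAt V p y)).toLinearMap).transpose * gram g q y *
      LinearMap.toMatrix (modelBasis V) (modelBasis V)
      (fderiv ℝ (transition p q) (chartAt V p y)).toLinearMap := by
  set S := LinearMap.toMatrix (modelBasis V) (modelBasis V)
      (fderiv ℝ (transition p q) (chartAt V p y)).toLinearMap with hS
  have hb : ∀ a, fderiv ℝ (transition p y) (chartAt V p y) (modelBasis V a) =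
      ∑ i, S i a • fderiv ℝ (transition q y) (chartAt V q y) (modelBasis V i) := fun a => by
    rw [← fderiv_transition_comp hp hq (mem_chart_source V y)]
    conv_lhs => rw [← (modelBasis V).sum_repr
      (fderiv ℝ (transition p q) (chartAt V p y) (modelBasis V a)), map_sum]
    simp only [map_smul, hS, LinearMap.toMatrix_apply]
    rfl
  ext a c
  rw [gram_apply g hp, hb, hb, IsBilinearMap.apply_sum_smul (isBilinearMap_metricForm g y)]
  simp only [Matrix.mul_apply, Matrix.transpose_apply, Finset.sum_mul, smul_eq_mul, gram_apply g hq]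
  rw [Finset.sum_comm]
  exact Finset.sum_congr rfl fun i _ => Finset.sum_congr rfl fun j _ => by ring

/-- The determinant of $S^{T}GS$ is $(\det S)^2\det G$; this is the density transformation that
matches the change of variables formula. -/
theorem sqrt_det_gram_eq (g : KahlerMetric V X) {p q y : X} (hp : y ∈ (chartAt V p).source)
    (hq : y ∈ (chartAt V q).source) :
    Real.sqrt (gram g p y).det =
      |(fderiv ℝ (transition p q) (chartAt V p y)).det| * Real.sqrt (gram g q y).det := by
  rw [gram_eq_chart g hp hq, Matrix.det_mul, Matrix.det_mul, Matrix.det_transpose,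
    LinearMap.det_toMatrix, mul_comm (LinearMap.det _) (Matrix.det _), mul_assoc, ← pow_two,
    Real.sqrt_mul (gram_posDef g hq).det_pos.le, Real.sqrt_sq_eq_abs, mul_comm]

theorem contDiffOn_comp_chart_symm {W : Type*} [NormedAddCommGroup W] [NormedSpace ℝ W]
    {n : ℕ∞ω} {f : X → W} {p : X}
    (hf : ∀ y ∈ (chartAt V p).source, ContMDiffAt 𝓘(ℝ, V) 𝓘(ℝ, W) n f y) :
    ContDiffOn ℝ n (fun z => f ((chartAt V p).symm z)) (chartAt V p).target := by
  rw [← contMDiffOn_iff_contDiffOn]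
  have h := contMDiffOn_extChartAt_symm (I := 𝓘(ℝ, V)) (n := n) p
  have ht : (extChartAt 𝓘(ℝ, V) p).target = (chartAt V p).target := by simp [mfld_simps]
  rw [ht] at h
  intro z hz
  exact (hf _ ((chartAt V p).map_target hz)).comp_contMDiffWithinAt z (h z hz)

theorem contDiffOn_gram (g : KahlerMetric V X) (p : X) (a b : Fin (Module.finrank ℝ V)) :
    ContDiffOn ℝ ∞ (fun z => gram g p ((chartAt V p).symm z) a b) (chartAt V p).target :=
  contDiffOn_comp_chart_symm fun _ hy => contMDiffAt_gram g hy a b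

theorem continuousOn_sqrt_det_gram (g : KahlerMetric V X) (p : X) :
    ContinuousOn (fun z => Real.sqrt (gram g p ((chartAt V p).symm z)).det)
      (chartAt V p).target := by
  refine Real.continuous_sqrt.comp_continuousOn ?_
  simp only [Matrix.det_apply]
  refine continuousOn_finsetSum _ fun σ _ => ContinuousOn.const_smul ?_ _
  exact continuousOn_finsetProd _ fun i _ => (contDiffOn_gram g p _ _).continuousOn

variable [MeasurableSpace V] [BorelSpace V]

/-- The Riemannian volume density of the chart at `p` as a function on the model space. -/
def volumeDensity (g : KahlerMetric V X) (p : X) (z : V) : ℝ≥0∞ :=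
  ENNReal.ofReal (Real.sqrt (gram g p ((chartAt V p).symm z)).det)

theorem measurableSet_target_inter_preimage [MeasurableSpace X] [BorelSpace X] (p : X)
    {S : Set X} (hS : MeasurableSet S) :
    MeasurableSet ((chartAt V p).target ∩ (chartAt V p).symm ⁻¹' S) := by
  have h := MeasurableSet.subtype_image (chartAt V p).open_target.measurableSet
    ((chartAt V p).continuousOn_symm.domRestrict.measurable hS)
  convert h using 1
  ext z
  simp [mem_image, and_comm]

theorem lintegral_chart_eq (g : KahlerMetric V X) [MeasurableSpace X] [BorelSpace X] (p q : X)
    {S : Set X} (hS : MeasurableSet S)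
    (hp : S ⊆ (chartAt V p).source) (hq : S ⊆ (chartAt V q).source) (f : X → ℝ≥0∞) :
    ∫⁻ z in (chartAt V q).target ∩ (chartAt V q).symm ⁻¹' S,
        f ((chartAt V q).symm z) * volumeDensity g q z ∂(modelBasis V).addHaar =
      ∫⁻ z in (chartAt V p).target ∩ (chartAt V p).symm ⁻¹' S,
        f ((chartAt V p).symm z) * volumeDensity g p z ∂(modelBasis V).addHaar := by
  have hmeas : MeasurableSet ((chartAt V p).target ∩ (chartAt V p).symm ⁻¹' S) :=
    measurableSet_target_inter_preimage p hS
  have himage : (chartAt V q).target ∩ (chartAt V q).symm ⁻¹' S =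
      transition p q '' ((chartAt V p).target ∩ (chartAt V p).symm ⁻¹' S) := by
    ext z
    constructor
    · rintro ⟨hz, hzS⟩
      refine ⟨chartAt V p ((chartAt V q).symm z), ⟨(chartAt V p).map_source (hp hzS), ?_⟩, ?_⟩
      · rw [mem_preimage, (chartAt V p).left_inv (hp hzS)]
        exact hzS
      · rw [transition_apply (hp hzS), (chartAt V q).right_inv hz]
    · rintro ⟨w, ⟨hw, hwS⟩, rfl⟩
      refine ⟨(chartAt V q).map_source (hq hwS), ?_⟩
      rw [mem_preimage]
      simp only [transition, Function.comp_apply]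
      rw [(chartAt V q).left_inv (hq hwS)]
      exact hwS
  rw [himage, lintegral_image_eq_lintegral_abs_det_fderiv_mul _ hmeas
    (f' := fun w => fderiv ℝ (transition p q) w)]
  · refine setLIntegral_congr_fun hmeas fun w hw => ?_
    have hy := hp hw.2
    have hy' := hq hw.2
    have hw' : chartAt V p ((chartAt V p).symm w) = w := (chartAt V p).right_inv hw.1
    have hd := sqrt_det_gram_eq g hy hy'
    rw [hw'] at hd
    have ht : (chartAt V q).symm (transition p q w) = (chartAt V p).symm w := by
      simp only [transition, Function.comp_apply]
      exact (chartAt V q).left_inv hy'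
    simp only [volumeDensity, ht]
    rw [hd, ENNReal.ofReal_mul (abs_nonneg _)]
    ring
  · intro w hw
    have := (transition_differentiableAt (hp hw.2) (hq hw.2)).hasFDerivAt
    rw [(chartAt V p).right_inv hw.1] at this
    exact this.hasFDerivWithinAt
  · intro w hw w' hw' h
    simp only [transition, Function.comp_apply] at h
    exact (chartAt V p).symm.injOn hw.1 hw'.1 ((chartAt V q).injOn (hq hw.2) (hq hw'.2) h)

variable [T2Space X] [CompactSpace X]

theorem chartPartition_isSubordinate :
    (chartPartition V X).IsSubordinate fun x => (chartAt V x).source :=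
  (SmoothPartitionOfUnity.exists_isSubordinate_chartAt_source 𝓘(ℝ, V) X).choose_spec

theorem finite_chartPartition : {i | (Function.support (chartPartition V X i)).Nonempty}.Finite :=
  (chartPartition V X).locallyFinite.finite_nonempty_of_compact

variable (V X) in
/-- The indices of the non-zero functions of the partition of unity. -/
def partitionIndices : Finset X := (finite_chartPartition (V := V) (X := X)).toFinset

theorem chartPartition_eq_zero {i : X} (hi : i ∉ partitionIndices V X) (x : X) :
    chartPartition V X i x = 0 := by
  by_contra h
  exact hi ((finite_chartPartition).mem_toFinset.2 ⟨x, h⟩)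

theorem sum_chartPartition (x : X) : ∑ i ∈ partitionIndices V X, chartPartition V X i x = 1 := by
  rw [← (chartPartition V X).sum_eq_one (mem_univ x)]
  refine (finsum_eq_sum_of_support_subset _ fun i hi => ?_).symm
  exact (finite_chartPartition).mem_toFinset.2 ⟨x, hi⟩

theorem chartPartition_eq_zero_of_notMem {i x : X} (hx : x ∉ (chartAt V i).source) :
    chartPartition V X i x = 0 := by
  by_contra h
  exact hx (chartPartition_isSubordinate i (subset_tsupport _ h))

variable [MeasurableSpace X] [BorelSpace X]

theorem aemeasurable_chart_symm (μ : Measure V) (p : X) :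
    AEMeasurable (chartAt V p).symm (μ.restrict (chartAt V p).target) :=
  (chartAt V p).continuousOn_symm.aemeasurable (chartAt V p).open_target.measurableSet

theorem aemeasurable_volumeDensity (g : KahlerMetric V X) (p : X) :
    AEMeasurable (volumeDensity g p) ((modelBasis V).addHaar.restrict (chartAt V p).target) :=
  ((continuousOn_sqrt_det_gram g p).aemeasurable
    (chartAt V p).open_target.measurableSet).ennreal_ofReal

theorem map_withDensity_apply (p : X) {f : V → ℝ≥0∞} {S : Set X}
    (hS : MeasurableSet S) :
    (((modelBasis V).addHaar.restrict (chartAt V p).target).withDensity f).map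
      (chartAt V p).symm S =
      ∫⁻ z in (chartAt V p).target ∩ (chartAt V p).symm ⁻¹' S, f z ∂(modelBasis V).addHaar := by
  have hm := measurableSet_target_inter_preimage (V := V) p hS
  rw [Measure.map_apply_of_aemeasurable
    ((aemeasurable_chart_symm _ p).mono_ac (withDensity_absolutelyContinuous _ _)) hS]
  have hae : ((chartAt V p).symm ⁻¹' S : Set V) =ᵐ[((modelBasis V).addHaar.restrict
      (chartAt V p).target).withDensity f]
      ((chartAt V p).target ∩ (chartAt V p).symm ⁻¹' S : Set V) := by
    have h1 : ∀ᵐ z ∂((modelBasis V).addHaar.restrict (chartAt V p).target).withDensity f,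
        z ∈ (chartAt V p).target :=
      (withDensity_absolutelyContinuous _ _).ae_le
        (ae_restrict_mem (chartAt V p).open_target.measurableSet)
    filter_upwards [h1] with z hz
    exact propext ⟨fun h => ⟨hz, h⟩, fun h => h.2⟩
  rw [measure_congr hae, withDensity_apply _ hm, Measure.restrict_restrict hm,
    inter_comm _ (chartAt V p).target, ← inter_assoc, inter_self]

theorem continuousOn_chartPartition_comp (i p : X) :
    ContinuousOn (fun z => chartPartition V X i ((chartAt V p).symm z)) (chartAt V p).target :=
  (chartPartition V X i).contMDiff.continuous.comp_continuousOn (chartAt V p).continuousOn_symm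

theorem kahlerVolume_apply (g : KahlerMetric V X) {S : Set X} (hS : MeasurableSet S) :
    kahlerVolume g S = ∑ i ∈ partitionIndices V X,
      ∫⁻ z in (chartAt V i).target ∩ (chartAt V i).symm ⁻¹' S,
        ENNReal.ofReal (chartPartition V X i ((chartAt V i).symm z)) * volumeDensity g i z
        ∂(modelBasis V).addHaar := by
  have h : ∀ i : X, (((modelBasis V).addHaar.restrict (chartAt V i).target).withDensity fun z =>
      ENNReal.ofReal (chartPartition V X i ((chartAt V i).symm z) *
        Real.sqrt (gram g i ((chartAt V i).symm z)).det)).map (chartAt V i).symm S =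
      ∫⁻ z in (chartAt V i).target ∩ (chartAt V i).symm ⁻¹' S,
        ENNReal.ofReal (chartPartition V X i ((chartAt V i).symm z)) * volumeDensity g i z
        ∂(modelBasis V).addHaar := fun i => by
    rw [map_withDensity_apply i hS]
    simp only [volumeDensity]
    refine lintegral_congr fun z => ?_
    rw [ENNReal.ofReal_mul ((chartPartition V X).nonneg i _)]
  unfold kahlerVolume
  rw [Measure.sum_apply _ hS, tsum_eq_sum (s := partitionIndices V X)]
  · exact Finset.sum_congr rfl fun i _ => h i
  · intro i hi
    rw [h i]
    simp [chartPartition_eq_zero hi]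

/-- Frees the measure from the partition of unity: each term is carried to the chart at `p` by the
change of variables, and there the functions of the partition sum to one. -/
theorem kahlerVolume_apply_of_subset (g : KahlerMetric V X) {S : Set X} (hS : MeasurableSet S)
    {p : X} (hp : S ⊆ (chartAt V p).source) :
    kahlerVolume g S = ∫⁻ z in (chartAt V p).target ∩ (chartAt V p).symm ⁻¹' S,
        volumeDensity g p z ∂(modelBasis V).addHaar := by
  have hm := measurableSet_target_inter_preimage (V := V) p hS
  have key : ∀ i : X, ∫⁻ z in (chartAt V i).target ∩ (chartAt V i).symm ⁻¹' S,
        ENNReal.ofReal (chartPartition V X i ((chartAt V i).symm z)) * volumeDensity g i z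
        ∂(modelBasis V).addHaar = ∫⁻ z in (chartAt V p).target ∩ (chartAt V p).symm ⁻¹' S,
        ENNReal.ofReal (chartPartition V X i ((chartAt V p).symm z)) * volumeDensity g p z
        ∂(modelBasis V).addHaar := fun i => by
    -- The `i`-th function vanishes off the domain of the chart at `i`, so each side may be
    -- restricted to the overlap, where the change of variables applies.
    have hsplit : ∀ q : X, ∫⁻ z in (chartAt V q).target ∩ (chartAt V q).symm ⁻¹' S,
        ENNReal.ofReal (chartPartition V X i ((chartAt V q).symm z)) * volumeDensity g q z
        ∂(modelBasis V).addHaar = ∫⁻ z in (chartAt V q).target ∩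
          (chartAt V q).symm ⁻¹' (S ∩ (chartAt V i).source),
        ENNReal.ofReal (chartPartition V X i ((chartAt V q).symm z)) * volumeDensity g q z
        ∂(modelBasis V).addHaar := fun q => by
      rw [← lintegral_indicator (measurableSet_target_inter_preimage q hS), ← lintegral_indicator
        (measurableSet_target_inter_preimage q (hS.inter (chartAt V i).open_source.measurableSet))]
      refine lintegral_congr fun z => ?_
      by_cases hz : (chartAt V q).symm z ∈ (chartAt V i).source
      · by_cases hzS : z ∈ (chartAt V q).target ∩ (chartAt V q).symm ⁻¹' S
        · rw [indicator_of_mem hzS, indicator_of_mem (show z ∈ (chartAt V q).target ∩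
            (chartAt V q).symm ⁻¹' (S ∩ (chartAt V i).source) from ⟨hzS.1, hzS.2, hz⟩)]
        · rw [indicator_of_notMem hzS, indicator_of_notMem fun h => hzS ⟨h.1, h.2.1⟩]
      · rw [indicator_apply_eq_zero.2, indicator_apply_eq_zero.2] <;>
        · intro _
          simp [chartPartition_eq_zero_of_notMem hz]
    rw [hsplit i, hsplit p]
    exact lintegral_chart_eq g p i (hS.inter (chartAt V i).open_source.measurableSet)
      (inter_subset_left.trans hp) inter_subset_right
      fun x => ENNReal.ofReal (chartPartition V X i x)
  rw [kahlerVolume_apply g hS, Finset.sum_congr rfl fun i _ => key i, ← lintegral_finsetSum']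
  · refine lintegral_congr fun z => ?_
    rw [← Finset.sum_mul, ← ENNReal.ofReal_sum_of_nonneg
      fun i _ => (chartPartition V X).nonneg i _, sum_chartPartition]
    simp
  · intro i _
    refine AEMeasurable.mono_measure ?_ (Measure.restrict_mono inter_subset_left le_rfl)
    exact (((continuousOn_chartPartition_comp i p).aemeasurable
      (chartAt V p).open_target.measurableSet).ennreal_ofReal).mul (aemeasurable_volumeDensity g p)

theorem kahlerVolume_restrict_source (g : KahlerMetric V X) (p : X) :
    (kahlerVolume g).restrict (chartAt V p).source =
      (((modelBasis V).addHaar.restrict (chartAt V p).target).withDensity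
        (volumeDensity g p)).map (chartAt V p).symm := by
  ext S hS
  have hs : MeasurableSet (chartAt V p).source := (chartAt V p).open_source.measurableSet
  rw [Measure.restrict_apply hS, kahlerVolume_apply_of_subset g (hS.inter hs) inter_subset_right,
    map_withDensity_apply p hS]
  congr 2
  ext z
  simp only [mem_inter_iff, mem_preimage]
  exact ⟨fun h => ⟨h.1, h.2.1⟩, fun h => ⟨h.1, h.2, (chartAt V p).map_target h.1⟩⟩

/-- Only finitely many functions of the partition are non-zero, and each has compact support inside
its chart, on which the continuous density is bounded. -/
instance isFiniteMeasure_kahlerVolume (g : KahlerMetric V X) :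
    IsFiniteMeasure (kahlerVolume g) := by
  refine ⟨?_⟩
  rw [kahlerVolume_apply g MeasurableSet.univ]
  refine ENNReal.sum_lt_top.2 fun i _ => ?_
  set K : Set V := chartAt V i '' tsupport (chartPartition V X i) with hK
  have hsub : tsupport (chartPartition V X i) ⊆ (chartAt V i).source :=
    chartPartition_isSubordinate i
  have hKc : IsCompact K := (isClosed_tsupport _).isCompact.image_of_continuousOn
    ((chartAt V i).continuousOn.mono hsub)
  have hKt : K ⊆ (chartAt V i).target := by
    rintro _ ⟨x, hx, rfl⟩
    exact (chartAt V i).map_source (hsub hx)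
  obtain ⟨C, hC⟩ := hKc.exists_bound_of_continuousOn
    ((continuousOn_sqrt_det_gram g i).mono hKt)
  have hle : ∀ z ∈ (chartAt V i).target,
      ENNReal.ofReal (chartPartition V X i ((chartAt V i).symm z)) * volumeDensity g i z ≤
        K.indicator (fun _ => ENNReal.ofReal C) z := fun z hz => by
    by_cases hzK : z ∈ K
    · rw [indicator_of_mem hzK]
      calc _ ≤ 1 * ENNReal.ofReal C := by
            refine mul_le_mul' ?_ (ENNReal.ofReal_le_ofReal ((le_abs_self _).trans (hC z hzK)))
            rw [← ENNReal.ofReal_one]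
            exact ENNReal.ofReal_le_ofReal ((chartPartition V X).le_one i _)
        _ = _ := one_mul _
    · have h0 : chartPartition V X i ((chartAt V i).symm z) = 0 := by
        by_contra h
        exact hzK ⟨_, subset_tsupport _ h, (chartAt V i).right_inv hz⟩
      simp [h0]
  calc _ ≤ ∫⁻ z in (chartAt V i).target, K.indicator (fun _ => ENNReal.ofReal C) z
        ∂(modelBasis V).addHaar := by
        rw [preimage_univ, inter_univ]
        exact setLIntegral_mono' (chartAt V i).open_target.measurableSet hle
    _ ≤ ∫⁻ z, K.indicator (fun _ => ENNReal.ofReal C) z ∂(modelBasis V).addHaar :=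
        setLIntegral_le_lintegral _ _
    _ < ⊤ := by
        rw [lintegral_indicator hKc.measurableSet, setLIntegral_const]
        exact ENNReal.mul_lt_top ENNReal.ofReal_lt_top hKc.measure_lt_top

theorem integral_kahlerVolume_eq (g : KahlerMetric V X) (p : X) {f : X → ℂ} (hf : Continuous f)
    (hsupp : ∀ x ∉ (chartAt V p).source, f x = 0) :
    ∫ x, f x ∂(kahlerVolume g) = ∫ z in (chartAt V p).target,
      Real.sqrt (gram g p ((chartAt V p).symm z)).det • f ((chartAt V p).symm z)
        ∂(modelBasis V).addHaar := by
  rw [← setIntegral_eq_integral_of_forall_compl_eq_zero hsupp, kahlerVolume_restrict_source,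
    integral_map ((aemeasurable_chart_symm _ p).mono_ac (withDensity_absolutelyContinuous _ _))
      hf.aestronglyMeasurable]
  rw [integral_withDensity_eq_integral_toReal_smul₀ (aemeasurable_volumeDensity g p)
    (ae_of_all _ fun _ => ENNReal.ofReal_lt_top)]
  refine integral_congr_ae (ae_of_all _ fun z => ?_)
  simp only [volumeDensity]
  rw [ENNReal.toReal_ofReal (Real.sqrt_nonneg _)]

end Volume

/-! ### Entrywise calculus of matrix-valued functions -/

section MatrixCalculus

variable {V ι 𝕜 : Type*} [NormedAddCommGroup V] [NormedSpace ℝ V] [Fintype ι] [DecidableEq ι]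
  [RCLike 𝕜]

/-- A matrix-valued function all of whose entries are `C^n` within `s` at `z`. -/
def MatrixContDiffWithinAt (n : ℕ∞ω) (A : V → Matrix ι ι 𝕜) (s : Set V) (z : V) : Prop :=
  ∀ i j, ContDiffWithinAt ℝ n (fun z => A z i j) s z

/-- A matrix-valued function all of whose entries are differentiable at `z`. -/
def MatrixDifferentiableAt (A : V → Matrix ι ι 𝕜) (z : V) : Prop :=
  ∀ i j, DifferentiableAt ℝ (fun z => A z i j) z

/-- The entrywise directional derivative of a matrix-valued function. -/
def matrixDeriv (A : V → Matrix ι ι 𝕜) (z u : V) : Matrix ι ι 𝕜 :=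
  Matrix.of fun i j => fderiv ℝ (fun z => A z i j) z u

variable {n : ℕ∞ω} {A B : V → Matrix ι ι 𝕜} {s : Set V} {z : V}

theorem matrixDeriv_apply (i j : ι) (u : V) :
    matrixDeriv A z u i j = fderiv ℝ (fun z => A z i j) z u := rfl

theorem MatrixContDiffWithinAt.differentiableAt (hA : MatrixContDiffWithinAt n A univ z)
    (hn : n ≠ 0) : MatrixDifferentiableAt A z := fun i j =>
  (contDiffWithinAt_univ.1 (hA i j)).differentiableAt hn

theorem MatrixContDiffWithinAt.mul (hA : MatrixContDiffWithinAt n A s z)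
    (hB : MatrixContDiffWithinAt n B s z) :
    MatrixContDiffWithinAt n (fun z => A z * B z) s z := fun i j => by
  simp only [Matrix.mul_apply]
  exact ContDiffWithinAt.sum fun k _ => (hA i k).mul (hB k j)

theorem MatrixContDiffWithinAt.add (hA : MatrixContDiffWithinAt n A s z)
    (hB : MatrixContDiffWithinAt n B s z) :
    MatrixContDiffWithinAt n (fun z => A z + B z) s z := fun i j => (hA i j).add (hB i j)

theorem MatrixContDiffWithinAt.sub (hA : MatrixContDiffWithinAt n A s z)
    (hB : MatrixContDiffWithinAt n B s z) :
    MatrixContDiffWithinAt n (fun z => A z - B z) s z := fun i j => (hA i j).sub (hB i j)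

theorem MatrixContDiffWithinAt.const_smul (c : 𝕜) (hA : MatrixContDiffWithinAt n A s z) :
    MatrixContDiffWithinAt n (fun z => c • A z) s z := fun i j =>
  (contDiffWithinAt_const (c := c)).mul (hA i j)

theorem contDiff_star : ContDiff ℝ n (fun c : 𝕜 => star c) :=
  (RCLike.conjCLE (K := 𝕜)).contDiff

theorem MatrixContDiffWithinAt.conjTranspose (hA : MatrixContDiffWithinAt n A s z) :
    MatrixContDiffWithinAt n (fun z => (A z).conjTranspose) s z := fun i j =>
  contDiff_star.contDiffAt.comp_contDiffWithinAt z (hA j i)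

theorem MatrixContDiffWithinAt.trace (hA : MatrixContDiffWithinAt n A s z) :
    ContDiffWithinAt ℝ n (fun z => (A z).trace) s z :=
  ContDiffWithinAt.sum fun i _ => hA i i

theorem MatrixContDiffWithinAt.det (hA : MatrixContDiffWithinAt n A s z) :
    ContDiffWithinAt ℝ n (fun z => (A z).det) s z := by
  simp only [Matrix.det_apply]
  refine ContDiffWithinAt.sum fun σ _ => ?_
  have h : ContDiffWithinAt ℝ n (fun z => ∏ i, A z (σ i) i) s z :=
    contDiffWithinAt_prod fun i _ => hA (σ i) i
  rcases Int.units_eq_one_or (Equiv.Perm.sign σ) with h1 | h1 <;> rw [h1]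
  · simpa using h
  · simpa using h.neg

theorem MatrixContDiffWithinAt.inv (hA : MatrixContDiffWithinAt n A s z) (h0 : (A z).det ≠ 0) :
    MatrixContDiffWithinAt n (fun z => (A z)⁻¹) s z := fun i j => by
  simp only [Matrix.inv_def, Ring.inverse_eq_inv', Matrix.smul_apply, smul_eq_mul,
    Matrix.adjugate_apply]
  refine (hA.det.inv h0).mul (MatrixContDiffWithinAt.det fun k l => ?_)
  simp only [Matrix.updateRow_apply]
  split_ifs
  · exact contDiffWithinAt_const
  · exact hA k l

theorem matrixDeriv_mul (hA : MatrixDifferentiableAt A z) (hB : MatrixDifferentiableAt B z)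
    (u : V) :
    matrixDeriv (fun z => A z * B z) z u = matrixDeriv A z u * B z + A z * matrixDeriv B z u := by
  ext i j
  simp only [matrixDeriv_apply, Matrix.mul_apply, Matrix.add_apply]
  have h := HasFDerivAt.fun_sum (u := Finset.univ) fun k _ =>
    (hA i k).hasFDerivAt.fun_mul (hB k j).hasFDerivAt
  refine (congrArg (fun f => f u) h.fderiv).trans ?_
  simp only [sum_apply, ← Finset.sum_add_distrib]
  refine Finset.sum_congr rfl fun k _ => ?_
  simp only [add_apply, smul_apply, smul_eq_mul]
  ring

theorem MatrixDifferentiableAt.mul (hA : MatrixDifferentiableAt A z)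
    (hB : MatrixDifferentiableAt B z) : MatrixDifferentiableAt (fun z => A z * B z) z :=
  fun i j => by
  simp only [Matrix.mul_apply]
  exact DifferentiableAt.fun_sum fun k _ => (hA i k).mul (hB k j)

theorem MatrixDifferentiableAt.add (hA : MatrixDifferentiableAt A z)
    (hB : MatrixDifferentiableAt B z) : MatrixDifferentiableAt (fun z => A z + B z) z :=
  fun i j => (hA i j).add (hB i j)

theorem MatrixDifferentiableAt.sub (hA : MatrixDifferentiableAt A z)
    (hB : MatrixDifferentiableAt B z) : MatrixDifferentiableAt (fun z => A z - B z) z :=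
  fun i j => (hA i j).sub (hB i j)

theorem MatrixDifferentiableAt.const_smul (c : 𝕜) (hA : MatrixDifferentiableAt A z) :
    MatrixDifferentiableAt (fun z => c • A z) z :=
  fun i j => (differentiableAt_const c).mul (hA i j)

theorem MatrixDifferentiableAt.conjTranspose (hA : MatrixDifferentiableAt A z) :
    MatrixDifferentiableAt (fun z => (A z).conjTranspose) z := fun i j =>
  ((contDiff_star (n := 1)).contDiffAt.differentiableAt one_ne_zero).comp z (hA j i)

theorem matrixDeriv_add (hA : MatrixDifferentiableAt A z) (hB : MatrixDifferentiableAt B z)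
    (u : V) :
    matrixDeriv (fun z => A z + B z) z u = matrixDeriv A z u + matrixDeriv B z u := by
  ext i j
  simp only [matrixDeriv_apply, Matrix.add_apply]
  rw [fderiv_fun_add (hA i j) (hB i j)]
  rfl

theorem matrixDeriv_sub (hA : MatrixDifferentiableAt A z) (hB : MatrixDifferentiableAt B z)
    (u : V) :
    matrixDeriv (fun z => A z - B z) z u = matrixDeriv A z u - matrixDeriv B z u := by
  ext i j
  simp only [matrixDeriv_apply, Matrix.sub_apply]
  rw [fderiv_fun_sub (hA i j) (hB i j)]
  rfl

theorem matrixDeriv_const_smul (c : 𝕜) (hA : MatrixDifferentiableAt A z) (u : V) :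
    matrixDeriv (fun z => c • A z) z u = c • matrixDeriv A z u := by
  ext i j
  simp only [matrixDeriv_apply, Matrix.smul_apply, smul_eq_mul]
  rw [fderiv_const_mul (hA i j)]
  rfl

theorem matrixDeriv_const (M : Matrix ι ι 𝕜) (u : V) :
    matrixDeriv (fun _ : V => M) z u = 0 := by
  ext i j
  simp [matrixDeriv_apply]

theorem matrixDeriv_conjTranspose (hA : MatrixDifferentiableAt A z) (u : V) :
    matrixDeriv (fun z => (A z).conjTranspose) z u = (matrixDeriv A z u).conjTranspose := by
  ext i j
  have h := ((RCLike.conjCLE (K := 𝕜)).toContinuousLinearMap.hasFDerivAt (x := A z j i)).comp z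
    (hA j i).hasFDerivAt
  have h' := congrArg (fun f => f u) h.fderiv
  exact h'

theorem matrixDeriv_trace (hA : MatrixDifferentiableAt A z) (u : V) :
    fderiv ℝ (fun z => (A z).trace) z u = (matrixDeriv A z u).trace := by
  simp only [Matrix.trace, Matrix.diag]
  rw [fderiv_fun_sum fun k _ => hA k k]
  simp [matrixDeriv_apply]

theorem matrixDeriv_congr (h : A =ᶠ[𝓝 z] B) (u : V) : matrixDeriv A z u = matrixDeriv B z u := by
  ext i j
  simp only [matrixDeriv_apply]
  exact congrArg (fun f => f u)
    (Filter.EventuallyEq.fderiv_eq (𝕜 := ℝ) (h.fun_comp fun M : Matrix ι ι 𝕜 => M i j))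

theorem MatrixDifferentiableAt.continuousAt_det (hA : MatrixDifferentiableAt A z) :
    ContinuousAt (fun z => (A z).det) z := by
  have h : ContinuousAt A z :=
    continuousAt_pi.2 fun i => continuousAt_pi.2 fun j => (hA i j).continuousAt
  exact (Continuous.matrix_det continuous_id).continuousAt.comp h

/-- Differentiate $AA^{-1}=1$, which holds near `z` because the determinant stays non-zero there. -/
theorem matrixDeriv_inv (hA : MatrixDifferentiableAt A z) (h0 : (A z).det ≠ 0)
    (hA' : MatrixDifferentiableAt (fun z => (A z)⁻¹) z) (u : V) :
    matrixDeriv (fun z => (A z)⁻¹) z u = -((A z)⁻¹ * matrixDeriv A z u * (A z)⁻¹) := by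
  have h1 : (fun z => A z * (A z)⁻¹) =ᶠ[𝓝 z] fun _ => 1 := by
    filter_upwards [hA.continuousAt_det.eventually_ne h0] with y hy
    exact Matrix.mul_nonsing_inv _ (isUnit_iff_ne_zero.2 hy)
  have h2 := matrixDeriv_congr h1 u
  rw [matrixDeriv_mul hA hA', matrixDeriv_const] at h2
  have h3 := congrArg (fun M => (A z)⁻¹ * M) h2
  simp only [mul_add, mul_zero] at h3
  rw [← mul_assoc, ← mul_assoc, Matrix.nonsing_inv_mul _ (isUnit_iff_ne_zero.2 h0), one_mul] at h3
  exact eq_neg_of_add_eq_zero_right h3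

/-- Jacobi's formula: the derivative of the determinant is the trace of the adjugate times the
derivative, and the adjugate is $\det A\cdot A^{-1}$. -/
theorem fderiv_det (hA : MatrixDifferentiableAt A z) (h0 : (A z).det ≠ 0) (u : V) :
    fderiv ℝ (fun z => (A z).det) z u = (A z).det * ((A z)⁻¹ * matrixDeriv A z u).trace := by
  have hd : ∀ σ : Equiv.Perm ι, HasFDerivAt (fun z => ∏ i, A z (σ i) i)
      (∑ i, (∏ j ∈ Finset.univ.erase i, A z (σ j) j) • fderiv ℝ (fun z => A z (σ i) i) z) z :=
    fun σ => HasFDerivAt.finsetProd fun i _ => (hA (σ i) i).hasFDerivAt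
  have h1 : HasFDerivAt (fun z => (A z).det)
      (∑ σ : Equiv.Perm ι, ((Equiv.Perm.sign σ : ℤ) : 𝕜) •
        ∑ i, (∏ j ∈ Finset.univ.erase i, A z (σ j) j) • fderiv ℝ (fun z => A z (σ i) i) z) z := by
    simp only [Matrix.det_apply']
    exact HasFDerivAt.fun_sum fun σ _ => (hd σ).const_mul _
  -- By Cramer's rule this diagonal entry is the determinant with its `i`-th column differentiated,
  -- whose permutation expansion is the `i`-th group of terms of the product rule.
  have h2 : ∀ i, ((A z).adjugate * matrixDeriv A z u) i i =
      ∑ σ : Equiv.Perm ι, ((Equiv.Perm.sign σ : ℤ) : 𝕜) *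
        ((∏ j ∈ Finset.univ.erase i, A z (σ j) j) * matrixDeriv A z u (σ i) i) := by
    intro i
    have : ((A z).adjugate * matrixDeriv A z u) i i =
        ((A z).updateCol i fun k => matrixDeriv A z u k i).det := by
      rw [← Matrix.cramer_apply, Matrix.cramer_eq_adjugate_mulVec]
      rfl
    rw [this, Matrix.det_apply']
    refine Finset.sum_congr rfl fun σ _ => ?_
    rw [← Finset.mul_prod_erase _ _ (Finset.mem_univ i), Matrix.updateCol_self, mul_comm (matrixDeriv A z u (σ i) i)]
    congr 2
    refine Finset.prod_congr rfl fun j hj => ?_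
    rw [Matrix.updateCol_ne (Finset.ne_of_mem_erase hj)]
  have h3 : (A z).det • (A z)⁻¹ = (A z).adjugate := by
    rw [Matrix.inv_def, smul_smul, Ring.inverse_eq_inv', mul_inv_cancel₀ h0, one_smul]
  rw [h1.fderiv, ← smul_eq_mul, ← Matrix.trace_smul, ← Matrix.smul_mul, h3, Matrix.trace]
  simp only [Matrix.diag, h2, sum_apply, smul_apply,
    smul_eq_mul, Finset.mul_sum, matrixDeriv_apply]
  rw [Finset.sum_comm]

theorem fderiv_fderiv_comm {W : Type*} [NormedAddCommGroup W] [NormedSpace ℝ W] {f : V → W}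
    (hf : ContDiffAt ℝ 2 f z) (u v : V) :
    fderiv ℝ (fun y => fderiv ℝ f y u) z v = fderiv ℝ (fun y => fderiv ℝ f y v) z u := by
  have hd : DifferentiableAt ℝ (fderiv ℝ f) z :=
    (hf.fderiv_right (m := 1) (by norm_num)).differentiableAt one_ne_zero
  rw [fderiv_clm_apply hd (differentiableAt_const u), fderiv_clm_apply hd (differentiableAt_const v)]
  simpa using (hf.isSymmSndFDerivAt (by simp)).eq v u

theorem ContDiffAt.fderiv_apply_const {W : Type*} [NormedAddCommGroup W] [NormedSpace ℝ W]
    {f : V → W} {m : ℕ∞ω} (hf : ContDiffAt ℝ n f z) (hm : m + 1 ≤ n) (u : V) :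
    ContDiffAt ℝ m (fun y => fderiv ℝ f y u) z :=
  (hf.fderiv_right hm).clm_apply contDiffAt_const

theorem MatrixContDiffWithinAt.matrixDeriv {m : ℕ∞ω} (hA : MatrixContDiffWithinAt n A univ z)
    (hm : m + 1 ≤ n) (u : V) :
    MatrixContDiffWithinAt m (fun y => matrixDeriv A y u) univ z := fun i j =>
  contDiffWithinAt_univ.2 (ContDiffAt.fderiv_apply_const (contDiffWithinAt_univ.1 (hA i j)) hm u)

theorem matrixDeriv_comm (hA : MatrixContDiffWithinAt 2 A univ z) (u v : V) :
    matrixDeriv (fun y => matrixDeriv A y u) z v = matrixDeriv (fun y => matrixDeriv A y v) z u := by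
  ext i j
  exact fderiv_fderiv_comm (contDiffWithinAt_univ.1 (hA i j)) u v

end MatrixCalculus

/-! ### The divergence identity for the Poisson tensor of a closed form -/

section Poisson

variable {ι : Type*} [Fintype ι] [DecidableEq ι]

/-- Here `Ω a` plays the role of $\partial_a\omega$ and `hcyc` that of $d\omega=0$. The cyclic
identity splits $\mathrm{tr}(P\Omega_e)$ into two contractions that agree by antisymmetry of $P$,
whence $\sum_{a,d}P_{ad}(\Omega_a)_{de}=\tfrac12\mathrm{tr}(P\Omega_e)$, and the two summands
cancel. -/
theorem sum_poisson_eq_zero (P : Matrix ι ι ℝ) (Ω : ι → Matrix ι ι ℝ)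
    (hP : ∀ a c, P a c = -P c a)
    (hcyc : ∀ a c d, Ω a c d + Ω c d a + Ω d a c = 0) (hΩ : ∀ a c d, Ω a c d = -Ω a d c) (c : ι) :
    ∑ a, (-(1 / 2) * (P * Ω a).trace * P a c + (P * Ω a * P) a c) = 0 := by
  have h1 : ∑ a, (P * Ω a * P) a c = ∑ e, (∑ a, ∑ d, P a d * Ω a d e) * P e c := by
    simp only [Matrix.mul_apply]
    rw [Finset.sum_comm]
    simp only [Finset.sum_mul]
  have h2 : ∀ e, ∑ a, ∑ d, P a d * Ω a d e = (1 / 2) * (P * Ω e).trace := by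
    intro e
    have h3 : ∑ a, ∑ d, P a d * Ω a d e = ∑ a, ∑ d, -(P a d * Ω d a e) := by
      rw [Finset.sum_comm]
      refine Finset.sum_congr rfl fun a _ => Finset.sum_congr rfl fun d _ => ?_
      rw [hP d a]; ring
    have h4 : (P * Ω e).trace = ∑ a, ∑ d, P a d * Ω e d a := by
      simp [Matrix.trace, Matrix.mul_apply]
    have h5 : (P * Ω e).trace =
        ∑ a, ∑ d, P a d * Ω a d e + ∑ a, ∑ d, -(P a d * Ω d a e) := by
      rw [h4]
      simp only [← Finset.sum_add_distrib]
      refine Finset.sum_congr rfl fun a _ => Finset.sum_congr rfl fun d _ => ?_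
      have := hcyc a d e
      have h6 := hΩ e d a
      have h7 := hΩ d a e
      rw [h6, h7]
      linear_combination (-P a d) * this
    rw [h5, ← h3]; ring
  rw [Finset.sum_add_distrib, h1]
  simp only [h2, ← Finset.sum_add_distrib]
  exact Finset.sum_eq_zero fun a _ => by ring

theorem transpose_mul_eq_neg_mul {J M : Matrix ι ι ℝ} (hJ : J * J = -1)
    (hM : J.transpose * M * J = M) : J.transpose * M = -(M * J) := by
  have hJt : J.transpose * J.transpose = -1 := by
    rw [← Matrix.transpose_mul, hJ, Matrix.transpose_neg, Matrix.transpose_one]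
  have : J.transpose * (J.transpose * M * J) = J.transpose * M := by rw [hM]
  rw [← this, ← mul_assoc, ← mul_assoc, hJt]
  simp

/-- Orthogonality of `J` gives $G^{-1}J^{T}=-JG^{-1}$, and $JG^{-1}$ is the transpose of
$G^{-1}J^{T}$ because `G` is symmetric. -/
theorem inv_mul_transpose_antisymm {G J : Matrix ι ι ℝ} (hdet : G.det ≠ 0)
    (hG : G.transpose = G) (hJ : J * J = -1) (hJG : J.transpose * G * J = G) (a c : ι) :
    (G⁻¹ * J.transpose) a c = -(G⁻¹ * J.transpose) c a := by
  have hu : IsUnit G.det := isUnit_iff_ne_zero.2 hdet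
  have hP' : G⁻¹ * J.transpose = -(J * G⁻¹) := by
    have h := transpose_mul_eq_neg_mul hJ hJG
    have h2 := congrArg (fun M => G⁻¹ * M * G⁻¹) h
    simp only [Matrix.mul_neg, Matrix.neg_mul] at h2
    rw [← mul_assoc, ← mul_assoc, Matrix.nonsing_inv_mul _ hu, one_mul, mul_assoc,
      Matrix.mul_nonsing_inv _ hu, mul_one] at h2
    exact h2
  have : (G⁻¹ * J.transpose).transpose = J * G⁻¹ := by
    rw [Matrix.transpose_mul, Matrix.transpose_transpose, Matrix.transpose_nonsing_inv, hG]
  have h2 : (G⁻¹ * J.transpose) c a = (J * G⁻¹) a c := congrFun (congrFun this a) c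
  rw [h2, hP']; rfl

variable {V : Type*} [NormedAddCommGroup V] [NormedSpace ℝ V]

/-- The matrix of $\omega$ is $J^{T}G$, and $P=G^{-1}J^{T}$ is minus its inverse. Closedness of
$\omega$ amounts to $\sum_a\partial_a(\sqrt{\det G}\,P^{ac})=0$, so in the divergence only the
derivatives of `L` survive. -/
theorem sum_fderiv_poisson (b : ι → V) (G : V → Matrix ι ι ℝ) (J : Matrix ι ι ℝ) (z : V)
    (hG : MatrixContDiffWithinAt 1 G univ z) (hdet : 0 < (G z).det)
    (hsymm : ∀ᶠ y in 𝓝 z, (G y).transpose = G y) (hJG : ∀ᶠ y in 𝓝 z, J.transpose * G y * J = G y)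
    (hJ : J * J = -1)
    (hcl : ∀ a c d, (J.transpose * matrixDeriv G z (b a)) c d +
      (J.transpose * matrixDeriv G z (b c)) d a + (J.transpose * matrixDeriv G z (b d)) a c = 0)
    (L : ι → V → ℂ) (hL : ∀ c, DifferentiableAt ℝ (L c) z) :
    ∑ a, fderiv ℝ (fun y => ∑ c, (√(G y).det * ((G y)⁻¹ * J.transpose) a c) • L c y) z (b a) =
      √(G z).det • ∑ a, ∑ c, ((G z)⁻¹ * J.transpose) a c • fderiv ℝ (L c) z (b a) := by
  have hGd := hG.differentiableAt one_ne_zero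
  have hGinv := (hG.inv hdet.ne').differentiableAt one_ne_zero
  have hu : IsUnit (G z).det := isUnit_iff_ne_zero.2 hdet.ne'
  have hJt : J.transpose * J.transpose = -1 := by
    rw [← Matrix.transpose_mul, hJ, Matrix.transpose_neg, Matrix.transpose_one]
  set D : ι → Matrix ι ι ℝ := fun a => matrixDeriv G z (b a) with hD
  have hDsymm : ∀ a, (D a).transpose = D a := by
    intro a
    ext i j
    have h : (fun y => G y j i) =ᶠ[𝓝 z] fun y => G y i j :=
      hsymm.mono fun y hy => congrFun (congrFun hy i) j
    exact congrArg (fun f => f (b a)) (Filter.EventuallyEq.fderiv_eq (𝕜 := ℝ) h)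
  have hc : ∀ M : Matrix ι ι ℝ, MatrixDifferentiableAt (fun _ : V => M) z :=
    fun M i j => differentiableAt_const _
  have hDJ : ∀ a, J.transpose * D a * J = D a := by
    intro a
    have h := matrixDeriv_congr hJG (b a)
    rw [matrixDeriv_mul ((hc _).mul hGd) (hc _), matrixDeriv_mul (hc _) hGd, matrixDeriv_const,
      matrixDeriv_const] at h
    simpa using h
  set P := (G z)⁻¹ * J.transpose with hPdef
  have hGz : (G z).transpose = G z := hsymm.self_of_nhds
  have hP : ∀ a c, P a c = -P c a :=
    inv_mul_transpose_antisymm hdet.ne' hGz hJ hJG.self_of_nhds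
  have hΩ : ∀ a c d, (J.transpose * D a) c d = -(J.transpose * D a) d c := by
    intro a c d
    have : (J.transpose * D a).transpose = -(J.transpose * D a) := by
      rw [transpose_mul_eq_neg_mul hJ (hDJ a), Matrix.transpose_neg, Matrix.transpose_mul, hDsymm,
        transpose_mul_eq_neg_mul hJ (hDJ a)]
    have h2 := congrFun (congrFun this d) c
    exact h2
  have hsum := sum_poisson_eq_zero P (fun a => J.transpose * D a) hP hcl hΩ
  -- Since $J^{T}$ squares to $-1$. This rewrites both $\partial_aP=-G^{-1}(\partial_aG)P$ and the
  -- logarithmic derivative of $\sqrt{\det G}$ in terms of $P$ and $\partial_a\omega$.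
  have hPD : ∀ a, P * (J.transpose * D a) = -((G z)⁻¹ * D a) := by
    intro a
    rw [hPdef, mul_assoc, ← mul_assoc J.transpose, hJt]; simp
  have hsq : DifferentiableAt ℝ (fun y => √(G y).det) z :=
    ((contDiffWithinAt_univ.1 hG.det).differentiableAt one_ne_zero).sqrt hdet.ne'
  have hPd : MatrixDifferentiableAt (fun y => (G y)⁻¹ * J.transpose) z := hGinv.mul (hc _)
  have hRd : ∀ a c, DifferentiableAt ℝ (fun y => √(G y).det * ((G y)⁻¹ * J.transpose) a c) z :=
    fun a c => hsq.mul (hPd a c)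
  have hR : ∀ a c, fderiv ℝ (fun y => √(G y).det * ((G y)⁻¹ * J.transpose) a c) z (b a) =
      √(G z).det * (-(1 / 2) * (P * (J.transpose * D a)).trace * P a c +
        (P * (J.transpose * D a) * P) a c) := by
    intro a c
    rw [fderiv_fun_mul hsq (hPd a c),
      fderiv_sqrt ((contDiffWithinAt_univ.1 hG.det).differentiableAt one_ne_zero) hdet.ne']
    have h1 : fderiv ℝ (fun y => ((G y)⁻¹ * J.transpose) a c) z (b a) =
        -((G z)⁻¹ * D a * P) a c := by
      have := matrixDeriv_mul hGinv (hc J.transpose) (b a)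
      rw [matrixDeriv_const, matrixDeriv_inv hGd hdet.ne' hGinv, mul_zero, add_zero,
        Matrix.neg_mul, mul_assoc _ (G z)⁻¹] at this
      exact congrFun (congrFun this a) c
    have hs : 0 < √(G z).det := Real.sqrt_pos.2 hdet
    have hss : √(G z).det * √(G z).det = (G z).det := Real.mul_self_sqrt hdet.le
    simp only [add_apply, smul_apply, smul_eq_mul, h1]
    rw [fderiv_det hGd hdet.ne', hPD, Matrix.neg_mul, Matrix.trace_neg]
    change √(G z).det * -((G z)⁻¹ * D a * P) a c + P a c * _ = _ * (_ + -((G z)⁻¹ * D a * P) a c)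
    have : 1 / (2 * √(G z).det) * ((G z).det * ((G z)⁻¹ * matrixDeriv G z (b a)).trace) =
        √(G z).det / 2 * ((G z)⁻¹ * D a).trace := by
      have hst : ∀ s t : ℝ, 0 < s → 1 / (2 * s) * (s * s * t) = s / 2 * t := fun s t h => by
        field_simp
      have := hst _ ((G z)⁻¹ * D a).trace hs
      rwa [hss] at this
    rw [this]
    ring
  have hfin : ∀ a, fderiv ℝ
      (fun y => ∑ c, (√(G y).det * ((G y)⁻¹ * J.transpose) a c) • L c y) z (b a) =
      ∑ c, ((√(G z).det * P a c) • fderiv ℝ (L c) z (b a) +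
        (√(G z).det * (-(1 / 2) * (P * (J.transpose * D a)).trace * P a c +
        (P * (J.transpose * D a) * P) a c)) • L c z) := by
    intro a
    have h := HasFDerivAt.fun_sum (u := Finset.univ) fun c _ =>
      (hRd a c).hasFDerivAt.fun_smul (hL c).hasFDerivAt
    refine (congrArg (fun f => f (b a)) h.fderiv).trans ?_
    rw [sum_apply]
    refine Finset.sum_congr rfl fun c _ => ?_
    rw [← hR]
    rfl
  refine (Finset.sum_congr rfl fun a _ => hfin a).trans ?_
  simp only [Finset.sum_add_distrib, mul_smul]
  -- The derivatives of the coefficients cancel for each fixed `c`, after summation over `a`.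
  have hzero : ∑ a, ∑ c, √(G z).det • (-(1 / 2) * (P * (J.transpose * D a)).trace * P a c +
      (P * (J.transpose * D a) * P) a c) • L c z = 0 := by
    rw [Finset.sum_comm]
    simp only [← Finset.smul_sum, ← Finset.sum_smul, hsum, zero_smul, Finset.sum_const_zero,
      smul_zero]
  rw [hzero, add_zero]
  simp only [Finset.smul_sum]

end Poisson

/-! ### Complex-valued 1-forms and the contraction of their exterior derivative -/

section OneForms

variable {V : Type*} [NormedAddCommGroup V] [NormedSpace ℂ V] [FiniteDimensional ℂ V]
  {X : Type*} [TopologicalSpace X] [ChartedSpace V X] [IsManifold 𝓘(ℂ, V) ω X]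

/-- A complex-valued 1-form read in the chart at `p`. -/
def formInChart (β : X → V →L[ℝ] ℂ) (p : X) (z : V) : V →L[ℝ] ℂ :=
  (β ((chartAt V p).symm z)).comp (fderiv ℝ (transition p ((chartAt V p).symm z)) z)

/-- A 1-form with continuously differentiable coefficients. -/
def IsC1Form (β : X → V →L[ℝ] ℂ) : Prop :=
  ∀ p, ContDiffOn ℝ 1 (formInChart β p) (chartAt V p).target

/-- The exterior derivative of a 1-form. -/
def dform (β : X → V →L[ℝ] ℂ) (y : X) (u v : V) : ℂ :=
  fderiv ℝ (formInChart β y) (chartAt V y y) u v - fderiv ℝ (formInChart β y) (chartAt V y y) v u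

variable {β : X → V →L[ℝ] ℂ} {p y : X}

theorem formInChart_apply (hp : y ∈ (chartAt V p).source) (v : V) :
    formInChart β p (chartAt V p y) v = β y (constField p v y) := by
  rw [formInChart, (chartAt V p).left_inv hp, constField_eq_fderiv hp]
  rfl

theorem IsC1Form.contDiffAt (hβ : IsC1Form β) (hp : y ∈ (chartAt V p).source) :
    ContDiffAt ℝ 1 (formInChart β p) (chartAt V p y) :=
  (hβ p).contDiffAt ((chartAt V p).open_target.mem_nhds ((chartAt V p).map_source hp))

theorem eventually_mem_source (hp : y ∈ (chartAt V p).source) {s : Set X} (hs : s ∈ 𝓝 y) :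
    ∀ᶠ z in 𝓝 (chartAt V p y), z ∈ (chartAt V p).target ∧ (chartAt V p).symm z ∈ s := by
  filter_upwards [(chartAt V p).open_target.mem_nhds ((chartAt V p).map_source hp),
    ((chartAt V p).continuousAt_symm ((chartAt V p).map_source hp)).preimage_mem_nhds
      (by rwa [(chartAt V p).left_inv hp])] with z hz hz'
  exact ⟨hz, hz'⟩

theorem formInChart_eventuallyEq (hp : y ∈ (chartAt V p).source) :
    formInChart β p =ᶠ[𝓝 (chartAt V p y)] fun z =>
      (formInChart β y (transition p y z)).comp (fderiv ℝ (transition p y) z) := by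
  set τ : V → V := transition p y
  filter_upwards [eventually_mem_source hp ((chartAt V y).open_source.mem_nhds
    (mem_chart_source V y))] with z' ⟨hz, hz'⟩
  have hs : (chartAt V p).symm z' ∈ (chartAt V p).source := (chartAt V p).map_target hz
  have hzz : chartAt V p ((chartAt V p).symm z') = z' := (chartAt V p).right_inv hz
  have hτ : τ z' = chartAt V y ((chartAt V p).symm z') := rfl
  ext w
  have h1 := formInChart_apply (β := β) hs w
  have h2 := formInChart_apply (β := β) hz' (fderiv ℝ τ z' w)
  have h3 := constField_eq_constField hs hz' w
  rw [hzz] at h1 h3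
  rw [← h3] at h2
  rw [h1, ← h2]
  rfl

/-- The exterior derivative at `y` is computed in the chart at `y`. In another chart an extra term
with the second derivative of the transition map appears; it is symmetric and cancels under
antisymmetrization. -/
theorem dform_constField (hβ : IsC1Form β) (hp : y ∈ (chartAt V p).source) (u v : V) :
    dform β y (constField p u y) (constField p v y) =
      fderiv ℝ (formInChart β p) (chartAt V p y) u v -
        fderiv ℝ (formInChart β p) (chartAt V p y) v u := by
  set τ : V → V := transition p y
  set z : V := chartAt V p y
  have hτz : τ z = chartAt V y y := transition_apply hp
  have hτ2 : ContDiffAt ℝ 2 τ z := transition_contDiffAt hp (mem_chart_source V y)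
  have h : formInChart β p =ᶠ[𝓝 z] fun z' => (formInChart β y (τ z')).comp (fderiv ℝ τ z') :=
    formInChart_eventuallyEq hp
  have hφ : DifferentiableAt ℝ (formInChart β y) (τ z) := by
    rw [hτz]
    exact (hβ.contDiffAt (mem_chart_source V y)).differentiableAt one_ne_zero
  have hτd : HasFDerivAt τ (fderiv ℝ τ z) z := (hτ2.differentiableAt two_ne_zero).hasFDerivAt
  have hdd : DifferentiableAt ℝ (fderiv ℝ τ) z :=
    (hτ2.fderiv_right (m := 1) (by norm_num)).differentiableAt one_ne_zero
  have hder := (hφ.hasFDerivAt.comp z hτd).clm_comp hdd.hasFDerivAt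
  have hf : ∀ u v, fderiv ℝ (formInChart β p) z u v =
      formInChart β y (τ z) (fderiv ℝ (fderiv ℝ τ) z u v) +
        fderiv ℝ (formInChart β y) (τ z) (fderiv ℝ τ z u) (fderiv ℝ τ z v) := by
    intro u v
    rw [h.fderiv_eq]
    exact congrArg (fun f => f u v) hder.fderiv
  have hsym : fderiv ℝ (fderiv ℝ τ) z u v = fderiv ℝ (fderiv ℝ τ) z v u :=
    (hτ2.isSymmSndFDerivAt (by simp)).eq u v
  rw [hf, hf, hsym, hτz, constField_eq_fderiv hp, constField_eq_fderiv hp]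
  unfold dform
  ring

theorem isBilinearMap_dform (β : X → V →L[ℝ] ℂ) (y : X) : IsBilinearMap ℝ (dform β y) where
  add_left a b c := by simp only [dform, map_add, add_apply]; ring
  smul_left r a c := by simp only [dform, map_smul, smul_apply, smul_sub]
  add_right a b c := by simp only [dform, map_add, add_apply]; ring
  smul_right r a c := by simp only [dform, map_smul, smul_apply, smul_sub]

variable (V) in
/-- The matrix of the complex structure in the fixed real basis. -/
def complexMatrix : Matrix (Fin (Module.finrank ℝ V)) (Fin (Module.finrank ℝ V)) ℝ :=
  Matrix.of fun i j => (modelBasis V).repr (Complex.I • modelBasis V j) i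

theorem I_smul_modelBasis (j : Fin (Module.finrank ℝ V)) :
    Complex.I • modelBasis V j = ∑ i, complexMatrix V i j • modelBasis V i :=
  ((modelBasis V).sum_repr _).symm

theorem complexMatrix_mul_self : complexMatrix V * complexMatrix V = -1 := by
  have h : complexMatrix V = LinearMap.toMatrix (modelBasis V) (modelBasis V)
      ((Complex.I • LinearMap.id : V →ₗ[ℂ] V).restrictScalars ℝ) := by
    ext i j
    simp [complexMatrix, LinearMap.toMatrix_apply]
  rw [h, ← LinearMap.toMatrix_mul, ← LinearMap.toMatrix_one (modelBasis V), ← map_neg]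
  congr 1
  ext v
  simp [smul_smul]

theorem sum_complexMatrix_gram (g : KahlerMetric V X) (hp : y ∈ (chartAt V p).source)
    (c d : Fin (Module.finrank ℝ V)) :
    g.inner y (complexStructure y (constField p (modelBasis V c) y))
      (constField p (modelBasis V d) y) = ((complexMatrix V).transpose * gram g p y) c d := by
  rw [complexStructure_constField hp, Matrix.mul_apply]
  have h := isBilinearMap_metricForm g y
  have h2 : ∀ u v : V, g.inner y (constField p u y) (constField p v y) = metricForm g y
      (fderiv ℝ (transition p y) (chartAt V p y) u) (fderiv ℝ (transition p y) (chartAt V p y) v) :=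
    fun u v => by rw [constField_eq_fderiv hp, constField_eq_fderiv hp]; rfl
  rw [h2, I_smul_modelBasis]
  have e : ∀ u v, metricForm g y u v = h.toLinearMap u v := fun _ _ => rfl
  simp only [e, map_sum, map_smul, LinearMap.sum_apply, LinearMap.smul_apply]
  refine Finset.sum_congr rfl fun k _ => ?_
  rw [gram_apply g hp]
  rfl

theorem complexMatrix_gram (g : KahlerMetric V X) (hp : y ∈ (chartAt V p).source) :
    (complexMatrix V).transpose * gram g p y * complexMatrix V = gram g p y := by
  have h := isBilinearMap_metricForm g y
  ext a b
  set T := fderiv ℝ (transition p y) (chartAt V p y) with hT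
  have e : ∀ u v, metricForm g y u v = h.toLinearMap u v := fun _ _ => rfl
  have h1 : metricForm g y (T (Complex.I • modelBasis V a)) (T (Complex.I • modelBasis V b)) =
      gram g p y a b := by
    rw [gram_apply g hp, hT, fderiv_transition_smul_I hp (mem_chart_source V y),
      fderiv_transition_smul_I hp (mem_chart_source V y)]
    exact g.orthogonal y _ _
  rw [← h1, I_smul_modelBasis, I_smul_modelBasis, Matrix.mul_assoc, Matrix.mul_apply]
  simp only [e, map_sum, map_smul, LinearMap.sum_apply, LinearMap.smul_apply, Matrix.mul_apply]
  simp only [Finset.mul_sum, Finset.smul_sum]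
  refine Finset.sum_comm.trans ?_
  refine Finset.sum_congr rfl fun k _ => Finset.sum_congr rfl fun l _ => ?_
  rw [gram_apply g hp, ← e]
  simp only [smul_eq_mul, Matrix.transpose_apply]
  ring

/-- Expanding the complex structure in the basis turns
$\tfrac12g^{ab}d\beta(\partial_a,J\partial_b)$ into
$\tfrac12P^{ac}(\partial_a\beta_c-\partial_c\beta_a)$, and antisymmetry of $P$ makes the two halves
equal. -/
theorem contract_dform (g : KahlerMetric V X) (hβ : IsC1Form β) (hp : y ∈ (chartAt V p).source) :
    contract g y (dform (V := V) β y) = ∑ a, ∑ c, ((gram g p y)⁻¹ * (complexMatrix V).transpose) a c •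
      fderiv ℝ (fun z => formInChart β p z (modelBasis V c)) (chartAt V p y) (modelBasis V a) := by
  have hd : DifferentiableAt ℝ (formInChart β p) (chartAt V p y) :=
    (hβ.contDiffAt hp).differentiableAt one_ne_zero
  have hB := isBilinearMap_dform β y
  have hB' : IsBilinearMap ℝ fun u v : V => dform β y u (Complex.I • v) :=
    ⟨fun a b c => hB.add_left a b _, fun r a c => hB.smul_left r a _,
      fun a b c => by simp only [smul_add]; exact hB.add_right a _ _,
      fun r a c => by simp only [smul_comm Complex.I r]; exact hB.smul_right r a _⟩
  have hP := inv_mul_transpose_antisymm (gram_posDef g hp).det_pos.ne' (gram_isSymm g p y)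
    (complexMatrix_mul_self (V := V)) (complexMatrix_gram g hp)
  set P := (gram g p y)⁻¹ * (complexMatrix V).transpose with hPdef
  set A : Fin (Module.finrank ℝ V) → Fin (Module.finrank ℝ V) → ℂ := fun a c =>
    fderiv ℝ (formInChart β p) (chartAt V p y) (modelBasis V a) (modelBasis V c) with hA
  have hA' : ∀ a c, fderiv ℝ (fun z => formInChart β p z (modelBasis V c)) (chartAt V p y)
      (modelBasis V a) = A a c := by
    intro a c
    rw [fderiv_clm_apply hd (differentiableAt_const _)]
    simp [hA]
  simp only [hA']
  refine (contract_eq_metricTrace g y _).trans ?_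
  refine (congrArg ((1 / 2 : ℂ) • ·) (metricTrace_eq_chart g hp _ hB')).trans ?_
  have h1 : ∀ a b, dform β y (constField p (modelBasis V a) y)
      (complexStructure y (constField p (modelBasis V b) y)) =
      ∑ k, complexMatrix V k b • (A a k - A k a) := by
    intro a b
    rw [complexStructure_constField hp, dform_constField hβ hp, I_smul_modelBasis]
    simp only [map_sum, map_smul, sum_apply, smul_apply, smul_sub, Finset.sum_sub_distrib, hA]
  have h2 : ∑ a, ∑ b, (gram g p y)⁻¹ a b • dform β y (constField p (modelBasis V a) y)
      (complexStructure y (constField p (modelBasis V b) y)) =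
      ∑ a, ∑ c, P a c • (A a c - A c a) := by
    refine Finset.sum_congr rfl fun a _ => ?_
    simp only [h1, Finset.smul_sum, hPdef, Matrix.mul_apply, Finset.sum_smul, smul_smul,
      Matrix.transpose_apply]
    rw [Finset.sum_comm]
  refine (congrArg ((1 / 2 : ℂ) • ·) h2).trans ?_
  have h3 : ∑ a, ∑ c, P a c • A c a = -∑ a, ∑ c, P a c • A a c := by
    rw [Finset.sum_comm, ← Finset.sum_neg_distrib]
    refine Finset.sum_congr rfl fun a _ => ?_
    rw [← Finset.sum_neg_distrib]
    refine Finset.sum_congr rfl fun c _ => ?_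
    rw [hP c a, neg_smul]
  simp only [smul_sub, Finset.sum_sub_distrib, h3]
  simp only [smul_eq_mul]
  ring

end OneForms

/-! ### Stokes' theorem for the contracted exterior derivative -/

section Divergence

variable {V : Type*} [NormedAddCommGroup V] [NormedSpace ℂ V] [FiniteDimensional ℂ V]
  {X : Type*} [TopologicalSpace X] [ChartedSpace V X] [IsManifold 𝓘(ℂ, V) ω X]
  {β : X → V →L[ℝ] ℂ} {p y : X}

/-- Closedness of the Kähler form, tested on coordinate fields: the brackets vanish and only the
three derivatives of the coefficients of $\omega$ remain. -/
theorem matrixDeriv_gram_cyclic (g : KahlerMetric V X) (hp : y ∈ (chartAt V p).source)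
    (a c d : Fin (Module.finrank ℝ V)) :
    ((complexMatrix V).transpose * matrixDeriv (fun z => gram g p ((chartAt V p).symm z))
        (chartAt V p y) (modelBasis V a)) c d +
      ((complexMatrix V).transpose * matrixDeriv (fun z => gram g p ((chartAt V p).symm z))
        (chartAt V p y) (modelBasis V c)) d a +
      ((complexMatrix V).transpose * matrixDeriv (fun z => gram g p ((chartAt V p).symm z))
        (chartAt V p y) (modelBasis V d)) a c = 0 := by
  have hV : CompleteSpace V := FiniteDimensional.complete ℂ V
  have hgd : ∀ i j, MDifferentiableAt 𝓘(ℝ, V) 𝓘(ℝ, ℝ) (fun y => gram g p y i j) y :=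
    fun i j => (contMDiffAt_gram g hp i j).mdifferentiableAt (by simp)
  have key : ∀ a c d, mvfderiv 𝓘(ℝ, V) (fun y => g.inner y
      (complexStructure y (constField p (modelBasis V c) y)) (constField p (modelBasis V d) y)) y
      (constField p (modelBasis V a) y) = ((complexMatrix V).transpose *
        matrixDeriv (fun z => gram g p ((chartAt V p).symm z))
        (chartAt V p y) (modelBasis V a)) c d := by
    intro a c d
    have he : (fun y => g.inner y (complexStructure y (constField p (modelBasis V c) y))
        (constField p (modelBasis V d) y)) =ᶠ[𝓝 y]
        fun y => ∑ k, complexMatrix V k c * gram g p y k d := by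
      filter_upwards [(chartAt V p).open_source.mem_nhds hp] with w hw
      rw [sum_complexMatrix_gram g hw, Matrix.mul_apply]
      rfl
    have hm : MDifferentiableAt 𝓘(ℝ, V) 𝓘(ℝ, ℝ)
        (fun y => ∑ k, complexMatrix V k c * gram g p y k d) y := by
      have : ContMDiffAt 𝓘(ℝ, V) 𝓘(ℝ, ℝ) ∞
          (fun y => ∑ k, complexMatrix V k c * gram g p y k d) y :=
        contMDiffAt_finsetSum fun k _ => contMDiffAt_const.mul (contMDiffAt_gram g hp k d)
      exact this.mdifferentiableAt (by simp)
    rw [mvfderiv_constField hp (hm.congr_of_eventuallyEq he)]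
    have he' : (fun y => g.inner y (complexStructure y (constField p (modelBasis V c) y))
        (constField p (modelBasis V d) y)) ∘ (chartAt V p).symm =ᶠ[𝓝 (chartAt V p y)]
        fun z => ∑ k, complexMatrix V k c * gram g p ((chartAt V p).symm z) k d := by
      filter_upwards [eventually_mem_source hp ((chartAt V p).open_source.mem_nhds hp)] with z hz
      have := sum_complexMatrix_gram g hz.2 c d
      rw [Matrix.mul_apply] at this
      exact this
    have hd : ∀ k, HasFDerivAt (fun z => complexMatrix V k c * gram g p ((chartAt V p).symm z) k d)
        (complexMatrix V k c • fderiv ℝ (fun z => gram g p ((chartAt V p).symm z) k d)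
          (chartAt V p y)) (chartAt V p y) := fun k =>
      (differentiableAt_comp_chart_symm hp (hgd k d)).hasFDerivAt.const_mul _
    rw [he'.fderiv_eq, (HasFDerivAt.fun_sum fun k _ => hd k).fderiv, Matrix.mul_apply, sum_apply]
    rfl
  have h := g.closed y (constField p (modelBasis V a)) (constField p (modelBasis V c))
    (constField p (modelBasis V d)) (contMDiffAt_constField hp _) (contMDiffAt_constField hp _)
    (contMDiffAt_constField hp _)
  rw [mlieBracket_constField hp, mlieBracket_constField hp, mlieBracket_constField hp] at h
  simp only [key, map_zero] at h
  have hz : ∀ w, (0 : TangentSpace 𝓘(ℝ, V) y →L[ℝ] ℝ) w = 0 := fun _ => rfl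
  rw [hz, hz, hz, sub_zero, sub_zero, sub_zero] at h
  linarith [h]

theorem matrixContDiffWithinAt_gram (g : KahlerMetric V X) (hp : y ∈ (chartAt V p).source) :
    MatrixContDiffWithinAt ∞ (fun z => gram g p ((chartAt V p).symm z)) univ
      (chartAt V p y) := fun i j => contDiffWithinAt_univ.2
  ((contDiffOn_gram g p i j).contDiffAt
    ((chartAt V p).open_target.mem_nhds ((chartAt V p).map_source hp)))

/-- The coefficients, in the chart at `p`, of the vector field with divergence `Λ dβ`. -/
def poissonField (g : KahlerMetric V X) (β : X → V →L[ℝ] ℂ) (p : X)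
    (a : Fin (Module.finrank ℝ V)) (z : V) : ℂ :=
  ∑ c, (√(gram g p ((chartAt V p).symm z)).det *
    ((gram g p ((chartAt V p).symm z))⁻¹ * (complexMatrix V).transpose) a c) •
    formInChart β p z (modelBasis V c)

theorem contDiffAt_poissonField (g : KahlerMetric V X) (hβ : IsC1Form β)
    (hp : y ∈ (chartAt V p).source) (a : Fin (Module.finrank ℝ V)) :
    ContDiffAt ℝ 1 (poissonField g β p a) (chartAt V p y) := by
  have hpos : 0 < (gram g p ((chartAt V p).symm (chartAt V p y))).det := by
    rw [(chartAt V p).left_inv hp]; exact (gram_posDef g hp).det_pos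
  have hG : MatrixContDiffWithinAt 1 (fun z => gram g p ((chartAt V p).symm z)) univ
      (chartAt V p y) := fun i j => (matrixContDiffWithinAt_gram g hp i j).of_le (by simp)
  have hc : MatrixContDiffWithinAt 1 (fun _ : V => (complexMatrix V).transpose) univ
      (chartAt V p y) := fun i j => contDiffWithinAt_const
  refine ContDiffAt.sum fun c _ => ContDiffAt.smul (ContDiffAt.mul
    ((contDiffWithinAt_univ.1 hG.det).sqrt hpos.ne') ?_)
    ((hβ.contDiffAt hp).clm_apply contDiffAt_const)
  exact contDiffWithinAt_univ.1 ((hG.inv hpos.ne').mul hc a c)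

theorem sum_fderiv_poissonField (g : KahlerMetric V X) (hβ : IsC1Form β)
    (hp : y ∈ (chartAt V p).source) :
    ∑ a, fderiv ℝ (poissonField g β p a) (chartAt V p y) (modelBasis V a) =
      √(gram g p y).det • contract g y (dform (V := V) β y) := by
  have hG : MatrixContDiffWithinAt 1 (fun z => gram g p ((chartAt V p).symm z)) univ
      (chartAt V p y) := fun i j => (matrixContDiffWithinAt_gram g hp i j).of_le (by simp)
  have hinv : (chartAt V p).symm (chartAt V p y) = y := (chartAt V p).left_inv hp
  have h := sum_fderiv_poisson (modelBasis V) (fun z => gram g p ((chartAt V p).symm z))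
    (complexMatrix V) (chartAt V p y) hG (by rw [hinv]; exact (gram_posDef g hp).det_pos)
    (Eventually.of_forall fun z => gram_isSymm g p _)
    (by
      filter_upwards [eventually_mem_source hp ((chartAt V p).open_source.mem_nhds hp)] with z hz
      exact complexMatrix_gram g hz.2)
    complexMatrix_mul_self (matrixDeriv_gram_cyclic g hp)
    (fun c z => formInChart β p z (modelBasis V c))
    (fun c => ((hβ.contDiffAt hp).clm_apply contDiffAt_const).differentiableAt one_ne_zero)
  rw [contract_dform g hβ hp]
  simp only [hinv] at h
  exact h

/-- The definition uses a different chart at every point. Near a fixed `y` the function equals the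
divergence in the chart at `y` of one continuously differentiable field, divided by the volume
density. -/
theorem continuous_contract_dform (g : KahlerMetric V X) (hβ : IsC1Form β) :
    Continuous fun x => contract g x (dform (V := V) β x) := by
  rw [continuous_iff_continuousAt]
  intro y
  have hp := mem_chart_source V y
  have he : (fun x => contract g x (dform (V := V) β x)) =ᶠ[𝓝 y] fun x =>
      ((√(gram g y ((chartAt V y).symm (chartAt V y x))).det)⁻¹ : ℝ) •
        ∑ a, fderiv ℝ (poissonField g β y a) (chartAt V y x) (modelBasis V a) := by
    filter_upwards [(chartAt V y).open_source.mem_nhds hp] with x hx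
    rw [sum_fderiv_poissonField g hβ hx, smul_smul, (chartAt V y).left_inv hx, inv_mul_cancel₀, one_smul]
    exact (Real.sqrt_pos.2 (gram_posDef g hx).det_pos).ne'
  refine ContinuousAt.congr ?_ he.symm
  have hcont := (chartAt V y).continuousAt hp
  have h1 : ContinuousAt (fun z => (√(gram g y ((chartAt V y).symm z)).det)⁻¹) (chartAt V y y) := by
    refine ContinuousAt.inv₀ ((continuousOn_sqrt_det_gram g y).continuousAt
      ((chartAt V y).open_target.mem_nhds ((chartAt V y).map_source hp))) ?_
    rw [(chartAt V y).left_inv hp]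
    exact (Real.sqrt_pos.2 (gram_posDef g hp).det_pos).ne'
  have h2 : ContinuousAt (fun z => ∑ a, fderiv ℝ (poissonField g β y a) z (modelBasis V a))
      (chartAt V y y) := tendsto_finsetSum _ fun a _ =>
    (((contDiffAt_poissonField g hβ hp a).fderiv_right (m := 0) (by simp)).continuousAt).clm_apply
      continuousAt_const
  exact (ContinuousAt.comp (f := chartAt V y) (x := y) h1 hcont).smul (ContinuousAt.comp (f := chartAt V y) (x := y) h2 hcont)

variable [T2Space X] [CompactSpace X] [MeasurableSpace V] [BorelSpace V]
  [MeasurableSpace X] [BorelSpace X]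

theorem integral_fderiv_eq_zero {f : V → ℂ} (μ : Measure V) [μ.IsAddHaarMeasure]
    (hf : ContDiff ℝ 1 f) (hc : HasCompactSupport f) (v : V) : ∫ z, fderiv ℝ f z v ∂μ = 0 := by
  have hV : FiniteDimensional ℝ V := FiniteDimensional.complexToReal V
  have h1 : Integrable (fun z => fderiv ℝ f z v) μ :=
    ((hf.continuous_fderiv one_ne_zero).clm_apply continuous_const).integrable_of_hasCompactSupport
      (hc.fderiv_apply (𝕜 := ℝ) v)
  have h2 : Integrable f μ := hf.continuous.integrable_of_hasCompactSupport hc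
  have := integral_mul_fderiv_eq_neg_fderiv_mul_of_integrable (μ := μ) (f := fun _ : V => (1 : ℂ))
    (g := f) (v := v) (by simp) (by simpa using h1) (by simpa using h2)
    (fun x _ => differentiableAt_const _) (fun x _ => hf.differentiable one_ne_zero x)
  simpa using this

/-- Inside one chart the integrand times the density is a Euclidean divergence of fields with
compact support, whose integral is zero. -/
theorem integral_contract_dform_of_support (g : KahlerMetric V X) (hβ : IsC1Form β) {C : Set X}
    (hC : IsClosed C) (hCp : C ⊆ (chartAt V p).source) (hsupp : ∀ x ∉ C, β x = 0) :
    ∫ x, contract g x (dform (V := V) β x) ∂(kahlerVolume g) = 0 := by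
  have hV : FiniteDimensional ℝ V := FiniteDimensional.complexToReal V
  have hzero : ∀ x ∉ (chartAt V p).source, contract g x (dform (V := V) β x) = 0 := by
    intro x hx
    have hx' : x ∉ C := fun h => hx (hCp h)
    have he : formInChart β x =ᶠ[𝓝 (chartAt V x x)] fun _ => 0 := by
      filter_upwards [eventually_mem_source (mem_chart_source V x) (hC.isOpen_compl.mem_nhds hx')]
        with z hz
      rw [formInChart, hsupp _ hz.2]
      simp
    have hd : dform (V := V) β x = fun _ _ => 0 := by
      funext u v
      unfold dform
      rw [he.fderiv_eq]
      simp
    have : contract g x (W := ℂ) (fun _ _ => 0) = 0 := by simp [contract]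
    rw [hd]
    exact this
  rw [integral_kahlerVolume_eq g p (continuous_contract_dform g hβ) hzero]
  set K : Set V := chartAt V p '' C with hK
  have hKc : IsCompact K := hC.isCompact.image_of_continuousOn
    ((chartAt V p).continuousOn.mono hCp)
  have hKt : K ⊆ (chartAt V p).target := by
    rintro _ ⟨x, hx, rfl⟩
    exact (chartAt V p).map_source (hCp hx)
  -- Extension by zero to the whole model space; it stays continuously differentiable because the
  -- support lies in the compact set `K` inside the chart.
  set W : Fin (Module.finrank ℝ V) → V → ℂ := fun a =>
    (chartAt V p).target.indicator (poissonField g β p a) with hW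
  have hWK : ∀ a, ∀ z ∉ K, W a z = 0 := by
    intro a z hz
    by_cases hzt : z ∈ (chartAt V p).target
    · have hn : (chartAt V p).symm z ∉ C := fun h => hz ⟨_, h, (chartAt V p).right_inv hzt⟩
      rw [hW]
      simp only [indicator_of_mem hzt]
      refine Finset.sum_eq_zero fun c _ => ?_
      rw [formInChart, hsupp _ hn]
      simp
    · exact indicator_of_notMem hzt _
  have hWt : ∀ a, ∀ z ∈ (chartAt V p).target, W a =ᶠ[𝓝 z] poissonField g β p a := fun a z hz => by
    filter_upwards [(chartAt V p).open_target.mem_nhds hz] with w hw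
    exact indicator_of_mem hw _
  have hWo : ∀ a, ∀ z ∉ (chartAt V p).target, W a =ᶠ[𝓝 z] fun _ => 0 := fun a z hz => by
    filter_upwards [hKc.isClosed.isOpen_compl.mem_nhds fun h => hz (hKt h)] with w hw
    exact hWK a w hw
  have hWd : ∀ a, ContDiff ℝ 1 (W a) := fun a => contDiff_iff_contDiffAt.2 fun z => by
    by_cases hz : z ∈ (chartAt V p).target
    · have := contDiffAt_poissonField g hβ ((chartAt V p).map_target hz) a
      rw [(chartAt V p).right_inv hz] at this
      exact this.congr_of_eventuallyEq (hWt a z hz)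
    · exact contDiffAt_const.congr_of_eventuallyEq (hWo a z hz)
  have hWc : ∀ a, HasCompactSupport (W a) := fun a => HasCompactSupport.intro hKc (hWK a)
  have h1 : ∫ z in (chartAt V p).target, √(gram g p ((chartAt V p).symm z)).det •
      contract g ((chartAt V p).symm z) (dform (V := V) β ((chartAt V p).symm z))
        ∂(modelBasis V).addHaar =
      ∫ z, ∑ a, fderiv ℝ (W a) z (modelBasis V a) ∂(modelBasis V).addHaar := by
    refine Eq.trans ?_
      (setIntegral_eq_integral_of_forall_compl_eq_zero (s := (chartAt V p).target) ?_)
    · refine setIntegral_congr_fun (chartAt V p).open_target.measurableSet fun z hz => ?_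
      have := sum_fderiv_poissonField g hβ ((chartAt V p).map_target hz)
      rw [(chartAt V p).right_inv hz] at this
      refine this.symm.trans (Finset.sum_congr rfl fun a _ => ?_)
      rw [(hWt a z hz).fderiv_eq]
    · intro z hz
      refine Finset.sum_eq_zero fun a _ => ?_
      rw [(hWo a z hz).fderiv_eq]
      simp
  rw [h1, integral_finsetSum]
  · exact Finset.sum_eq_zero fun a _ => integral_fderiv_eq_zero _ (hWd a) (hWc a) _
  · intro a _
    exact (((hWd a).continuous_fderiv one_ne_zero).clm_apply
      continuous_const).integrable_of_hasCompactSupport ((hWc a).fderiv_apply (𝕜 := ℝ) _)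

/-- **Stokes' theorem** on a compact Kähler manifold, in the form `∫ Λ dβ = 0`. -/
theorem integral_contract_dform (g : KahlerMetric V X) (hβ : IsC1Form β) :
    ∫ x, contract g x (dform (V := V) β x) ∂(kahlerVolume g) = 0 := by
  have hV : FiniteDimensional ℝ V := FiniteDimensional.complexToReal V
  -- A partition of unity reduces to forms supported in one chart; $\sum_j\rho_j\beta=\beta$, and
  -- $\Lambda d$ is additive.
  set ρβ : X → X → V →L[ℝ] ℂ := fun j x => chartPartition V X j x • β x with hρβ
  have hf : ∀ j p z, formInChart (ρβ j) p z =
      chartPartition V X j ((chartAt V p).symm z) • formInChart β p z := fun j p z => by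
    ext v; rfl
  have hC1 : ∀ j, IsC1Form (ρβ j) := fun j p => by
    have h1 : ContDiffOn ℝ 1 (fun z => chartPartition V X j ((chartAt V p).symm z))
        (chartAt V p).target := contDiffOn_comp_chart_symm fun y _ =>
      ((chartPartition V X j).contMDiff.contMDiffAt).of_le (by simp)
    exact (h1.smul (hβ p)).congr fun z _ => hf j p z
  have hsum : ∀ x, contract g x (dform (V := V) β x) =
      ∑ j ∈ partitionIndices V X, contract g x (dform (V := V) (ρβ j) x) := by
    intro x
    have hd : ∀ j, DifferentiableAt ℝ (formInChart (ρβ j) x) (chartAt V x x) := fun j =>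
      ((hC1 j).contDiffAt (mem_chart_source V x)).differentiableAt one_ne_zero
    have he : formInChart β x = fun z => ∑ j ∈ partitionIndices V X, formInChart (ρβ j) x z := by
      funext z
      simp only [hf, ← Finset.sum_smul, sum_chartPartition, one_smul]
    simp only [contract_dform g (hC1 _) (mem_chart_source V x),
      contract_dform g hβ (mem_chart_source V x)]
    refine Eq.trans (Finset.sum_congr rfl fun a _ => ?_) Finset.sum_comm
    refine Eq.trans (Finset.sum_congr rfl fun c _ => ?_) Finset.sum_comm
    rw [← Finset.smul_sum]
    congr 1
    have hd' : ∀ j ∈ partitionIndices V X, DifferentiableAt ℝ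
        (fun z => formInChart (ρβ j) x z (modelBasis V c)) (chartAt V x x) := fun j _ =>
      (hd j).clm_apply (differentiableAt_const _)
    have := fderiv_fun_sum hd'
    have he' : (fun z => formInChart β x z (modelBasis V c)) = fun z =>
        ∑ j ∈ partitionIndices V X, formInChart (ρβ j) x z (modelBasis V c) := by
      funext z
      rw [he, sum_apply]
    rw [he', this, sum_apply]
  simp only [hsum]
  rw [integral_finsetSum]
  · refine Finset.sum_eq_zero fun j _ => integral_contract_dform_of_support g (hC1 j) (p := j)
      (isClosed_tsupport (chartPartition V X j)) (chartPartition_isSubordinate j) fun x hx => ?_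
    have : chartPartition V X j x = 0 := by
      by_contra h
      exact hx (subset_tsupport _ h)
    change chartPartition V X j x • β x = 0
    rw [this]
    exact zero_smul ℝ (β x)
  · intro j _
    exact (continuous_contract_dform g (hC1 j)).integrable_of_hasCompactSupport
      (HasCompactSupport.of_compactSpace _)

end Divergence

/-! ### Local frames of the bundle and coordinates in them -/

section Frames

variable {V : Type*} [NormedAddCommGroup V] [NormedSpace ℂ V]
  {X : Type*} [TopologicalSpace X] [ChartedSpace V X]
  {F : Type*} [NormedAddCommGroup F] [NormedSpace ℂ F]
  {E : X → Type*} [∀ x, AddCommGroup (E x)] [∀ x, Module ℂ (E x)]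
  [∀ x, TopologicalSpace (E x)] [TopologicalSpace (TotalSpace F E)] [FiberBundle F E]
  [FiniteDimensional ℂ F]

variable (F E) in
/-- The local frame of the bundle given by the preferred trivialization at `q`. -/
def frame (q : X) (i : Fin (Module.finrank ℂ F)) (y : X) : E y :=
  (trivializationAt F E q).symm y (Module.finBasis ℂ F i)

variable (F) in
/-- The coordinates of a vector in the local frame at `q`. -/
def frameCoord (q y : X) (e : E y) (i : Fin (Module.finrank ℂ F)) : ℂ :=
  (Module.finBasis ℂ F).repr (trivializationAt F E q ⟨y, e⟩).2 i

variable [VectorBundle ℂ F E]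

variable (F E) in
/-- The basis of the fibre at `y` given by the local frame at `q`. -/
def frameBasis {q y : X} (hy : y ∈ (trivializationAt F E q).baseSet) :
    Module.Basis (Fin (Module.finrank ℂ F)) ℂ (E y) :=
  (trivializationAt F E q).basisAt (Module.finBasis ℂ F) hy

variable {q y : X}

theorem frameBasis_apply (hy : y ∈ (trivializationAt F E q).baseSet)
    (i : Fin (Module.finrank ℂ F)) : frameBasis F E hy i = frame F E q i y := by
  simp [frameBasis, frame, Trivialization.basisAt]

theorem frameBasis_repr (hy : y ∈ (trivializationAt F E q).baseSet) (e : E y)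
    (i : Fin (Module.finrank ℂ F)) : (frameBasis F E hy).repr e i = frameCoord F q y e i := by
  simp [frameBasis, frameCoord, Trivialization.basisAt,
    Trivialization.linearEquivAt_apply]

theorem fiberBasis_eq (q : X) (i : Fin (Module.finrank ℂ F)) :
    fiberBasis F E q i = frame F E q i q := frameBasis_apply _ i

theorem sum_frameCoord_smul (hy : y ∈ (trivializationAt F E q).baseSet) (e : E y) :
    ∑ i, frameCoord F q y e i • frame F E q i y = e := by
  have := (frameBasis F E hy).sum_repr e
  simpa only [frameBasis_apply, frameBasis_repr] using this

theorem frameCoord_frame (hy : y ∈ (trivializationAt F E q).baseSet)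
    (i j : Fin (Module.finrank ℂ F)) :
    frameCoord F q y (frame F E q i y) j = if i = j then 1 else 0 := by
  rw [← frameBasis_repr hy, ← frameBasis_apply hy, Module.Basis.repr_self, Finsupp.single_apply]

theorem frameCoord_add (hy : y ∈ (trivializationAt F E q).baseSet) (e f : E y)
    (i : Fin (Module.finrank ℂ F)) :
    frameCoord F q y (e + f) i = frameCoord F q y e i + frameCoord F q y f i := by
  simp [← frameBasis_repr hy]

theorem frameCoord_sub (hy : y ∈ (trivializationAt F E q).baseSet) (e f : E y)
    (i : Fin (Module.finrank ℂ F)) :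
    frameCoord F q y (e - f) i = frameCoord F q y e i - frameCoord F q y f i := by
  simp [← frameBasis_repr hy]

theorem frameCoord_smul (hy : y ∈ (trivializationAt F E q).baseSet) (c : ℂ) (e : E y)
    (i : Fin (Module.finrank ℂ F)) :
    frameCoord F q y (c • e) i = c * frameCoord F q y e i := by
  simp [← frameBasis_repr hy]

theorem frameCoord_sum (hy : y ∈ (trivializationAt F E q).baseSet) {ι : Type*} (s : Finset ι)
    (e : ι → E y) (i : Fin (Module.finrank ℂ F)) :
    frameCoord F q y (∑ k ∈ s, e k) i = ∑ k ∈ s, frameCoord F q y (e k) i := by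
  simp [← frameBasis_repr hy]

theorem frameCoord_ext (hy : y ∈ (trivializationAt F E q).baseSet) {e f : E y}
    (h : ∀ i, frameCoord F q y e i = frameCoord F q y f i) : e = f := by
  rw [← sum_frameCoord_smul hy e, ← sum_frameCoord_smul hy f]
  simp only [h]

/-- Local extensions are constant in the preferred trivialization. Objects defined through
extensions of fibre vectors at `q` can therefore be computed in the frame at `q`. -/
theorem extend_frame (q : X) (i : Fin (Module.finrank ℂ F)) :
    FiberBundle.extend F (frame F E q i q) = frame F E q i := by
  have hq := FiberBundle.mem_baseSet_trivializationAt F E q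
  funext y
  unfold FiberBundle.extend frame
  rw [Trivialization.apply_mk_symm _ hq]

variable [IsManifold 𝓘(ℂ, V) ω X] [ContMDiffVectorBundle ∞ F E 𝓘(ℝ, V)]

theorem contMDiffAt_frame {n : ℕ∞} (hy : y ∈ (trivializationAt F E q).baseSet)
    (i : Fin (Module.finrank ℂ F)) :
    ContMDiffAt 𝓘(ℝ, V) (𝓘(ℝ, V).prod 𝓘(ℝ, F)) n
      (fun y => TotalSpace.mk' F y (frame F E q i y)) y := by
  have hm : ContMDiffVectorBundle n F E 𝓘(ℝ, V) := ContMDiffVectorBundle.of_le (n := ∞) (by exact_mod_cast le_top)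
  rw [Trivialization.contMDiffAt_section_iff (e := trivializationAt F E q) hy]
  refine (contMDiffAt_const (c := Module.finBasis ℂ F i)).congr_of_eventuallyEq ?_
  filter_upwards [(trivializationAt F E q).open_baseSet.mem_nhds hy] with z hz
  unfold frame
  rw [Trivialization.apply_mk_symm _ hz]

theorem mdifferentiableAt_frame (hy : y ∈ (trivializationAt F E q).baseSet)
    (i : Fin (Module.finrank ℂ F)) :
    MDifferentiableAt 𝓘(ℝ, V) (𝓘(ℝ, V).prod 𝓘(ℝ, F))
      (fun y => TotalSpace.mk' F y (frame F E q i y)) y :=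
  (contMDiffAt_frame (n := 1) hy i).mdifferentiableAt (by simp)

theorem mdifferentiableAt_section_of_frameCoord {σ : Π y, E y}
    (hy : y ∈ (trivializationAt F E q).baseSet)
    (hσ : ∀ i, MDifferentiableAt 𝓘(ℝ, V) 𝓘(ℝ, ℂ) (fun y => frameCoord F q y (σ y) i) y) :
    MDifferentiableAt 𝓘(ℝ, V) (𝓘(ℝ, V).prod 𝓘(ℝ, F)) (fun y => TotalSpace.mk' F y (σ y)) y := by
  have hm : ContMDiffVectorBundle 1 F E 𝓘(ℝ, V) := ContMDiffVectorBundle.of_le (n := ∞) (by simp)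
  refine ((trivializationAt F E q).mdifferentiableAt_section_iff 𝓘(ℝ, V) σ hy).2 ?_
  have h : (fun x => (trivializationAt F E q ⟨x, σ x⟩).2) = fun x =>
      ∑ i, frameCoord F q x (σ x) i • Module.finBasis ℂ F i := by
    funext x
    exact ((Module.finBasis ℂ F).sum_repr _).symm
  have h2 : MDifferentiableAt 𝓘(ℝ, V) 𝓘(ℝ, F) (fun x =>
      ∑ i, frameCoord F q x (σ x) i • Module.finBasis ℂ F i) y := by
    have hg : ∀ i, MDifferentiableAt 𝓘(ℝ, V) 𝓘(ℝ, F) (fun x =>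
        frameCoord F q x (σ x) i • Module.finBasis ℂ F i) y := fun i => by
      have hl : Differentiable ℝ fun c : ℂ => c • Module.finBasis ℂ F i :=
        differentiable_id.smul_const _
      exact (hl.differentiableAt.mdifferentiableAt).comp y (hσ i)
    exact (MDifferentiableAt.sum fun i (_ : i ∈ Finset.univ) => hg i).congr_of_eventuallyEq
      (Eventually.of_forall fun x => by rw [Finset.sum_apply])
  have h3 := h ▸ h2
  exact h3

theorem mdifferentiableAt_frameCoord {σ : Π y, E y}
    (hy : y ∈ (trivializationAt F E q).baseSet)
    (hσ : MDifferentiableAt 𝓘(ℝ, V) (𝓘(ℝ, V).prod 𝓘(ℝ, F)) (fun y => TotalSpace.mk' F y (σ y)) y)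
    (i : Fin (Module.finrank ℂ F)) :
    MDifferentiableAt 𝓘(ℝ, V) 𝓘(ℝ, ℂ) (fun y => frameCoord F q y (σ y) i) y := by
  have hm : ContMDiffVectorBundle 1 F E 𝓘(ℝ, V) := ContMDiffVectorBundle.of_le (n := ∞) (by simp)
  have h := ((trivializationAt F E q).mdifferentiableAt_section_iff 𝓘(ℝ, V) σ hy).1 hσ
  have hl : Differentiable ℝ fun e : F => (Module.finBasis ℂ F).repr e i :=
    ((LinearMap.toContinuousLinearMap ((Module.finBasis ℂ F).coord i)).restrictScalars
      ℝ).differentiable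
  exact (hl.differentiableAt.mdifferentiableAt).comp y h

theorem contMDiffAt_frameCoord {σ : Π y, E y} {n : ℕ∞}
    (hy : y ∈ (trivializationAt F E q).baseSet)
    (hσ : ContMDiffAt 𝓘(ℝ, V) (𝓘(ℝ, V).prod 𝓘(ℝ, F)) n (fun y => TotalSpace.mk' F y (σ y)) y)
    (i : Fin (Module.finrank ℂ F)) :
    ContMDiffAt 𝓘(ℝ, V) 𝓘(ℝ, ℂ) n (fun y => frameCoord F q y (σ y) i) y := by
  have hm : ContMDiffVectorBundle n F E 𝓘(ℝ, V) :=
    ContMDiffVectorBundle.of_le (n := ∞) (by exact_mod_cast le_top)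
  have h := (Trivialization.contMDiffAt_section_iff (e := trivializationAt F E q) hy).1 hσ
  have hl : ContDiff ℝ n fun e : F => (Module.finBasis ℂ F).repr e i :=
    ((LinearMap.toContinuousLinearMap ((Module.finBasis ℂ F).coord i)).restrictScalars
      ℝ).contDiff
  exact (hl.contDiffAt.contMDiffAt).comp y h

theorem mdifferentiableAt_of_comp_chart_symm {W : Type*} [NormedAddCommGroup W] [NormedSpace ℝ W]
    {f : X → W} (hp : y ∈ (chartAt V q).source)
    (hf : DifferentiableAt ℝ (f ∘ (chartAt V q).symm) (chartAt V q y)) :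
    MDifferentiableAt 𝓘(ℝ, V) 𝓘(ℝ, W) f y := by
  have h1 : MDifferentiableAt 𝓘(ℝ, V) 𝓘(ℝ, V) (chartAt V q) y :=
    mdifferentiableAt_extChartAt (I := 𝓘(ℝ, V)) hp
  refine (MDifferentiableAt.comp y hf.mdifferentiableAt h1).congr_of_eventuallyEq ?_
  filter_upwards [(chartAt V q).open_source.mem_nhds hp] with z hz
  simp [(chartAt V q).left_inv hz]

end Frames

/-! ### The connection in a local frame -/

section Connection

variable {V : Type*} [NormedAddCommGroup V] [NormedSpace ℂ V]
  {X : Type*} [TopologicalSpace X] [ChartedSpace V X]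
  {F : Type*} [NormedAddCommGroup F] [NormedSpace ℂ F]
  {E : X → Type*} [∀ x, AddCommGroup (E x)] [∀ x, Module ℂ (E x)]
  [∀ x, TopologicalSpace (E x)] [∀ x, IsTopologicalAddGroup (E x)] [∀ x, ContinuousSMul ℂ (E x)]
  [TopologicalSpace (TotalSpace F E)] [FiberBundle F E]
  [FiniteDimensional ℂ F] [VectorBundle ℂ F E] [IsManifold 𝓘(ℂ, V) ω X]

/-- The matrix of the connection in the local frame at `q`, in the direction of the constant
vector `v` of the chart at `q`. -/
def connMatrix (D : ComplexConnection V F E) (q : X) (v z : V) :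
    Matrix (Fin (Module.finrank ℂ F)) (Fin (Module.finrank ℂ F)) ℂ :=
  Matrix.of fun i j => frameCoord F q ((chartAt V q).symm z)
    (D.toFun (frame F E q j) ((chartAt V q).symm z) (constField q v ((chartAt V q).symm z))) i

variable {q y : X}

theorem connMatrix_chart (D : ComplexConnection V F E) (hy : y ∈ (chartAt V q).source) (v : V)
    (i j : Fin (Module.finrank ℂ F)) : connMatrix D q v (chartAt V q y) i j =
      frameCoord F q y (D.toFun (frame F E q j) y (constField q v y)) i := by
  have h : ∀ y', y' = y → frameCoord F q y' (D.toFun (frame F E q j) y' (constField q v y')) i =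
      frameCoord F q y (D.toFun (frame F E q j) y (constField q v y)) i := by
    rintro _ rfl; rfl
  exact h _ ((chartAt V q).left_inv hy)

variable [ContMDiffVectorBundle ∞ F E 𝓘(ℝ, V)]

theorem mvfderiv_comp_clm {W W' : Type*} [NormedAddCommGroup W] [NormedSpace ℝ W]
    [NormedAddCommGroup W'] [NormedSpace ℝ W'] {c : X → W}
    (hc : MDifferentiableAt 𝓘(ℝ, V) 𝓘(ℝ, W) c y) (L : W →L[ℝ] W') (v : TangentSpace 𝓘(ℝ, V) y) :
    mvfderiv 𝓘(ℝ, V) (fun y => L (c y)) y v = L (mvfderiv 𝓘(ℝ, V) c y v) := by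
  obtain ⟨w, rfl⟩ := exists_constField_eq (mem_chart_source V y) v
  have hLc : MDifferentiableAt 𝓘(ℝ, V) 𝓘(ℝ, W') (fun y => L (c y)) y :=
    (L.differentiableAt.mdifferentiableAt).comp y hc
  rw [mvfderiv_constField (mem_chart_source V y) hc, mvfderiv_constField (mem_chart_source V y)
    hLc]
  have := (L.hasFDerivAt.comp (chartAt V y y)
    (differentiableAt_comp_chart_symm (mem_chart_source V y) hc).hasFDerivAt).fderiv
  exact congrArg (fun f => f w) this

theorem mdifferentiableAt_complex_smul {σ : Π y, E y} {c : X → ℂ}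
    (hσ : MDifferentiableAt 𝓘(ℝ, V) (𝓘(ℝ, V).prod 𝓘(ℝ, F)) (fun y => TotalSpace.mk' F y (σ y)) y)
    (hc : MDifferentiableAt 𝓘(ℝ, V) 𝓘(ℝ, ℂ) c y) :
    MDifferentiableAt 𝓘(ℝ, V) (𝓘(ℝ, V).prod 𝓘(ℝ, F))
      (fun y => TotalSpace.mk' F y (c y • σ y)) y := by
  have hy := FiberBundle.mem_baseSet_trivializationAt F E y
  refine mdifferentiableAt_section_of_frameCoord hy fun i => ?_
  refine (hc.mul (mdifferentiableAt_frameCoord hy hσ i)).congr_of_eventuallyEq ?_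
  filter_upwards [(trivializationAt F E y).open_baseSet.mem_nhds hy] with x hx
  exact frameCoord_smul hx _ _ _

/-- The Leibniz rule is given for real functions only; the complex rule follows by splitting `c`
into real and imaginary parts and using that `D` commutes with multiplication by $\sqrt{-1}$. -/
theorem connection_smul (D : ComplexConnection V F E) {σ : Π y, E y} {c : X → ℂ}
    (hσ : MDifferentiableAt 𝓘(ℝ, V) (𝓘(ℝ, V).prod 𝓘(ℝ, F)) (fun y => TotalSpace.mk' F y (σ y)) y)
    (hc : MDifferentiableAt 𝓘(ℝ, V) 𝓘(ℝ, ℂ) c y) (v : TangentSpace 𝓘(ℝ, V) y) :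
    D.toFun (fun y => c y • σ y) y v = c y • D.toFun σ y v + mvfderiv 𝓘(ℝ, V) c y v • σ y := by
  have hD := D.isCovariantDerivativeOnUniv
  have hre : MDifferentiableAt 𝓘(ℝ, V) 𝓘(ℝ, ℝ) (fun y => (c y).re) y :=
    (Complex.reCLM.differentiableAt.mdifferentiableAt).comp y hc
  have him : MDifferentiableAt 𝓘(ℝ, V) 𝓘(ℝ, ℝ) (fun y => (c y).im) y :=
    (Complex.imCLM.differentiableAt.mdifferentiableAt).comp y hc
  have hIσ : MDifferentiableAt 𝓘(ℝ, V) (𝓘(ℝ, V).prod 𝓘(ℝ, F))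
      (fun y => TotalSpace.mk' F y (Complex.I • σ y)) y :=
    mdifferentiableAt_complex_smul hσ mdifferentiableAt_const
  have h1 : (fun y => c y • σ y) = (fun y => (c y).re) • σ + (fun y => (c y).im) •
      (fun y => Complex.I • σ y) := by
    funext x
    change c x • σ x = ((c x).re : ℝ) • σ x + (c x).im • Complex.I • σ x
    rw [← Complex.coe_smul, ← Complex.coe_smul, smul_smul, ← add_smul, Complex.re_add_im]
  have hs : ∀ {r : X → ℝ} {τ : Π y, E y},
      MDifferentiableAt 𝓘(ℝ, V) (𝓘(ℝ, V).prod 𝓘(ℝ, F)) (fun y => TotalSpace.mk' F y (τ y)) y →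
      MDifferentiableAt 𝓘(ℝ, V) 𝓘(ℝ, ℝ) r y →
      MDifferentiableAt 𝓘(ℝ, V) (𝓘(ℝ, V).prod 𝓘(ℝ, F))
        (fun y => TotalSpace.mk' F y ((r • τ) y)) y := by
    intro r τ hτ hr
    have := mdifferentiableAt_complex_smul (c := fun y => (r y : ℂ)) hτ
      ((Complex.ofRealCLM.differentiableAt.mdifferentiableAt).comp y hr)
    simp only [Complex.coe_smul] at this
    exact this
  have h2 := hD.add (hs hσ hre) (hs hIσ him) (mem_univ y)
  have h3 := hD.leibniz hσ hre (mem_univ y)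
  have h4 := hD.leibniz hIσ him (mem_univ y)
  rw [h1, h2, h3, h4]
  have h5 := D.smul_I σ y hσ v
  have hrec : mvfderiv 𝓘(ℝ, V) (fun y => (c y).re) y v = (mvfderiv 𝓘(ℝ, V) c y v).re :=
    mvfderiv_comp_clm hc Complex.reCLM v
  have himc : mvfderiv 𝓘(ℝ, V) (fun y => (c y).im) y v = (mvfderiv 𝓘(ℝ, V) c y v).im :=
    mvfderiv_comp_clm hc Complex.imCLM v
  change (c y).re • D.toFun σ y v + mvfderiv 𝓘(ℝ, V) (fun y => (c y).re) y v • σ y +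
    ((c y).im • D.toFun (fun y => Complex.I • σ y) y v +
      mvfderiv 𝓘(ℝ, V) (fun y => (c y).im) y v • Complex.I • σ y) = _
  rw [h5, hrec, himc]
  simp only [← Complex.coe_smul, smul_smul]
  nth_rewrite 3 [← Complex.re_add_im (c y)]
  nth_rewrite 3 [← Complex.re_add_im (mvfderiv 𝓘(ℝ, V) c y v)]
  simp only [add_smul]
  abel

theorem connection_sum (D : ComplexConnection V F E) {ι : Type*} (s : Finset ι)
    {σ : ι → Π y, E y}
    (hσ : ∀ i, MDifferentiableAt 𝓘(ℝ, V) (𝓘(ℝ, V).prod 𝓘(ℝ, F))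
      (fun y => TotalSpace.mk' F y (σ i y)) y) (v : TangentSpace 𝓘(ℝ, V) y) :
    MDifferentiableAt 𝓘(ℝ, V) (𝓘(ℝ, V).prod 𝓘(ℝ, F))
      (fun y => TotalSpace.mk' F y (∑ i ∈ s, σ i y)) y ∧
    D.toFun (fun y => ∑ i ∈ s, σ i y) y v = ∑ i ∈ s, D.toFun (σ i) y v := by
  classical
  have hD := D.isCovariantDerivativeOnUniv
  induction s using Finset.induction_on with
  | empty =>
    constructor
    · simpa using mdifferentiableAt_complex_smul (c := fun _ => 0) (σ := fun y => (0 : E y))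
        (mdifferentiableAt_zeroSection (𝕜 := ℝ) ..) mdifferentiableAt_const
    · have := hD.zero (mem_univ y)
      simp only [Finset.sum_empty]
      exact congrArg (fun f => f v) this
  | insert i s hi ih =>
    have hy := FiberBundle.mem_baseSet_trivializationAt F E y
    have h1 : (fun y => ∑ j ∈ insert i s, σ j y) = σ i + fun y => ∑ j ∈ s, σ j y := by
      funext x
      rw [Finset.sum_insert hi]
      rfl
    constructor
    · refine mdifferentiableAt_section_of_frameCoord hy fun k => ?_
      refine ((mdifferentiableAt_frameCoord hy (hσ i) k).add
        (mdifferentiableAt_frameCoord hy ih.1 k)).congr_of_eventuallyEq ?_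
      filter_upwards [(trivializationAt F E y).open_baseSet.mem_nhds hy] with x hx
      rw [Finset.sum_insert hi, frameCoord_add hx]
      rfl
    · rw [h1, hD.add (hσ i) ih.1 (mem_univ y), Finset.sum_insert hi, ← ih.2]
      rfl

/-- The formula $D=d+A$: near `y` the section is its expansion in the frame, and `D` depends only on
the germ. -/
theorem frameCoord_connection (D : ComplexConnection V F E) {σ : Π y, E y}
    (hy : y ∈ (chartAt V q).source) (hyE : y ∈ (trivializationAt F E q).baseSet)
    (hσ : ∀ i, DifferentiableAt ℝ (fun z => frameCoord F q ((chartAt V q).symm z)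
      (σ ((chartAt V q).symm z)) i) (chartAt V q y)) (v : V) (i : Fin (Module.finrank ℂ F)) :
    frameCoord F q y (D.toFun σ y (constField q v y)) i =
      fderiv ℝ (fun z => frameCoord F q ((chartAt V q).symm z) (σ ((chartAt V q).symm z)) i)
        (chartAt V q y) v +
      ∑ j, connMatrix D q v (chartAt V q y) i j * frameCoord F q y (σ y) j := by
  have hc : ∀ i, MDifferentiableAt 𝓘(ℝ, V) 𝓘(ℝ, ℂ) (fun y => frameCoord F q y (σ y) i) y :=
    fun i => mdifferentiableAt_of_comp_chart_symm hy (hσ i)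
  have hterm := fun j => mdifferentiableAt_complex_smul (mdifferentiableAt_frame hyE j) (hc j)
  have hsum := connection_sum D Finset.univ hterm (constField q v y)
  have hσm : MDifferentiableAt 𝓘(ℝ, V) (𝓘(ℝ, V).prod 𝓘(ℝ, F))
      (fun y => TotalSpace.mk' F y (σ y)) y := mdifferentiableAt_section_of_frameCoord hyE hc
  have hcongr := D.isCovariantDerivativeOnUniv.congr_of_eventuallyEq hσm hsum.1 univ_mem (by
    filter_upwards [(trivializationAt F E q).open_baseSet.mem_nhds hyE] with x hx
    exact (sum_frameCoord_smul hx (σ x)).symm)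
  rw [hcongr, hsum.2, frameCoord_sum hyE]
  have hd : ∀ j, mvfderiv 𝓘(ℝ, V) (fun y => frameCoord F q y (σ y) j) y (constField q v y) =
      fderiv ℝ (fun z => frameCoord F q ((chartAt V q).symm z) (σ ((chartAt V q).symm z)) j)
        (chartAt V q y) v := fun j => mvfderiv_constField hy (hc j) v
  simp only [connection_smul D (mdifferentiableAt_frame hyE _) (hc _), frameCoord_add hyE,
    frameCoord_smul hyE, frameCoord_frame hyE, hd, Finset.sum_add_distrib]
  simp only [mul_ite, mul_one, mul_zero, Finset.sum_ite_eq', Finset.mem_univ, if_true]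
  rw [add_comm]
  congr 1
  refine Finset.sum_congr rfl fun j _ => ?_
  rw [connMatrix_chart D hy, mul_comm]

end Connection

/-! ### Matrices of the metric, of the connection and of $\psi_H$ -/

section FrameMatrices

variable {V : Type*} [NormedAddCommGroup V] [NormedSpace ℂ V]
  {X : Type*} [TopologicalSpace X] [ChartedSpace V X]
  {F : Type*} [NormedAddCommGroup F] [NormedSpace ℂ F]
  {E : X → Type*} [∀ x, AddCommGroup (E x)] [∀ x, Module ℂ (E x)]
  [∀ x, TopologicalSpace (E x)] [∀ x, IsTopologicalAddGroup (E x)] [∀ x, ContinuousSMul ℂ (E x)]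
  [TopologicalSpace (TotalSpace F E)] [FiberBundle F E]
  [FiniteDimensional ℂ F] [VectorBundle ℂ F E] [IsManifold 𝓘(ℂ, V) ω X]
  [ContMDiffVectorBundle ∞ F E 𝓘(ℝ, V)]

variable (V F E) in
/-- The part of the chart at `q` over which the local frame at `q` is defined. -/
def frameDomain (q : X) : Set V :=
  (chartAt V q).target ∩ (chartAt V q).symm ⁻¹' (trivializationAt F E q).baseSet

theorem isOpen_frameDomain (q : X) : IsOpen (frameDomain V F E q) :=
  (chartAt V q).isOpen_inter_preimage_symm (trivializationAt F E q).open_baseSet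

variable {q y : X}

theorem chart_mem_frameDomain (hy : y ∈ (chartAt V q).source)
    (hyE : y ∈ (trivializationAt F E q).baseSet) : chartAt V q y ∈ frameDomain V F E q :=
  ⟨(chartAt V q).map_source hy, by rwa [mem_preimage, (chartAt V q).left_inv hy]⟩

theorem chart_self_mem_frameDomain (q : X) : chartAt V q q ∈ frameDomain V F E q :=
  chart_mem_frameDomain (mem_chart_source V q) (FiberBundle.mem_baseSet_trivializationAt F E q)

theorem contDiffAt_comp_chart_symm {W : Type*} [NormedAddCommGroup W] [NormedSpace ℝ W]
    {n : ℕ∞ω} {f : X → W} {z : V} (hz : z ∈ (chartAt V q).target)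
    (hf : ContMDiffAt 𝓘(ℝ, V) 𝓘(ℝ, W) n f ((chartAt V q).symm z)) :
    ContDiffAt ℝ n (fun z => f ((chartAt V q).symm z)) z := by
  rw [← contMDiffAt_iff_contDiffAt]
  have h := contMDiffOn_extChartAt_symm (I := 𝓘(ℝ, V)) (n := n) q
  have ht : (extChartAt 𝓘(ℝ, V) q).target = (chartAt V q).target := by simp [mfld_simps]
  rw [ht] at h
  have h2 : ContMDiffAt 𝓘(ℝ, V) 𝓘(ℝ, V) n (chartAt V q).symm z :=
    h.contMDiffAt ((chartAt V q).open_target.mem_nhds hz)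
  exact hf.comp z h2

/-- The matrix of a Hermitian metric in the local frame at `q`. -/
def metricMatrix (H : HermitianMetric V F E) (q : X) (z : V) :
    Matrix (Fin (Module.finrank ℂ F)) (Fin (Module.finrank ℂ F)) ℂ :=
  Matrix.of fun i j => H.form ((chartAt V q).symm z) (frame F E q j ((chartAt V q).symm z))
    (frame F E q i ((chartAt V q).symm z))

variable (F) in
/-- The matrix of an endomorphism of the fibre at `y` in the local frame at `q`. -/
def endMatrix (q y : X) (T : E y →ₗ[ℂ] E y) :
    Matrix (Fin (Module.finrank ℂ F)) (Fin (Module.finrank ℂ F)) ℂ :=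
  Matrix.of fun i j => frameCoord F q y (T (frame F E q j y)) i

theorem endMatrix_eq_toMatrix (hy : y ∈ (trivializationAt F E q).baseSet) (T : E y →ₗ[ℂ] E y) :
    endMatrix F q y T = LinearMap.toMatrix (frameBasis F E hy) (frameBasis F E hy) T := by
  ext i j
  rw [LinearMap.toMatrix_apply, frameBasis_repr, frameBasis_apply]
  rfl

theorem endMatrix_comp (hy : y ∈ (trivializationAt F E q).baseSet) (S T : E y →ₗ[ℂ] E y) :
    endMatrix F q y (S ∘ₗ T) = endMatrix F q y S * endMatrix F q y T := by
  simp only [endMatrix_eq_toMatrix hy]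
  exact LinearMap.toMatrix_comp _ _ _ S T

theorem trace_eq_trace_endMatrix (hy : y ∈ (trivializationAt F E q).baseSet)
    (T : E y →ₗ[ℂ] E y) : LinearMap.trace ℂ (E y) T = (endMatrix F q y T).trace := by
  rw [endMatrix_eq_toMatrix hy, LinearMap.trace_eq_matrix_trace ℂ (frameBasis F E hy)]

theorem frameCoord_apply (hy : y ∈ (trivializationAt F E q).baseSet)
    (T : E y →ₗ[ℂ] E y) (e : E y) (i : Fin (Module.finrank ℂ F)) :
    frameCoord F q y (T e) i = ∑ j, endMatrix F q y T i j * frameCoord F q y e j := by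
  conv_lhs => rw [← sum_frameCoord_smul hy e]
  simp only [map_sum, map_smul, frameCoord_sum hy, frameCoord_smul hy, endMatrix, Matrix.of_apply]
  exact Finset.sum_congr rfl fun j _ => mul_comm _ _

theorem metricMatrix_chart (H : HermitianMetric V F E) (hy : y ∈ (chartAt V q).source)
    (i j : Fin (Module.finrank ℂ F)) : metricMatrix H q (chartAt V q y) i j =
      H.form y (frame F E q j y) (frame F E q i y) := by
  have h : ∀ y', y' = y → H.form y' (frame F E q j y') (frame F E q i y') =
      H.form y (frame F E q j y) (frame F E q i y) := by
    rintro _ rfl; rfl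
  exact h _ ((chartAt V q).left_inv hy)

/-- The index order chosen for the metric matrix gives $H(e,f)=f^{*}He$, so metric adjoints become
conjugate transposes. -/
theorem form_eq_sum (H : HermitianMetric V F E) (hy : y ∈ (chartAt V q).source)
    (hyE : y ∈ (trivializationAt F E q).baseSet) (e f : E y) :
    H.form y e f = ∑ l, star (frameCoord F q y f l) *
      ∑ k, metricMatrix H q (chartAt V q y) l k * frameCoord F q y e k := by
  conv_lhs => rw [← sum_frameCoord_smul hyE e, ← sum_frameCoord_smul hyE f]
  simp only [map_sum, LinearMap.sum_apply, map_smulₛₗ, LinearMap.smul_apply, RingHom.id_apply,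
    metricMatrix_chart H hy, smul_eq_mul, starRingEnd_apply]
  refine Finset.sum_congr rfl fun l _ => ?_
  congr 1
  exact Finset.sum_congr rfl fun k _ => mul_comm _ _

theorem det_metricMatrix_ne_zero (H : HermitianMetric V F E) {z : V}
    (hz : z ∈ frameDomain V F E q) : (metricMatrix H q z).det ≠ 0 := by
  intro h0
  obtain ⟨c, hc, hc0⟩ := Matrix.exists_mulVec_eq_zero_iff.2 h0
  set y := (chartAt V q).symm z with hyd
  have hy : y ∈ (chartAt V q).source := (chartAt V q).map_target hz.1
  have hzy : chartAt V q y = z := (chartAt V q).right_inv hz.1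
  have hyE : y ∈ (trivializationAt F E q).baseSet := hz.2
  set e : E y := ∑ i, c i • frame F E q i y with he
  have hcoord : ∀ i, frameCoord F q y e i = c i := fun i => by
    rw [he, frameCoord_sum hyE]
    simp only [frameCoord_smul hyE, frameCoord_frame hyE]
    simp
  have he0 : e ≠ 0 := by
    intro h
    apply hc
    funext i
    rw [← hcoord i, h, ← frameBasis_repr hyE]
    simp
  have h1 : H.form y e e = 0 := by
    rw [form_eq_sum H hy hyE]
    refine Finset.sum_eq_zero fun l _ => ?_
    have := congrFun hc0 l
    simp only [hcoord, hzy]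
    have h2 : ∑ k, metricMatrix H q z l k * c k = 0 := this
    rw [h2, mul_zero]
  have := H.pos y e he0
  rw [h1] at this
  simp at this

theorem matrixContDiff_metricMatrix (H : HermitianMetric V F E) {z : V}
    (hz : z ∈ frameDomain V F E q) : MatrixContDiffWithinAt ∞ (metricMatrix H q) univ z :=
  fun i j => contDiffWithinAt_univ.2 <| contDiffAt_comp_chart_symm
    (f := fun y => H.form y (frame F E q j y) (frame F E q i y)) hz.1
    (H.smooth _ _ _ (contMDiffAt_frame (n := ⊤) hz.2 j) (contMDiffAt_frame (n := ⊤) hz.2 i))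

/-- Smoothness of `D` is applied to a globally smooth section, while the frame is only local. A
cutoff by a bump function does not change the germ at the point, and `D` sees only the germ. -/
theorem matrixContDiff_connMatrix [T2Space X] [FiniteDimensional ℂ V] (D : ComplexConnection V F E)
    (v : V) {z : V} (hz : z ∈ frameDomain V F E q) :
    MatrixContDiffWithinAt ∞ (connMatrix D q v) univ z := by
  intro i j
  have hV : FiniteDimensional ℝ V := FiniteDimensional.complexToReal V
  set y := (chartAt V q).symm z with hyd
  have hy : y ∈ (chartAt V q).source := (chartAt V q).map_target hz.1
  have hyE : y ∈ (trivializationAt F E q).baseSet := hz.2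
  obtain ⟨φ, -, hφ⟩ := (SmoothBumpFunction.nhds_basis_tsupport (I := 𝓘(ℝ, V)) y).mem_iff.1
    ((trivializationAt F E q).open_baseSet.mem_nhds hyE)
  set σ : Π x, E x := fun x => φ x • frame F E q j x with hσ
  have hsm : ContMDiff 𝓘(ℝ, V) (𝓘(ℝ, V).prod 𝓘(ℝ, F)) ∞
      (fun x => TotalSpace.mk' F x (σ x)) := by
    have hm : ContMDiffOn 𝓘(ℝ, V) (𝓘(ℝ, V).prod 𝓘(ℝ, F)) ∞
        (fun x => TotalSpace.mk' F x (frame F E q j x)) (trivializationAt F E q).baseSet :=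
      fun x hx => (contMDiffAt_frame (n := ⊤) hx j).contMDiffWithinAt
    exact ContMDiffOn.smul_section_of_tsupport φ.contMDiff.contMDiffOn
      (trivializationAt F E q).open_baseSet hφ hm
  have heq : ∀ᶠ x in 𝓝 y, σ x = frame F E q j x := by
    filter_upwards [φ.eventuallyEq_one] with x hx
    rw [hσ]
    simp [hx]
  have hD := (D.smooth.contMDiff.contMDiff (σ := σ) hsm.contMDiffOn).contMDiffAt
    (x := y) univ_mem
  have hap : ContMDiffAt 𝓘(ℝ, V) (𝓘(ℝ, V).prod 𝓘(ℝ, F)) ∞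
      (fun x => TotalSpace.mk' F x (D.toFun σ x (constField q v x))) y := by
    have := ContMDiffAt.clm_bundle_apply (F₁ := V) (F₂ := F) (b := fun x : X => x)
      (E₁ := fun x : X => TangentSpace 𝓘(ℝ, V) x) (E₂ := E) hD (contMDiffAt_constField hy v)
    exact this
  have hf := contDiffAt_comp_chart_symm hz.1 (contMDiffAt_frameCoord (n := ⊤) hyE hap i)
  refine contDiffWithinAt_univ.2 (hf.congr_of_eventuallyEq ?_)
  have hzy : chartAt V q y = z := (chartAt V q).right_inv hz.1
  have hnear := eventually_mem_source hy (eventually_eventually_nhds.2 heq)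
  rw [hzy] at hnear
  filter_upwards [hnear, (isOpen_frameDomain q).mem_nhds hz] with w hw hw'
  have hE : (chartAt V q).symm w ∈ (trivializationAt F E q).baseSet := hw'.2
  have hc := D.isCovariantDerivativeOnUniv.congr_of_eventuallyEq
    (hsm.contMDiffAt.mdifferentiableAt (by simp)) (mdifferentiableAt_frame hE j) univ_mem hw.2
  change frameCoord F q _ (D.toFun (frame F E q j) _ _) i = _
  rw [← hc]

/-- The matrix of `ψ_H` in the local frame at `q`, in the direction of the constant vector `v` of
the chart at `q`. -/
def psiMatrix (D : ComplexConnection V F E) (H : HermitianMetric V F E) (q : X) (v z : V) :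
    Matrix (Fin (Module.finrank ℂ F)) (Fin (Module.finrank ℂ F)) ℂ :=
  endMatrix F q ((chartAt V q).symm z)
    (psi D H ((chartAt V q).symm z) (constField q v ((chartAt V q).symm z)))

theorem psiMatrix_chart (D : ComplexConnection V F E) (H : HermitianMetric V F E)
    (hy : y ∈ (chartAt V q).source) (v : V) : psiMatrix D H q v (chartAt V q y) =
      endMatrix F q y (psi D H y (constField q v y)) := by
  have h : ∀ y', y' = y → endMatrix F q y' (psi D H y' (constField q v y')) =
      endMatrix F q y (psi D H y (constField q v y)) := by
    rintro _ rfl; rfl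
  exact h _ ((chartAt V q).left_inv hy)

/-- `H⁻¹ S` in a local frame, where the matrix `S` of a sesquilinear form is only known
on the distinguished basis of the fibre. -/
theorem metricMatrix_mul_endMatrix_invMul (H : HermitianMetric V F E)
    (hy : y ∈ (chartAt V q).source) (hyE : y ∈ (trivializationAt F E q).baseSet)
    (B : E y → E y → ℂ) (S : Matrix (Fin (Module.finrank ℂ F)) (Fin (Module.finrank ℂ F)) ℂ)
    (hB : ∀ i j, B (fiberBasis F E y j) (fiberBasis F E y i) =
      (((frameBasis F E hyE).toMatrix (fiberBasis F E y)).conjTranspose * S *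
        (frameBasis F E hyE).toMatrix (fiberBasis F E y)) i j) :
    metricMatrix H q (chartAt V q y) * endMatrix F q y (invMul H y B) = S := by
  -- In the distinguished basis the two forms have matrices $C^{*}HC$ and $C^{*}SC$, and
  -- $(C^{*}HC)^{-1}C^{*}SC=C^{-1}(H^{-1}S)C$.
  set C := (frameBasis F E hyE).toMatrix (fiberBasis F E y) with hC
  set Hm := metricMatrix H q (chartAt V q y)
  have hCu : IsUnit C := by
    have := (frameBasis F E hyE).invertibleToMatrix (fiberBasis F E y)
    exact isUnit_of_invertible _
  have hCt : IsUnit C.conjTranspose := hCu.star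
  have hHu : IsUnit Hm := (Matrix.isUnit_iff_isUnit_det _).2
    (isUnit_iff_ne_zero.2 (det_metricMatrix_ne_zero H (chart_mem_frameDomain hy hyE)))
  have hform : (Matrix.of fun i j => H.form y (fiberBasis F E y j) (fiberBasis F E y i)) =
      C.conjTranspose * Hm * C := by
    ext i j
    rw [Matrix.of_apply, form_eq_sum H hy hyE, Matrix.mul_assoc, Matrix.mul_apply]
    refine Finset.sum_congr rfl fun l _ => ?_
    rw [Matrix.mul_apply]
    simp only [Matrix.conjTranspose_apply, hC, Module.Basis.toMatrix_apply, frameBasis_repr]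
    rfl
  have hBm : (Matrix.of fun i j => B (fiberBasis F E y j) (fiberBasis F E y i)) =
      C.conjTranspose * S * C := by
    ext i j
    exact hB i j
  have hT : LinearMap.toMatrix (fiberBasis F E y) (fiberBasis F E y) (invMul H y B) =
      (C.conjTranspose * Hm * C)⁻¹ * (C.conjTranspose * S * C) := by
    rw [invMul, LinearMap.toMatrix_toLin, hform, hBm]
  have hMC : endMatrix F q y (invMul H y B) * C =
      C * ((C.conjTranspose * Hm * C)⁻¹ * (C.conjTranspose * S * C)) := by
    rw [← hT, endMatrix_eq_toMatrix hyE, hC, linearMap_toMatrix_mul_basis_toMatrix,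
      basis_toMatrix_mul_linearMap_toMatrix]
  have hP : IsUnit (C.conjTranspose * Hm * C).det :=
    (Matrix.isUnit_iff_isUnit_det _).1 ((hCt.mul hHu).mul hCu)
  have h1 : C.conjTranspose * Hm * (endMatrix F q y (invMul H y B) * C) =
      C.conjTranspose * S * C := by
    rw [hMC, ← Matrix.mul_assoc, ← Matrix.mul_assoc, Matrix.mul_nonsing_inv _ hP, one_mul]
  rw [← Matrix.mul_assoc] at h1
  have h2 := hCu.mul_right_cancel h1
  rw [Matrix.mul_assoc] at h2
  exact hCt.mul_left_cancel h2

/-- The defining equation of $\psi_H$, $2H\psi=HA+A^{*}H-dH$, in an arbitrary frame. The definition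
uses the frame at the point itself; the expression is tensorial, so the derivatives of the change of
frame cancel. -/
theorem metricMatrix_mul_psiMatrix [T2Space X] [FiniteDimensional ℂ V]
    (D : ComplexConnection V F E) (H : HermitianMetric V F E) {z : V}
    (hz : z ∈ frameDomain V F E q) (v : V) :
    metricMatrix H q z * psiMatrix D H q v z = (1 / 2 : ℂ) • (metricMatrix H q z *
      connMatrix D q v z + (connMatrix D q v z).conjTranspose * metricMatrix H q z -
      matrixDeriv (metricMatrix H q) z v) := by
  set y := (chartAt V q).symm z with hyd
  have hy : y ∈ (chartAt V q).source := (chartAt V q).map_target hz.1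
  have hyE : y ∈ (trivializationAt F E q).baseSet := hz.2
  have hzy : chartAt V q y = z := (chartAt V q).right_inv hz.1
  have hyy : y ∈ (trivializationAt F E y).baseSet := FiberBundle.mem_baseSet_trivializationAt F E y
  -- The frame at `y` expressed in the frame at `q`, as a function of the point, since its
  -- derivative enters through the local extensions.
  set C : V → Matrix (Fin (Module.finrank ℂ F)) (Fin (Module.finrank ℂ F)) ℂ := fun w =>
    Matrix.of fun k i => frameCoord F q ((chartAt V q).symm w)
      (frame F E y i ((chartAt V q).symm w)) k with hC
  have hCy : ∀ k i, C z k i = frameCoord F q y (frame F E y i y) k := fun k i => rfl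
  have hCC : C z = (frameBasis F E hyE).toMatrix (fiberBasis F E y) := by
    ext k i
    rw [Module.Basis.toMatrix_apply, frameBasis_repr, fiberBasis_eq]
    rfl
  have hCd : MatrixDifferentiableAt C z := fun k i =>
    (contDiffAt_comp_chart_symm (n := 1) hz.1 (contMDiffAt_frameCoord (n := 1) hyE
      (contMDiffAt_frame (n := 1) hyy i) k)).differentiableAt one_ne_zero
  have hHd : MatrixDifferentiableAt (metricMatrix H q) z :=
    (matrixContDiff_metricMatrix H hz).differentiableAt (by simp)
  rw [← hzy, psiMatrix_chart D H hy]
  refine metricMatrix_mul_endMatrix_invMul H hy hyE _ _ fun i j => ?_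
  rw [← hCC, hzy]
  have hD : ∀ k j, frameCoord F q y (D.toFun (frame F E y j) y (constField q v y)) k =
      (matrixDeriv C z v + connMatrix D q v z * C z) k j := by
    intro k j
    have hd : ∀ i, DifferentiableAt ℝ (fun z => frameCoord F q ((chartAt V q).symm z)
        (frame F E y j ((chartAt V q).symm z)) i) (chartAt V q y) := fun i => by
      rw [hzy]; exact hCd i j
    have := frameCoord_connection D hy hyE hd v k
    rw [hzy] at this
    exact this
  have hform : ∀ e f : E y, H.form y e f = ∑ l, star (frameCoord F q y f l) *
      ∑ k, metricMatrix H q z l k * frameCoord F q y e k := by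
    intro e f
    rw [form_eq_sum H hy hyE, hzy]
  have hmv : mvfderiv 𝓘(ℝ, V) (fun x => H.form x (frame F E y j x) (frame F E y i x)) y
      (constField q v y) =
      matrixDeriv (fun w => (C w).conjTranspose * metricMatrix H q w * C w) z v i j := by
    have hm := (H.smooth y _ _ (contMDiffAt_frame (n := ⊤) hyy j)
      (contMDiffAt_frame (n := ⊤) hyy i)).mdifferentiableAt (by simp)
    rw [mvfderiv_constField hy hm, hzy, matrixDeriv_apply]
    congr 1
    refine Filter.EventuallyEq.fderiv_eq ?_
    filter_upwards [(isOpen_frameDomain q).mem_nhds hz] with w hw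
    have hws : (chartAt V q).symm w ∈ (chartAt V q).source := (chartAt V q).map_target hw.1
    change H.form _ _ _ = _
    rw [form_eq_sum H hws hw.2, (chartAt V q).right_inv hw.1, Matrix.mul_assoc, Matrix.mul_apply]
    refine Finset.sum_congr rfl fun l _ => ?_
    rw [Matrix.mul_apply]
    rfl
  have hext : ∀ i, FiberBundle.extend F (fiberBasis F E y i) = frame F E y i := fun i => by
    rw [fiberBasis_eq, extend_frame]
  simp only [hext, hmv]
  rw [matrixDeriv_mul (hCd.conjTranspose.mul hHd) hCd, matrixDeriv_mul hCd.conjTranspose hHd,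
    matrixDeriv_conjTranspose hCd, hform, hform, fiberBasis_eq, fiberBasis_eq]
  set M := matrixDeriv C z v with hM
  set A := connMatrix D q v z with hA
  set Hm := metricMatrix H q z with hHm
  have h1 : ∑ l, star (frameCoord F q y (frame F E y i y) l) * ∑ k, Hm l k *
      frameCoord F q y (D.toFun (frame F E y j) y (constField q v y)) k =
      ((C z).conjTranspose * (Hm * (M + A * C z))) i j := by
    rw [Matrix.mul_apply]
    refine Finset.sum_congr rfl fun l _ => ?_
    rw [Matrix.mul_apply]
    simp only [hD]
    rfl
  have h2 : ∑ l, star (frameCoord F q y (D.toFun (frame F E y i) y (constField q v y)) l) *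
      ∑ k, Hm l k * frameCoord F q y (frame F E y j y) k =
      ((M + A * C z).conjTranspose * (Hm * C z)) i j := by
    rw [Matrix.mul_apply]
    refine Finset.sum_congr rfl fun l _ => ?_
    rw [Matrix.mul_apply]
    simp only [hD]
    rfl
  rw [h1, h2]
  -- The terms with `M`, the derivative of `C`, cancel between the two connection terms and the
  -- derivative of $C^{*}HC$.
  have h3 : (C z).conjTranspose * ((1 / 2 : ℂ) • (Hm * A + A.conjTranspose * Hm -
      matrixDeriv (metricMatrix H q) z v)) * C z = (1 / 2 : ℂ) •
      ((C z).conjTranspose * (Hm * (M + A * C z)) +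
      (M + A * C z).conjTranspose * (Hm * C z) - ((M.conjTranspose * Hm +
        (C z).conjTranspose * matrixDeriv (metricMatrix H q) z v) * C z +
        (C z).conjTranspose * Hm * M)) := by
    rw [Matrix.mul_smul, Matrix.smul_mul, Matrix.conjTranspose_add, Matrix.conjTranspose_mul]
    congr 1
    noncomm_ring
  rw [h3]
  rfl

end FrameMatrices

/-! ### The contraction and the types of 2-forms -/

section KahlerTrace

variable {V : Type*} [NormedAddCommGroup V] [NormedSpace ℂ V] [FiniteDimensional ℂ V]
  {X : Type*} [TopologicalSpace X] [ChartedSpace V X] [IsManifold 𝓘(ℂ, V) ω X]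
  {W : Type*} [AddCommGroup W] [Module ℂ W]

/-- The contraction `Λ` as an operation on bilinear forms on the model space. -/
def kahlerTrace (g : KahlerMetric V X) (x : X) (γ : V → V → W) : W :=
  (1 / 2 : ℂ) • metricTrace g x fun u v => γ u (Complex.I • v)

theorem contract_eq_kahlerTrace (g : KahlerMetric V X) (x : X)
    (γ : TangentSpace 𝓘(ℝ, V) x → TangentSpace 𝓘(ℝ, V) x → W) :
    contract g x γ = kahlerTrace g x (γ : V → V → W) :=
  contract_eq_metricTrace g x γ

variable (g : KahlerMetric V X) (x : X)

theorem kahlerTrace_add (γ γ' : V → V → W) :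
    kahlerTrace g x (fun u v => γ u v + γ' u v) = kahlerTrace g x γ + kahlerTrace g x γ' := by
  rw [kahlerTrace, metricTrace_add, smul_add]; rfl

theorem kahlerTrace_sub (γ γ' : V → V → W) :
    kahlerTrace g x (fun u v => γ u v - γ' u v) = kahlerTrace g x γ - kahlerTrace g x γ' := by
  rw [kahlerTrace, metricTrace_sub, smul_sub]; rfl

theorem kahlerTrace_map {W' : Type*} [AddCommGroup W'] [Module ℂ W'] (f : W →ₗ[ℂ] W')
    (γ : V → V → W) : kahlerTrace g x (fun u v => f (γ u v)) = f (kahlerTrace g x γ) := by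
  rw [kahlerTrace, kahlerTrace, map_smul, metricTrace_map]

theorem kahlerTrace_smul (c : ℂ) (γ : V → V → W) :
    kahlerTrace g x (fun u v => c • γ u v) = c • kahlerTrace g x γ := by
  have h := kahlerTrace_map g x (c • (LinearMap.id : W →ₗ[ℂ] W)) γ
  simpa only [LinearMap.smul_apply, LinearMap.id_apply] using h

theorem metricTrace_neg (q : V → V → W) :
    metricTrace g x (fun u v => -q u v) = -metricTrace g x q := by
  simp [metricTrace]

variable {g x}

theorem isBilinearMap_neg_right {γ : V → V → W} [Module ℝ W] (hγ : IsBilinearMap ℝ γ) (u v : V) :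
    γ u (-v) = -γ u v := by
  have := hγ.smul_right (-1) u v
  simpa using this

theorem isBilinearMap_smul_I_right {γ : V → V → W} (hγ : IsBilinearMap ℝ γ) :
    IsBilinearMap ℝ fun u v => γ u (Complex.I • v) where
  add_left a b c := hγ.add_left a b _
  smul_left r a c := hγ.smul_left r a _
  add_right a b c := by simp only [smul_add]; exact hγ.add_right a _ _
  smul_right r a c := by simp only [smul_comm Complex.I r]; exact hγ.smul_right r a _

theorem kahlerTrace_smul_I {γ : V → V → W} (hγ : IsBilinearMap ℝ γ) :
    kahlerTrace g x (fun u v => γ (Complex.I • u) (Complex.I • v)) = kahlerTrace g x γ := by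
  rw [kahlerTrace, kahlerTrace]
  exact congrArg _ (metricTrace_smul_I g x _ (isBilinearMap_smul_I_right hγ))

theorem I_smul_I_smul (v : V) : Complex.I • Complex.I • v = -v := by
  rw [smul_smul, Complex.I_mul_I, neg_one_smul]

/-- Substituting $Jv$ in the second slot leaves the metric trace of $\gamma(Ju,Jv)-\gamma(u,v)$,
which is zero because $J$ is an isometry. -/
theorem kahlerTrace_smul_I_left_add {γ : V → V → W} (hγ : IsBilinearMap ℝ γ) :
    kahlerTrace g x (fun u v => γ (Complex.I • u) v + γ u (Complex.I • v)) = 0 := by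
  rw [kahlerTrace, metricTrace_add, metricTrace_smul_I g x _ hγ]
  simp only [I_smul_I_smul, isBilinearMap_neg_right hγ, metricTrace_neg, add_neg_cancel, smul_zero]

/-- Such forms are those of type $(2,0)+(0,2)$. Invariance of the contraction under $J$ makes it
equal to its own negative. -/
theorem kahlerTrace_eq_zero {γ : V → V → W} (hγ : IsBilinearMap ℝ γ)
    (h : ∀ u v, γ (Complex.I • u) (Complex.I • v) = -γ u v) : kahlerTrace g x γ = 0 := by
  have h1 := kahlerTrace_smul_I (g := g) (x := x) hγ
  simp only [h, kahlerTrace, metricTrace_neg, smul_neg] at h1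
  rw [kahlerTrace]
  have h2 : (2 : ℂ) • (1 / 2 : ℂ) • metricTrace g x (fun u v => γ u (Complex.I • v)) = 0 := by
    rw [two_smul]
    nth_rewrite 1 [← h1]
    exact neg_add_cancel _
  exact (smul_eq_zero.1 h2).resolve_left two_ne_zero

end KahlerTrace

/-! ### Contraction of the pseudo-curvature: linear algebra at a point -/

section Algebra

variable {V : Type*} [NormedAddCommGroup V] [NormedSpace ℂ V] [FiniteDimensional ℂ V]
  {X : Type*} [TopologicalSpace X] [ChartedSpace V X] [IsManifold 𝓘(ℂ, V) ω X]
  {ι : Type*} [Fintype ι] [DecidableEq ι]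

local notation "Mat" => Matrix ι ι ℂ

theorem isBilinearMap_mul {a b : V → Mat} (ha : IsLinearMap ℝ a) (hb : IsLinearMap ℝ b) :
    IsBilinearMap ℝ fun u v => a u * b v where
  add_left u u' v := by simp only [ha.map_add, add_mul]
  smul_left r u v := by simp only [ha.map_smul, Matrix.smul_mul]
  add_right u v v' := by simp only [hb.map_add, mul_add]
  smul_right r u v := by simp only [hb.map_smul, Matrix.mul_smul]

theorem isBilinearMap_add {W : Type*} [AddCommGroup W] [Module ℝ W] {q q' : V → V → W}
    (h : IsBilinearMap ℝ q) (h' : IsBilinearMap ℝ q') : IsBilinearMap ℝ fun u v => q u v + q' u v where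
  add_left u u' v := by rw [h.add_left, h'.add_left]; abel
  smul_left r u v := by rw [h.smul_left, h'.smul_left, smul_add]
  add_right u v v' := by rw [h.add_right, h'.add_right]; abel
  smul_right r u v := by rw [h.smul_right, h'.smul_right, smul_add]

theorem isBilinearMap_sub {W : Type*} [AddCommGroup W] [Module ℝ W] {q q' : V → V → W}
    (h : IsBilinearMap ℝ q) (h' : IsBilinearMap ℝ q') : IsBilinearMap ℝ fun u v => q u v - q' u v where
  add_left u u' v := by rw [h.add_left, h'.add_left]; abel
  smul_left r u v := by rw [h.smul_left, h'.smul_left, smul_sub]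
  add_right u v v' := by rw [h.add_right, h'.add_right]; abel
  smul_right r u v := by rw [h.smul_right, h'.smul_right, smul_sub]

theorem isBilinearMap_swap {W : Type*} [AddCommGroup W] [Module ℝ W] {q : V → V → W}
    (h : IsBilinearMap ℝ q) : IsBilinearMap ℝ fun u v => q v u where
  add_left _ _ _ := h.add_right _ _ _
  smul_left _ _ _ := h.smul_right _ _ _
  add_right _ _ _ := h.add_left _ _ _
  smul_right _ _ _ := h.smul_left _ _ _

theorem isBilinearMap_map {W W' : Type*} [AddCommGroup W] [Module ℂ W] [AddCommGroup W']
    [Module ℂ W'] {q : V → V → W} (h : IsBilinearMap ℝ q) (f : W →ₗ[ℂ] W') :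
    IsBilinearMap ℝ fun u v => f (q u v) where
  add_left u u' v := by rw [h.add_left, map_add]
  smul_left r u v := by rw [h.smul_left, ← Complex.coe_smul, map_smul, Complex.coe_smul]
  add_right u v v' := by rw [h.add_right, map_add]
  smul_right r u v := by rw [h.smul_right, ← Complex.coe_smul, map_smul, Complex.coe_smul]

/-- The `(1,0)`-part of a matrix-valued form on the model space. -/
def formPart10 (a : V → Mat) (v : V) : Mat := (1 / 2 : ℂ) • (a v - Complex.I • a (Complex.I • v))

/-- The `(0,1)`-part of a matrix-valued form on the model space. -/
def formPart01 (a : V → Mat) (v : V) : Mat := (1 / 2 : ℂ) • (a v + Complex.I • a (Complex.I • v))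

theorem isLinearMap_formPart10 {a : V → Mat} (ha : IsLinearMap ℝ a) :
    IsLinearMap ℝ (formPart10 a) where
  map_add u v := by
    simp only [formPart10, smul_add, ha.map_add]; module
  map_smul r v := by
    simp only [formPart10, smul_comm Complex.I r, ha.map_smul, smul_sub, smul_comm _ r]

theorem isLinearMap_formPart01 {a : V → Mat} (ha : IsLinearMap ℝ a) :
    IsLinearMap ℝ (formPart01 a) where
  map_add u v := by
    simp only [formPart01, smul_add, ha.map_add]; module
  map_smul r v := by
    simp only [formPart01, smul_comm Complex.I r, ha.map_smul, smul_add, smul_comm _ r]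

theorem formPart10_smul_I {a : V → Mat} (ha : IsLinearMap ℝ a) (v : V) :
    formPart10 a (Complex.I • v) = Complex.I • formPart10 a v := by
  have h : a (Complex.I • Complex.I • v) = -a v := by rw [I_smul_I_smul, ha.map_neg]
  simp only [formPart10, h]
  ext i j
  simp only [Matrix.smul_apply, Matrix.sub_apply, Matrix.neg_apply, smul_eq_mul]
  linear_combination ((1 / 2) * a (Complex.I • v) i j) * Complex.I_mul_I

theorem formPart01_smul_I {a : V → Mat} (ha : IsLinearMap ℝ a) (v : V) :
    formPart01 a (Complex.I • v) = -(Complex.I • formPart01 a v) := by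
  have h : a (Complex.I • Complex.I • v) = -a v := by rw [I_smul_I_smul, ha.map_neg]
  simp only [formPart01, h]
  ext i j
  simp only [Matrix.smul_apply, Matrix.add_apply, Matrix.neg_apply, smul_eq_mul]
  linear_combination ((1 / 2) * a (Complex.I • v) i j) * Complex.I_mul_I

/-- The covariant exterior derivative `∂_u χ_v - ∂_v χ_u + [N_u, χ_v] - [N_v, χ_u]` of an
endomorphism-valued form with derivatives `P u v = ∂_u χ_v`. -/
def covExt (N : V → Mat) (P : V → V → Mat) (χ : V → Mat) (u v : V) : Mat :=
  P u v - P v u + (N u * χ v - χ v * N u) - (N v * χ u - χ u * N v)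

variable (g : KahlerMetric V X) (x : X)

/-- The identity $\Lambda\,\mathrm{tr}(k\wedge\psi\circ J)=-\mathrm{tr}_g\,\mathrm{tr}(k\psi)$: both
terms give the same metric trace, one by $J^2=-1$ and the other by isometry and symmetry, and this
absorbs the factor $\tfrac12$. -/
theorem kahlerTrace_trace_wedge (k ψ : V → Mat) (hk : IsLinearMap ℝ k) (hψ : IsLinearMap ℝ ψ) :
    kahlerTrace g x (fun u v => (k u * ψ (Complex.I • v)).trace - (k v * ψ (Complex.I • u)).trace) =
      -metricTrace g x (fun u v => (k u * ψ v).trace) := by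
  have hb : IsBilinearMap ℝ fun u v => (k u * ψ v).trace :=
    isBilinearMap_map (isBilinearMap_mul hk hψ) (Matrix.traceLinearMap ι ℂ ℂ)
  rw [kahlerTrace, metricTrace_sub]
  have h1 : metricTrace g x (fun u v => (k u * ψ (Complex.I • Complex.I • v)).trace) =
      -metricTrace g x (fun u v => (k u * ψ v).trace) := by
    simp only [I_smul_I_smul, hψ.map_neg, mul_neg, Matrix.trace_neg, metricTrace_neg]
  have h2 : metricTrace g x (fun u v => (k (Complex.I • v) * ψ (Complex.I • u)).trace) =
      metricTrace g x (fun u v => (k u * ψ v).trace) := by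
    rw [← metricTrace_smul_I g x _ hb, ← metricTrace_swap]
  rw [h1, h2, smul_eq_mul]
  ring

/-- The left side is the contraction of the pseudo-curvature in a frame, with `N` the matrix of
$D_H$: the $(1,1)$-part of $D_H\psi^{1,0}$, the $(0,2)$-part of a form `γ`, and
$\psi^{1,0}\wedge(N^{0,1}+\psi^{1,0})$. Everything contracts to that of $D_H\psi^{1,0}$, and `h0`
removes the half of $\psi^{1,0}$ without $J$. -/
theorem kahlerTrace_pseudoCurvature (N ψ : V → Mat) (P : V → V → Mat) (hN : IsLinearMap ℝ N)
    (hψ : IsLinearMap ℝ ψ) (hP : IsBilinearMap ℝ P) (γ : V → V → Mat) (hγ : IsBilinearMap ℝ γ)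
    (h0 : kahlerTrace g x (covExt N P ψ) = 0) :
    kahlerTrace g x (fun u v =>
      (1 / 2 : ℂ) • (((1 / 2 : ℂ) • (P u v - Complex.I • P u (Complex.I • v)) +
            N u * formPart10 ψ v - ((1 / 2 : ℂ) • (P v u - Complex.I • P v (Complex.I • u)) +
            N v * formPart10 ψ u)) +
          ((1 / 2 : ℂ) • (P (Complex.I • u) (Complex.I • v) -
              Complex.I • P (Complex.I • u) (Complex.I • Complex.I • v)) +
            N (Complex.I • u) * formPart10 ψ (Complex.I • v) -
            ((1 / 2 : ℂ) • (P (Complex.I • v) (Complex.I • u) -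
              Complex.I • P (Complex.I • v) (Complex.I • Complex.I • u)) +
            N (Complex.I • v) * formPart10 ψ (Complex.I • u)))) +
        (1 / 4 : ℂ) • (γ u v - γ (Complex.I • u) (Complex.I • v) +
          Complex.I • (γ (Complex.I • u) v + γ u (Complex.I • v))) +
        (formPart10 ψ u * (formPart01 N v + formPart10 ψ v) -
          formPart10 ψ v * (formPart01 N u + formPart10 ψ u))) =
      (-(Complex.I / 2)) • kahlerTrace g x
        (covExt N (fun u v => P u (Complex.I • v)) fun v => ψ (Complex.I • v)) := by
  set Ψ := formPart10 ψ with hΨdef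
  have hΨ : IsLinearMap ℝ Ψ := isLinearMap_formPart10 hψ
  have hPI := isBilinearMap_smul_I_right hP
  set dΨ : V → V → Mat := fun u v => (1 / 2 : ℂ) • (P u v - Complex.I • P u (Complex.I • v)) with hdΨ
  have hdΨb : IsBilinearMap ℝ dΨ := by
    have h1 : IsBilinearMap ℝ fun u v => Complex.I • P u (Complex.I • v) :=
      isBilinearMap_map hPI (Complex.I • LinearMap.id)
    exact isBilinearMap_map (isBilinearMap_sub hP h1) ((1 / 2 : ℂ) • LinearMap.id)
  set δ : V → V → Mat := fun u v => dΨ u v + N u * Ψ v - (dΨ v u + N v * Ψ u) with hδ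
  have hδb : IsBilinearMap ℝ δ := by
    have h1 := isBilinearMap_add hdΨb (isBilinearMap_mul hN hΨ)
    exact isBilinearMap_sub h1 (isBilinearMap_swap h1)
  -- The difference between $N^{0,1}+\psi^{1,0}$ and $N$. It has type $(1,0)$, so its wedge with
  -- $\psi^{1,0}$ has type $(2,0)$ and is killed; what is left completes the commutator in
  -- $D_H\psi^{1,0}$.
  set Q : V → Mat := fun v => Ψ v - formPart10 N v with hQ
  have hQl : IsLinearMap ℝ Q :=
    ⟨fun u v => by simp only [hQ, hΨ.map_add, (isLinearMap_formPart10 hN).map_add]; abel,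
      fun r v => by
        simp only [hQ, hΨ.map_smul, (isLinearMap_formPart10 hN).map_smul, smul_sub]⟩
  have hQ20 : kahlerTrace g x (fun u v => Ψ u * Q v - Ψ v * Q u) = 0 := by
    have h1 := isBilinearMap_mul hΨ hQl
    refine kahlerTrace_eq_zero (isBilinearMap_sub h1 (isBilinearMap_swap h1)) fun u v => ?_
    have h2 : ∀ v, Ψ (Complex.I • v) = Complex.I • Ψ v := formPart10_smul_I hψ
    have h3 : ∀ v, Q (Complex.I • v) = Complex.I • Q v := fun v => by
      simp only [hQ, h2, formPart10_smul_I hN, smul_sub]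
    simp only [h2, h3, Matrix.smul_mul, Matrix.mul_smul, smul_smul, Complex.I_mul_I]
    simp only [neg_smul, one_smul]
    abel
  -- Taking the $(1,1)$-part does not change the contraction.
  have h11 : kahlerTrace g x (fun u v => (1 / 2 : ℂ) •
      (δ u v + δ (Complex.I • u) (Complex.I • v))) = kahlerTrace g x δ := by
    rw [kahlerTrace_smul, kahlerTrace_add, kahlerTrace_smul_I hδb, ← two_smul ℂ, smul_smul]
    norm_num
  have h02 : kahlerTrace g x (fun u v => (1 / 4 : ℂ) • (γ u v - γ (Complex.I • u) (Complex.I • v) +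
      Complex.I • (γ (Complex.I • u) v + γ u (Complex.I • v)))) = 0 := by
    rw [kahlerTrace_smul, kahlerTrace_add, kahlerTrace_sub, kahlerTrace_smul_I hγ,
      kahlerTrace_smul, kahlerTrace_smul_I_left_add hγ]
    simp
  have hR : ∀ v, formPart01 N v + Ψ v = N v + Q v := fun v => by
    simp only [hQ, formPart01, formPart10]
    ext i j
    simp only [Matrix.add_apply, Matrix.sub_apply, Matrix.smul_apply, smul_eq_mul]
    ring
  rw [kahlerTrace_add, kahlerTrace_add]
  rw [show kahlerTrace g x (fun u v => Ψ u * (formPart01 N v + Ψ v) -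
      Ψ v * (formPart01 N u + Ψ u)) = kahlerTrace g x (fun u v => Ψ u * N v - Ψ v * N u) by
    simp only [hR, mul_add]
    have : (fun u v => Ψ u * N v + Ψ u * Q v - (Ψ v * N u + Ψ v * Q u)) = fun u v =>
        (Ψ u * N v - Ψ v * N u) + (Ψ u * Q v - Ψ v * Q u) := by
      funext u v; abel
    rw [this, kahlerTrace_add, hQ20, add_zero]]
  rw [h02, add_zero]
  refine (congrArg (· + _) h11).trans ?_
  rw [← kahlerTrace_add]
  -- This is $D_H\psi^{1,0}$ with $\psi^{1,0}=\tfrac12\psi-\tfrac{\sqrt{-1}}2\psi\circ J$ inserted.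
  have hfin : (fun u v => δ u v + (Ψ u * N v - Ψ v * N u)) = fun u v =>
      (1 / 2 : ℂ) • covExt N P ψ u v + (-(Complex.I / 2)) •
        covExt N (fun u v => P u (Complex.I • v)) (fun v => ψ (Complex.I • v)) u v := by
    funext u v
    simp only [hδ, hdΨ, hΨdef, formPart10, covExt, Matrix.mul_smul, Matrix.smul_mul, mul_sub,
      sub_mul]
    ext i j
    simp only [Matrix.add_apply, Matrix.sub_apply, Matrix.smul_apply, smul_eq_mul]
    ring
  rw [hfin, kahlerTrace_add, kahlerTrace_smul, kahlerTrace_smul, h0, smul_zero, zero_add]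

/-- Integration by parts at one point: the Leibniz rule writes $\mathrm{tr}(D_N(\psi\circ J)\,h)$ as
the exact form $d\,\mathrm{tr}(h\,\psi\circ J)$ minus $\mathrm{tr}(D_Nh\wedge\psi\circ J)$, where
`k` stands for $dh$. Cyclicity of the trace matches the commutators. -/
theorem trace_covExt_mul (N ψ k : V → Mat) (P : V → V → Mat) (h : Mat) (hN : IsLinearMap ℝ N)
    (hψ : IsLinearMap ℝ ψ) (hk : IsLinearMap ℝ k) :
    ((-2 : ℂ) • kahlerTrace g x (covExt N (fun u v => P u (Complex.I • v))
        fun v => ψ (Complex.I • v)) * h).trace =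
      kahlerTrace g x (fun u v => (-2 : ℂ) * (k u * ψ (Complex.I • v) + h * P u (Complex.I • v)).trace -
        (-2 : ℂ) * (k v * ψ (Complex.I • u) + h * P v (Complex.I • u)).trace) -
      2 * metricTrace g x (fun u v => ((k u + (N u * h - h * N u)) * ψ v).trace) := by
  set κ : V → Mat := fun u => k u + (N u * h - h * N u) with hκ
  have hκl : IsLinearMap ℝ κ :=
    ⟨fun u v => by simp only [hκ, hk.map_add, hN.map_add, add_mul, mul_add]; abel,
      fun r v => by
        simp only [hκ, hk.map_smul, hN.map_smul, Matrix.smul_mul, Matrix.mul_smul, smul_add,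
          smul_sub]⟩
  have h1 := kahlerTrace_trace_wedge g x κ ψ hκl hψ
  set f : Mat →ₗ[ℂ] ℂ := (-2 : ℂ) • (Matrix.traceLinearMap ι ℂ ℂ ∘ₗ LinearMap.mulRight ℂ h) with hf
  have h2 : ∀ M, f M = ((-2 : ℂ) • M * h).trace := fun M => by
    simp [hf, Matrix.trace_smul]
  rw [← h2, ← kahlerTrace_map, sub_eq_add_neg, ← mul_neg, ← h1, ← smul_eq_mul (2 : ℂ),
    ← kahlerTrace_smul, ← kahlerTrace_add]
  congr 1
  funext u v
  simp only [h2, covExt, hκ, add_mul, sub_mul, smul_eq_mul, Matrix.smul_mul, Matrix.trace_add,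
    Matrix.trace_sub, Matrix.trace_smul]
  have c1 : ∀ w w', (P w (Complex.I • w') * h).trace = (h * P w (Complex.I • w')).trace :=
    fun w w' => Matrix.trace_mul_comm _ _
  have c2 : ∀ w w', (ψ (Complex.I • w') * N w * h).trace = (N w * h * ψ (Complex.I • w')).trace :=
    fun w w' => by rw [Matrix.mul_assoc, Matrix.trace_mul_comm]
  have c3 : ∀ w w', (N w * ψ (Complex.I • w') * h).trace = (h * N w * ψ (Complex.I • w')).trace :=
    fun w w' => by rw [Matrix.trace_mul_comm, Matrix.mul_assoc]
  rw [c1, c1, c2, c2, c3, c3]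
  ring

end Algebra

/-! ### Linearity and smoothness of $\psi_H$ -/

section PsiLinear

variable {V : Type*} [NormedAddCommGroup V] [NormedSpace ℂ V]
  {X : Type*} [TopologicalSpace X] [ChartedSpace V X]
  {F : Type*} [NormedAddCommGroup F] [NormedSpace ℂ F]
  {E : X → Type*} [∀ x, AddCommGroup (E x)] [∀ x, Module ℂ (E x)]
  [∀ x, TopologicalSpace (E x)] [∀ x, IsTopologicalAddGroup (E x)] [∀ x, ContinuousSMul ℂ (E x)]
  [TopologicalSpace (TotalSpace F E)] [FiberBundle F E]
  [FiniteDimensional ℂ F] [VectorBundle ℂ F E] [IsManifold 𝓘(ℂ, V) ω X]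

theorem invMul_add (H : HermitianMetric V F E) (x : X) (B B' : E x → E x → ℂ) :
    invMul H x (fun e f => B e f + B' e f) = invMul H x B + invMul H x B' := by
  rw [invMul, invMul, invMul, ← map_add, ← Matrix.mul_add]
  rfl

theorem invMul_smul (H : HermitianMetric V F E) (x : X) (c : ℂ) (B : E x → E x → ℂ) :
    invMul H x (fun e f => c * B e f) = c • invMul H x B := by
  rw [invMul, invMul, ← map_smul, ← Matrix.mul_smul]
  rfl

theorem psi_add (D : ComplexConnection V F E) (H : HermitianMetric V F E) (x : X)
    (u v : TangentSpace 𝓘(ℝ, V) x) : psi D H x (u + v) = psi D H x u + psi D H x v := by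
  rw [psi, psi, psi, ← invMul_add]
  congr 1
  funext e f
  simp only [map_add, LinearMap.add_apply]
  ring

theorem psi_smul (D : ComplexConnection V F E) (H : HermitianMetric V F E) (x : X)
    (r : ℝ) (v : TangentSpace 𝓘(ℝ, V) x) : psi D H x (r • v) = (r : ℂ) • psi D H x v := by
  rw [psi, psi, ← invMul_smul]
  congr 1
  funext e f
  simp only [map_smul, ← Complex.coe_smul, map_smulₛₗ, LinearMap.smul_apply, smul_eq_mul,
    Complex.conj_ofReal]
  ring

variable {q y : X}

theorem endMatrix_add (hy : y ∈ (trivializationAt F E q).baseSet) (S T : E y →ₗ[ℂ] E y) :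
    endMatrix F q y (S + T) = endMatrix F q y S + endMatrix F q y T := by
  ext i j
  exact frameCoord_add hy _ _ _

theorem endMatrix_smul (hy : y ∈ (trivializationAt F E q).baseSet) (c : ℂ) (T : E y →ₗ[ℂ] E y) :
    endMatrix F q y (c • T) = c • endMatrix F q y T := by
  ext i j
  exact frameCoord_smul hy _ _ _

variable [T2Space X] [FiniteDimensional ℂ V] [ContMDiffVectorBundle ∞ F E 𝓘(ℝ, V)]

theorem isLinearMap_connMatrix (D : ComplexConnection V F E) {z : V}
    (hz : z ∈ frameDomain V F E q) : IsLinearMap ℝ fun v => connMatrix D q v z := by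
  have hs := (chartAt V q).map_target hz.1
  constructor
  · intro u v
    ext i j
    change frameCoord F q _ (D.toFun _ _ (constField q (u + v) _)) i = _
    rw [constField_add hs, map_add, frameCoord_add hz.2]
    rfl
  · intro r v
    ext i j
    change frameCoord F q _ (D.toFun _ _ (constField q (r • v) _)) i = _
    rw [constField_smul hs, map_smul, ← Complex.coe_smul, frameCoord_smul hz.2]
    change _ = r • connMatrix D q v z i j
    rw [← Complex.coe_smul]
    rfl

theorem isLinearMap_psiMatrix (D : ComplexConnection V F E) (H : HermitianMetric V F E) {z : V}
    (hz : z ∈ frameDomain V F E q) : IsLinearMap ℝ fun v => psiMatrix D H q v z := by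
  have hs := (chartAt V q).map_target hz.1
  constructor
  · intro u v
    change endMatrix F q _ (psi D H _ (constField q (u + v) _)) = _
    rw [constField_add hs, psi_add, endMatrix_add hz.2]
    rfl
  · intro r v
    change endMatrix F q _ (psi D H _ (constField q (r • v) _)) = _
    rw [constField_smul hs, psi_smul, endMatrix_smul hz.2, Complex.coe_smul]
    rfl

/-- The equation for $H\psi$ is solved by inverting the metric matrix, which exhibits $\psi$ as a
smooth expression in $H$, $dH$ and $A$. -/
theorem matrixContDiff_psiMatrix (D : ComplexConnection V F E) (H : HermitianMetric V F E) {z : V}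
    (hz : z ∈ frameDomain V F E q) (v : V) :
    MatrixContDiffWithinAt ∞ (psiMatrix D H q v) univ z := by
  have hH := matrixContDiff_metricMatrix H hz
  have hA := matrixContDiff_connMatrix D v hz
  have h := (hH.inv (det_metricMatrix_ne_zero H hz)).mul (((hH.mul hA).add
    (hA.conjTranspose.mul hH)).sub (hH.matrixDeriv (m := ∞) (by simp) v)|>.const_smul (1 / 2 : ℂ))
  have heq : ∀ w ∈ frameDomain V F E q, psiMatrix D H q v w = (metricMatrix H q w)⁻¹ *
      (1 / 2 : ℂ) • (metricMatrix H q w * connMatrix D q v w +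
        (connMatrix D q v w).conjTranspose * metricMatrix H q w -
        matrixDeriv (metricMatrix H q) w v) := fun w hw => by
    rw [← metricMatrix_mul_psiMatrix D H hw v, ← Matrix.mul_assoc, Matrix.nonsing_inv_mul _
      (isUnit_iff_ne_zero.2 (det_metricMatrix_ne_zero H hw)), one_mul]
  intro i j
  refine contDiffWithinAt_univ.2 ((contDiffWithinAt_univ.1 (h i j)).congr_of_eventuallyEq ?_)
  filter_upwards [(isOpen_frameDomain q).mem_nhds hz] with w hw
  exact congrFun (congrFun (heq w hw) i) j

/-- Linearity in the index `v` is required on a neighbourhood, since the relation between the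
functions is differentiated. -/
theorem isBilinearMap_matrixDeriv {ι : Type*} [Fintype ι] [DecidableEq ι]
    {a : V → V → Matrix ι ι ℂ} {z : V} {U : Set V} (hU : U ∈ 𝓝 z)
    (ha : ∀ w ∈ U, IsLinearMap ℝ fun v => a v w) (hd : ∀ v, MatrixDifferentiableAt (a v) z) :
    IsBilinearMap ℝ fun u v => matrixDeriv (a v) z u where
  add_left u u' v := by
    ext i j
    simp [matrixDeriv_apply]
  smul_left r u v := by
    ext i j
    simp [matrixDeriv_apply]
  add_right u v v' := by
    rw [← matrixDeriv_add (hd v) (hd v')]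
    exact matrixDeriv_congr (by filter_upwards [hU] with w hw; exact (ha w hw).map_add v v') u
  smul_right r u v := by
    have h := matrixDeriv_const_smul (r : ℂ) (hd v) u
    rw [Complex.coe_smul] at h
    rw [← h]
    refine matrixDeriv_congr ?_ u
    filter_upwards [hU] with w hw
    rw [(ha w hw).map_smul, Complex.coe_smul]

end PsiLinear

/-! ### Curvature in a frame and the equation $\Lambda D_H\psi_H=0$ -/

section Curvature

variable {V : Type*} [NormedAddCommGroup V] [NormedSpace ℂ V] [FiniteDimensional ℂ V]
  {X : Type*} [TopologicalSpace X] [ChartedSpace V X]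
  {F : Type*} [NormedAddCommGroup F] [NormedSpace ℂ F]
  {E : X → Type*} [∀ x, AddCommGroup (E x)] [∀ x, Module ℂ (E x)]
  [∀ x, TopologicalSpace (E x)] [∀ x, IsTopologicalAddGroup (E x)] [∀ x, ContinuousSMul ℂ (E x)]
  [TopologicalSpace (TotalSpace F E)] [FiberBundle F E]
  [FiniteDimensional ℂ F] [VectorBundle ℂ F E] [IsManifold 𝓘(ℂ, V) ω X]
  [ContMDiffVectorBundle ∞ F E 𝓘(ℝ, V)] {q : X}

/-- If the operator is $d+K$ in the frame at `q`, its exterior derivative has the usual form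
$dM+K\wedge M$, because the extended coordinate fields commute. -/
theorem frameCoord_extDerivForm
    {nabla : (Π y, E y) → Π y : X, TangentSpace 𝓘(ℝ, V) y → E y}
    {K : V → Matrix (Fin (Module.finrank ℂ F)) (Fin (Module.finrank ℂ F)) ℂ}
    (hn : ∀ σ : Π y, E y, (∀ i, DifferentiableAt ℝ (fun z => frameCoord F q ((chartAt V q).symm z)
      (σ ((chartAt V q).symm z)) i) (chartAt V q q)) → ∀ (v : V) i,
      frameCoord F q q (nabla σ q v) i = fderiv ℝ (fun z => frameCoord F q ((chartAt V q).symm z)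
        (σ ((chartAt V q).symm z)) i) (chartAt V q q) v +
        ∑ j, K v i j * frameCoord F q q (σ q) j)
    {β : Fin (Module.finrank ℂ F) → Π y : X, TangentSpace 𝓘(ℝ, V) y → E y}
    {M : V → V → Matrix (Fin (Module.finrank ℂ F)) (Fin (Module.finrank ℂ F)) ℂ}
    (hβ : ∀ v, ∀ z ∈ frameDomain V F E q, ∀ i j, frameCoord F q ((chartAt V q).symm z)
      (β j ((chartAt V q).symm z) (constField q v ((chartAt V q).symm z))) i = M v z i j)
    (hM : ∀ v, MatrixDifferentiableAt (M v) (chartAt V q q)) (hM0 : M 0 (chartAt V q q) = 0)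
    (u v : V) (i j : Fin (Module.finrank ℂ F)) :
    frameCoord F q q (extDerivForm nabla (β j) q u v) i =
      (matrixDeriv (M v) (chartAt V q q) u + K u * M v (chartAt V q q) -
        (matrixDeriv (M u) (chartAt V q q) v + K v * M u (chartAt V q q))) i j := by
  have hV : CompleteSpace V := FiniteDimensional.complete ℂ V
  have hqE := FiberBundle.mem_baseSet_trivializationAt F E q
  have hz := chart_self_mem_frameDomain (V := V) (F := F) (E := E) q
  have hqq : (chartAt V q).symm (chartAt V q q) = q := (chartAt V q).left_inv (mem_chart_source V q)
  have hval : ∀ v i, frameCoord F q q (β j q (constField q v q)) i = M v (chartAt V q q) i j := by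
    intro v i
    have h : ∀ y, y = q → frameCoord F q y (β j y (constField q v y)) i =
        frameCoord F q q (β j q (constField q v q)) i := by rintro _ rfl; rfl
    rw [← hβ v _ hz i j, h _ hqq]
  have hev : ∀ v i, (fun z => frameCoord F q ((chartAt V q).symm z)
      (β j ((chartAt V q).symm z) (constField q v ((chartAt V q).symm z))) i)
      =ᶠ[𝓝 (chartAt V q q)] fun z => M v z i j := fun v i => by
    filter_upwards [(isOpen_frameDomain q).mem_nhds hz] with z hz
    exact hβ v z hz i j
  have hterm : ∀ u v : V, frameCoord F q q (nabla (fun y => β j y (constField q v y)) q u) i =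
      (matrixDeriv (M v) (chartAt V q q) u + K u * M v (chartAt V q q)) i j := by
    intro u v
    rw [hn _ (fun i => ((hM v i j).congr_of_eventuallyEq (hev v i))) u i,
      (hev v i).fderiv_eq, Matrix.add_apply, Matrix.mul_apply]
    simp only [hval]
    rfl
  -- The form `β j` is not assumed linear, so its value on the vanishing bracket has to come from
  -- `hM0`.
  have hbr : β j q (VectorField.mlieBracket 𝓘(ℝ, V) (constField q u) (constField q v) q) = 0 := by
    rw [mlieBracket_constField (mem_chart_source V q)]
    have h0 : (0 : TangentSpace 𝓘(ℝ, V) q) = constField (V := V) q (0 : V) q :=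
      (constField_self (V := V) q 0).symm
    rw [h0]
    refine frameCoord_ext hqE fun i => ?_
    rw [hval, hM0, ← frameBasis_repr hqE]
    simp
  have hext : ∀ v : TangentSpace 𝓘(ℝ, V) q, FiberBundle.extend V v = constField (V := V) q v :=
    fun v => funext fun y => extend_eq_constField (V := V) (x := q) v y
  have hdef : ∀ u v : TangentSpace 𝓘(ℝ, V) q, extDerivForm nabla (β j) q u v =
      nabla (fun y => β j y (constField (V := V) q v y)) q u -
      nabla (fun y => β j y (constField (V := V) q u y)) q v -
      β j q (VectorField.mlieBracket 𝓘(ℝ, V) (constField (V := V) q u)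
        (constField (V := V) q v) q) := by
    intro u v
    unfold extDerivForm
    rw [hext, hext]
  refine (congrArg (fun e => frameCoord F q q e i) (hdef u v)).trans ?_
  refine (congrArg (fun e => frameCoord F q q (_ - e) i) hbr).trans ?_
  rw [sub_zero, frameCoord_sub hqE]
  exact congrArg₂ _ (hterm u v) (hterm v u)

/-- The matrix of the curvature of `D` at `q` in the local frame at `q`. -/
def curvMatrix (D : ComplexConnection V F E) (q : X) (u v : V) :
    Matrix (Fin (Module.finrank ℂ F)) (Fin (Module.finrank ℂ F)) ℂ :=
  matrixDeriv (connMatrix D q v) (chartAt V q q) u +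
      connMatrix D q u (chartAt V q q) * connMatrix D q v (chartAt V q q) -
    (matrixDeriv (connMatrix D q u) (chartAt V q q) v +
      connMatrix D q v (chartAt V q q) * connMatrix D q u (chartAt V q q))

variable [T2Space X]

theorem frameCoord_curvature (D : ComplexConnection V F E) (u v : V)
    (i j : Fin (Module.finrank ℂ F)) :
    frameCoord F q q (curvature D q u v (frame F E q j q)) i = curvMatrix D q u v i j := by
  have hz := chart_self_mem_frameDomain (V := V) (F := F) (E := E) q
  unfold curvature
  rw [extend_frame]
  exact frameCoord_extDerivForm (nabla := fun σ y w => D.toFun σ y w)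
    (K := fun u => connMatrix D q u (chartAt V q q))
    (fun σ hσ v i => by
      have := frameCoord_connection D (mem_chart_source V q)
        (FiberBundle.mem_baseSet_trivializationAt F E q) hσ v i
      rwa [constField_self] at this)
    (β := fun j y w => D.toFun (frame F E q j) y w) (M := connMatrix D q)
    (fun v z _ i j => rfl)
    (fun v => (matrixContDiff_connMatrix D v hz).differentiableAt (by simp))
    ((isLinearMap_connMatrix D hz).map_zero) u v i j

theorem kahlerTrace_curvMatrix (g : KahlerMetric V X) {D : ComplexConnection V F E}
    (hD : IsNHYM g D) : ∃ lam : ℝ, ∀ q, kahlerTrace g q (curvMatrix D q) =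
      (-(Complex.I * lam)) • (1 : Matrix (Fin (Module.finrank ℂ F)) (Fin (Module.finrank ℂ F)) ℂ) := by
  obtain ⟨lam, hlam⟩ := hD.2
  refine ⟨lam, fun q => ?_⟩
  have hqE := FiberBundle.mem_baseSet_trivializationAt F E q
  ext i j
  have h := congrArg (fun e => Complex.I * frameCoord F q q e i) (hlam q (frame F E q j q))
  simp only [frameCoord_smul hqE, frameCoord_frame hqE] at h
  rw [← mul_assoc, Complex.I_mul_I] at h
  have h2 : frameCoord F q q (contract g q (fun u v => curvature D q u v (frame F E q j q))) i =
      kahlerTrace g q (curvMatrix D q) i j := by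
    rw [contract_eq_kahlerTrace]
    have h3 := kahlerTrace_map g q ((frameBasis F E hqE).coord i)
      (fun u v => curvature D q u v (frame F E q j q))
    have h4 := kahlerTrace_map g q (Matrix.entryLinearMap ℂ ℂ i j) (curvMatrix D q)
    rw [← frameBasis_repr hqE]
    refine h3.symm.trans (Eq.trans ?_ h4)
    congr 1
    funext u v
    exact (frameBasis_repr hqE _ _).trans (frameCoord_curvature D u v i j)
  rw [h2] at h
  rw [Matrix.smul_apply, Matrix.one_apply, smul_eq_mul]
  have h5 : (if j = i then (1 : ℂ) else 0) = if i = j then 1 else 0 := by simp only [eq_comm]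
  rw [h5] at h
  linear_combination -h

/-- The coefficients $\tfrac12g^{ab}$ of the contraction are real. -/
theorem kahlerTrace_conjTranspose {ι : Type*} [Fintype ι] (g : KahlerMetric V X) (x : X)
    (γ : V → V → Matrix ι ι ℂ) :
    kahlerTrace g x (fun u v => (γ u v).conjTranspose) = (kahlerTrace g x γ).conjTranspose := by
  ext i j
  simp only [kahlerTrace, metricTrace, Matrix.smul_apply, Matrix.sum_apply,
    Matrix.conjTranspose_apply, smul_eq_mul, star_mul', star_sum, Complex.real_smul]
  simp

/-- The matrix of the unitary connection `D_H` in the local frame at `q`. -/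
def unitaryMatrix (D : ComplexConnection V F E) (H : HermitianMetric V F E) (q : X) (v z : V) :
    Matrix (Fin (Module.finrank ℂ F)) (Fin (Module.finrank ℂ F)) ℂ :=
  connMatrix D q v z - psiMatrix D H q v z

/-- Compare the curvatures of $D=D_H+\psi$ and of the adjoint connection $D_H-\psi$: they have the
same contraction and differ by $2D_H\psi$. -/
theorem kahlerTrace_covExt_psi (g : KahlerMetric V X) {D : ComplexConnection V F E}
    (hD : IsNHYM g D) (H : HermitianMetric V F E) (q : X) :
    kahlerTrace g q (covExt (fun v => unitaryMatrix D H q v (chartAt V q q))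
      (fun u v => matrixDeriv (psiMatrix D H q v) (chartAt V q q) u)
      (fun v => psiMatrix D H q v (chartAt V q q))) = 0 := by
  obtain ⟨lam, hlam⟩ := kahlerTrace_curvMatrix g hD
  have hz := chart_self_mem_frameDomain (V := V) (F := F) (E := E) q
  set z := chartAt V q q
  set A := connMatrix D q with hA
  set ψ := psiMatrix D H q with hψ
  set Hm := metricMatrix H q with hHm
  -- The matrix of the adjoint connection $D_H-\psi=D-2\psi$, characterized by $HB=dH-A^{*}H$.
  set B : V → V → Matrix (Fin (Module.finrank ℂ F)) (Fin (Module.finrank ℂ F)) ℂ :=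
    fun v z => A v z - (2 : ℂ) • ψ v z with hB
  have hHc : MatrixContDiffWithinAt ∞ Hm univ z := matrixContDiff_metricMatrix H hz
  have hHd : MatrixDifferentiableAt Hm z := hHc.differentiableAt (by simp)
  have hAd : ∀ v, MatrixDifferentiableAt (A v) z := fun v =>
    (matrixContDiff_connMatrix D v hz).differentiableAt (by simp)
  have hψd : ∀ v, MatrixDifferentiableAt (ψ v) z := fun v =>
    (matrixContDiff_psiMatrix D H hz v).differentiableAt (by simp)
  have hBd : ∀ v, MatrixDifferentiableAt (B v) z := fun v => (hAd v).sub ((hψd v).const_smul 2)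
  have hHB : ∀ v, ∀ w ∈ frameDomain V F E q, Hm w * B v w =
      matrixDeriv Hm w v - (A v w).conjTranspose * Hm w := by
    intro v w hw
    have h := metricMatrix_mul_psiMatrix D H hw v
    change Hm w * (A v w - (2 : ℂ) • ψ v w) = _
    rw [mul_sub, Matrix.mul_smul]
    refine (congrArg (fun M => Hm w * A v w - (2 : ℂ) • M) h).trans ?_
    simp only [smul_smul]
    norm_num
    abel
  have hdH : ∀ v, matrixDeriv Hm z v = Hm z * B v z + (A v z).conjTranspose * Hm z := fun v => by
    rw [hHB v z hz]; abel
  have hdHB : ∀ u v, matrixDeriv Hm z u * B v z + Hm z * matrixDeriv (B v) z u =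
      matrixDeriv (fun w => matrixDeriv Hm w v) z u -
        ((matrixDeriv (A v) z u).conjTranspose * Hm z +
          (A v z).conjTranspose * matrixDeriv Hm z u) := by
    intro u v
    rw [← matrixDeriv_mul hHd (hBd v), ← matrixDeriv_conjTranspose (hAd v),
      ← matrixDeriv_mul (hAd v).conjTranspose hHd, ← matrixDeriv_sub
        ((hHc.matrixDeriv (m := ∞) (by simp) v).differentiableAt (by simp))
        ((hAd v).conjTranspose.mul hHd)]
    refine matrixDeriv_congr ?_ u
    filter_upwards [(isOpen_frameDomain q).mem_nhds hz] with w hw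
    exact hHB v w hw
  -- The curvature of `B` satisfies $HF_B=-F_A^{*}H$: differentiate $HB=dH-A^{*}H$, antisymmetrize,
  -- and use that the second derivatives of $H$ commute.
  have hFB : ∀ u v, Hm z * (matrixDeriv (B v) z u + B u z * B v z -
      (matrixDeriv (B u) z v + B v z * B u z)) = -((curvMatrix D q u v).conjTranspose * Hm z) := by
    intro u v
    have h1 := hdHB u v
    have h2 := hdHB v u
    have h3 : matrixDeriv (fun w => matrixDeriv Hm w v) z u =
        matrixDeriv (fun w => matrixDeriv Hm w u) z v :=
      matrixDeriv_comm (fun i j => (hHc i j).of_le (WithTop.coe_le_coe.2 (le_top : (2 : ℕ∞) ≤ ⊤))) v u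
    rw [hdH u, h3] at h1
    rw [hdH v] at h2
    have h4 : (curvMatrix D q u v).conjTranspose = (matrixDeriv (A v) z u).conjTranspose +
        (A v z).conjTranspose * (A u z).conjTranspose - ((matrixDeriv (A u) z v).conjTranspose +
        (A u z).conjTranspose * (A v z).conjTranspose) := by
      simp only [curvMatrix, Matrix.conjTranspose_sub, Matrix.conjTranspose_add,
        Matrix.conjTranspose_mul]
      rfl
    rw [h4]
    rw [← eq_sub_iff_add_eq'] at h1 h2
    rw [mul_sub, mul_add, mul_add, h1, h2]
    noncomm_ring
  -- Reality of $\lambda$ enters here: $-\sqrt{-1}\lambda$ is fixed by conjugation followed by a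
  -- change of sign.
  have hkB : kahlerTrace g q (fun u v => matrixDeriv (B v) z u + B u z * B v z -
      (matrixDeriv (B u) z v + B v z * B u z)) = (-(Complex.I * lam)) • 1 := by
    have hu : IsUnit (Hm z) := (Matrix.isUnit_iff_isUnit_det _).2
      (isUnit_iff_ne_zero.2 (det_metricMatrix_ne_zero H hz))
    refine hu.mul_left_cancel ?_
    have h1 := kahlerTrace_map g q (LinearMap.mulLeft ℂ (Hm z))
      (fun u v => matrixDeriv (B v) z u + B u z * B v z -
        (matrixDeriv (B u) z v + B v z * B u z))
    have h2 := kahlerTrace_map g q (-LinearMap.mulRight ℂ (Hm z))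
      (fun u v => (curvMatrix D q u v).conjTranspose)
    have h3 : (fun u v => LinearMap.mulLeft ℂ (Hm z) (matrixDeriv (B v) z u + B u z * B v z -
        (matrixDeriv (B u) z v + B v z * B u z))) = fun u v =>
        (-LinearMap.mulRight ℂ (Hm z)) (curvMatrix D q u v).conjTranspose := by
      funext u v
      exact hFB u v
    rw [h3, h2, kahlerTrace_conjTranspose] at h1
    have h4 : kahlerTrace g q (fun u v => curvMatrix D q u v) = (-(Complex.I * lam)) • 1 := hlam q
    rw [h4] at h1
    refine h1.symm.trans ?_
    simp
  -- With $A=N+\psi$ and $B=N-\psi$ the quadratic terms in $\psi$ cancel in the difference of the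
  -- curvatures.
  have hsplit : ∀ u v, curvMatrix D q u v = (matrixDeriv (B v) z u + B u z * B v z -
      (matrixDeriv (B u) z v + B v z * B u z)) + (2 : ℂ) •
      covExt (fun v => unitaryMatrix D H q v z) (fun u v => matrixDeriv (ψ v) z u)
        (fun v => ψ v z) u v := by
    intro u v
    have hBder : ∀ u v, matrixDeriv (B v) z u = matrixDeriv (A v) z u -
        (2 : ℂ) • matrixDeriv (ψ v) z u := fun u v => by
      rw [← matrixDeriv_const_smul _ (hψd v), ← matrixDeriv_sub (hAd v) ((hψd v).const_smul 2)]
    rw [hBder, hBder]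
    simp only [curvMatrix, covExt, unitaryMatrix, hB, two_smul]
    noncomm_ring
  have h5 := hlam q
  have h6 : curvMatrix D q = fun u v => (matrixDeriv (B v) z u + B u z * B v z -
      (matrixDeriv (B u) z v + B v z * B u z)) + (2 : ℂ) •
      covExt (fun v => unitaryMatrix D H q v z) (fun u v => matrixDeriv (ψ v) z u)
        (fun v => ψ v z) u v := funext fun u => funext fun v => hsplit u v
  rw [h6, kahlerTrace_add, hkB, kahlerTrace_smul] at h5
  exact (smul_eq_zero.1 (add_eq_left.1 h5)).resolve_left two_ne_zero

end Curvature

/-! ### The integrand for a fixed metric, up to an exact term -/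

section StaticIdentity

variable {V : Type*} [NormedAddCommGroup V] [NormedSpace ℂ V] [FiniteDimensional ℂ V]
  {X : Type*} [TopologicalSpace X] [ChartedSpace V X] [T2Space X]
  {F : Type*} [NormedAddCommGroup F] [NormedSpace ℂ F]
  {E : X → Type*} [∀ x, AddCommGroup (E x)] [∀ x, Module ℂ (E x)]
  [∀ x, TopologicalSpace (E x)] [∀ x, IsTopologicalAddGroup (E x)] [∀ x, ContinuousSMul ℂ (E x)]
  [TopologicalSpace (TotalSpace F E)] [FiberBundle F E]
  [FiniteDimensional ℂ F] [VectorBundle ℂ F E] [IsManifold 𝓘(ℂ, V) ω X]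
  [ContMDiffVectorBundle ∞ F E 𝓘(ℝ, V)] {q : X}

variable (F) in
/-- The matrix of a field of endomorphisms in the local frame and chart at `q`. -/
def fieldMatrix (q : X) (T : Π y : X, E y →ₗ[ℂ] E y) (z : V) :
    Matrix (Fin (Module.finrank ℂ F)) (Fin (Module.finrank ℂ F)) ℂ :=
  endMatrix F q ((chartAt V q).symm z) (T ((chartAt V q).symm z))

theorem fieldMatrix_chart (T : Π y : X, E y →ₗ[ℂ] E y) {y : X} (hy : y ∈ (chartAt V q).source) :
    fieldMatrix F q T (chartAt V q y) = endMatrix F q y (T y) := by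
  have h : ∀ y', y' = y → endMatrix F q y' (T y') = endMatrix F q y (T y) := by
    rintro _ rfl; rfl
  exact h _ ((chartAt V q).left_inv hy)

variable (V F) in
/-- A field of endomorphisms with continuously differentiable matrix entries. -/
def IsC1Field (T : Π y : X, E y →ₗ[ℂ] E y) : Prop :=
  ∀ q, ∀ z ∈ frameDomain V F E q, MatrixContDiffWithinAt 1 (fieldMatrix (V := V) F q T) univ z

/-- The 1-form `v ↦ -2 tr(T ψ(J v))`. -/
def transgression (D : ComplexConnection V F E) (H : HermitianMetric V F E)
    (T : Π y : X, E y →ₗ[ℂ] E y) (y : X) : V →L[ℝ] ℂ :=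
  letI : FiniteDimensional ℝ V := FiniteDimensional.complexToReal V
  LinearMap.toContinuousLinearMap
    { toFun := fun v : V => (-2 : ℂ) * LinearMap.trace ℂ (E y)
        (T y ∘ₗ psi D H y (complexStructure y (show TangentSpace 𝓘(ℝ, V) y from v)))
      map_add' := fun u v => by
        rw [← mul_add, ← map_add, ← LinearMap.comp_add, ← psi_add, ← map_add]
        rfl
      map_smul' := fun r v => by
        have h : psi D H y (complexStructure y (r • show TangentSpace 𝓘(ℝ, V) y from v)) =
            (r : ℂ) • psi D H y (complexStructure y (show TangentSpace 𝓘(ℝ, V) y from v)) := by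
          rw [map_smul, psi_smul]
        refine (congrArg (fun S => (-2 : ℂ) * LinearMap.trace ℂ (E y) (T y ∘ₗ S)) h).trans ?_
        rw [LinearMap.comp_smul, map_smul, RingHom.id_apply, ← Complex.coe_smul, smul_eq_mul,
          smul_eq_mul]
        ring }

theorem transgression_apply (D : ComplexConnection V F E) (H : HermitianMetric V F E)
    (T : Π y : X, E y →ₗ[ℂ] E y) (y : X) (v : TangentSpace 𝓘(ℝ, V) y) :
    transgression D H T y v = (-2 : ℂ) * LinearMap.trace ℂ (E y)
        (T y ∘ₗ psi D H y (complexStructure y v)) := rfl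

theorem formInChart_transgression (D : ComplexConnection V F E) (H : HermitianMetric V F E)
    (T : Π y : X, E y →ₗ[ℂ] E y) {z : V} (hz : z ∈ frameDomain V F E q) (v : V) :
    formInChart (transgression D H T) q z v =
      (-2 : ℂ) * (fieldMatrix F q T z * psiMatrix D H q (Complex.I • v) z).trace := by
  have hy := (chartAt V q).map_target hz.1
  have hyE : (chartAt V q).symm z ∈ (trivializationAt F E q).baseSet := hz.2
  have h := formInChart_apply (β := transgression D H T) hy v
  rw [(chartAt V q).right_inv hz.1] at h
  rw [h]
  refine (transgression_apply D H T _ _).trans ?_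
  rw [complexStructure_constField hy, trace_eq_trace_endMatrix hyE, endMatrix_comp hyE]
  rfl

/-- In the chart and frame at one point, the coefficients are traces of products of differentiable
matrices. -/
theorem isC1Form_transgression (D : ComplexConnection V F E) (H : HermitianMetric V F E)
    {T : Π y : X, E y →ₗ[ℂ] E y} (hT : IsC1Field V F T) : IsC1Form (transgression D H T) := by
  have hV : FiniteDimensional ℝ V := FiniteDimensional.complexToReal V
  have hloc : ∀ q, ContDiffOn ℝ 1 (formInChart (transgression D H T) q) (frameDomain V F E q) := by
    intro q
    refine contDiffOn_clm_apply.2 fun v => ?_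
    have : ContDiffOn ℝ 1 (fun z => (-2 : ℂ) *
        (fieldMatrix F q T z * psiMatrix D H q (Complex.I • v) z).trace) (frameDomain V F E q) := by
      intro z hz
      have h := ((hT q z hz).mul (fun i j => ((matrixContDiff_psiMatrix D H hz (Complex.I • v)) i j).of_le
        (by simp))).trace
      exact (contDiffWithinAt_const.mul h).mono (subset_univ _)
    exact this.congr fun z hz => formInChart_transgression D H T hz v
  -- The frame at `p` may not be defined over the whole chart at `p`; regularity is checked in the
  -- chart and frame at the point itself and carried over by the transition map.
  intro p z hz
  set y := (chartAt V p).symm z with hyd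
  have hy : y ∈ (chartAt V p).source := (chartAt V p).map_target hz
  have hzy : chartAt V p y = z := (chartAt V p).right_inv hz
  have hev := formInChart_eventuallyEq (β := transgression D H T) hy
  have hτ : ContDiffAt ℝ 2 (transition p y) (chartAt V p y) :=
    transition_contDiffAt hy (mem_chart_source V y)
  have hτy : transition p y (chartAt V p y) = chartAt V y y := transition_apply hy
  have h1 : ContDiffAt ℝ 1 (formInChart (transgression D H T) y)
      (transition p y (chartAt V p y)) := by
    rw [hτy]
    exact (hloc y).contDiffAt ((isOpen_frameDomain y).mem_nhds (chart_self_mem_frameDomain y))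
  have h2 := (h1.comp _ (hτ.of_le one_le_two)).clm_comp
    (hτ.fderiv_right (m := 1) (by norm_num))
  have h3 := h2.congr_of_eventuallyEq hev
  rw [hzy] at h3
  exact h3.contDiffWithinAt

theorem dform_transgression (D : ComplexConnection V F E) (H : HermitianMetric V F E)
    {T : Π y : X, E y →ₗ[ℂ] E y} (hT : IsC1Field V F T) (q : X) (u v : V) :
    dform (transgression D H T) q u v =
      (-2 : ℂ) * (matrixDeriv (fieldMatrix F q T) (chartAt V q q) u *
        psiMatrix D H q (Complex.I • v) (chartAt V q q) + fieldMatrix F q T (chartAt V q q) *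
        matrixDeriv (psiMatrix D H q (Complex.I • v)) (chartAt V q q) u).trace -
      (-2 : ℂ) * (matrixDeriv (fieldMatrix F q T) (chartAt V q q) v *
        psiMatrix D H q (Complex.I • u) (chartAt V q q) + fieldMatrix F q T (chartAt V q q) *
        matrixDeriv (psiMatrix D H q (Complex.I • u)) (chartAt V q q) v).trace := by
  have hz := chart_self_mem_frameDomain (V := V) (F := F) (E := E) q
  have hd : DifferentiableAt ℝ (formInChart (transgression D H T) q) (chartAt V q q) :=
    ((isC1Form_transgression D H hT).contDiffAt (mem_chart_source V q)).differentiableAt one_ne_zero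
  have hTd : MatrixDifferentiableAt (fieldMatrix F q T) (chartAt V q q) :=
    (hT q _ hz).differentiableAt one_ne_zero
  have hψd : ∀ v, MatrixDifferentiableAt (psiMatrix D H q v) (chartAt V q q) := fun v =>
    (matrixContDiff_psiMatrix D H hz v).differentiableAt (by simp)
  have key : ∀ u v : V, fderiv ℝ (formInChart (transgression D H T) q) (chartAt V q q) u v =
      (-2 : ℂ) * (matrixDeriv (fieldMatrix F q T) (chartAt V q q) u *
        psiMatrix D H q (Complex.I • v) (chartAt V q q) + fieldMatrix F q T (chartAt V q q) *
        matrixDeriv (psiMatrix D H q (Complex.I • v)) (chartAt V q q) u).trace := by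
    intro u v
    have h1 : fderiv ℝ (fun z => formInChart (transgression D H T) q z v) (chartAt V q q) u =
        fderiv ℝ (formInChart (transgression D H T) q) (chartAt V q q) u v := by
      rw [fderiv_clm_apply hd (differentiableAt_const _)]
      simp
    have h2 : (fun z => formInChart (transgression D H T) q z v) =ᶠ[𝓝 (chartAt V q q)]
        fun z => (((-2 : ℂ) • (fieldMatrix F q T z * psiMatrix D H q (Complex.I • v) z)).trace) := by
      filter_upwards [(isOpen_frameDomain q).mem_nhds hz] with z hz
      rw [formInChart_transgression D H T hz v, Matrix.trace_smul, smul_eq_mul]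
    rw [← h1, h2.fderiv_eq, matrixDeriv_trace ((hTd.mul (hψd _)).const_smul _),
      matrixDeriv_const_smul _ (hTd.mul (hψd _)), matrixDeriv_mul hTd (hψd _), Matrix.trace_smul,
      smul_eq_mul]
  rw [dform, key, key]

theorem frameCoord_unitaryPart (D : ComplexConnection V F E) (H : HermitianMetric V F E)
    {z : V} (hz : z ∈ frameDomain V F E q) (v : V) (i j : Fin (Module.finrank ℂ F)) :
    frameCoord F q ((chartAt V q).symm z) (unitaryPart D H (frame F E q j) ((chartAt V q).symm z)
      (constField q v ((chartAt V q).symm z))) i = unitaryMatrix D H q v z i j := by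
  have hyE : (chartAt V q).symm z ∈ (trivializationAt F E q).baseSet := hz.2
  rw [unitaryPart, frameCoord_sub hyE]
  rfl

theorem frameCoord_part10 {y : X} (hy : y ∈ (chartAt V q).source)
    (hyE : y ∈ (trivializationAt F E q).baseSet)
    {β : Fin (Module.finrank ℂ F) → TangentSpace 𝓘(ℝ, V) y → E y}
    {M : V → Matrix (Fin (Module.finrank ℂ F)) (Fin (Module.finrank ℂ F)) ℂ}
    (hβ : ∀ v i j, frameCoord F q y (β j (constField q v y)) i = M v i j) (v : V)
    (i j : Fin (Module.finrank ℂ F)) :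
    frameCoord F q y (part10 (β j) (constField q v y)) i = formPart10 M v i j := by
  rw [part10, frameCoord_smul hyE, frameCoord_sub hyE, frameCoord_smul hyE,
    complexStructure_constField hy, hβ, hβ]
  rfl

theorem frameCoord_part01 {y : X} (hy : y ∈ (chartAt V q).source)
    (hyE : y ∈ (trivializationAt F E q).baseSet)
    {β : Fin (Module.finrank ℂ F) → TangentSpace 𝓘(ℝ, V) y → E y}
    {M : V → Matrix (Fin (Module.finrank ℂ F)) (Fin (Module.finrank ℂ F)) ℂ}
    (hβ : ∀ v i j, frameCoord F q y (β j (constField q v y)) i = M v i j) (v : V)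
    (i j : Fin (Module.finrank ℂ F)) :
    frameCoord F q y (part01 (β j) (constField q v y)) i = formPart01 M v i j := by
  rw [part01, frameCoord_smul hyE, frameCoord_add hyE, frameCoord_smul hyE,
    complexStructure_constField hy, hβ, hβ]
  rfl

theorem endMatrix_part10 {y : X} (hy : y ∈ (chartAt V q).source)
    (hyE : y ∈ (trivializationAt F E q).baseSet)
    {β : TangentSpace 𝓘(ℝ, V) y → E y →ₗ[ℂ] E y}
    {M : V → Matrix (Fin (Module.finrank ℂ F)) (Fin (Module.finrank ℂ F)) ℂ}
    (hβ : ∀ v, endMatrix F q y (β (constField q v y)) = M v) (v : V) :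
    endMatrix F q y (part10 β (constField q v y)) = formPart10 M v := by
  rw [part10, endMatrix_smul hyE, sub_eq_add_neg, endMatrix_add hyE, ← neg_smul,
    endMatrix_smul hyE, complexStructure_constField hy, hβ, hβ, neg_smul, ← sub_eq_add_neg]
  rfl

theorem frameCoord_dSecond₀ (D : ComplexConnection V F E) (H : HermitianMetric V F E)
    {z : V} (hz : z ∈ frameDomain V F E q) (v : V) (i j : Fin (Module.finrank ℂ F)) :
    frameCoord F q ((chartAt V q).symm z) (dSecond₀ D H (frame F E q j) ((chartAt V q).symm z)
      (constField q v ((chartAt V q).symm z))) i =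
      (formPart01 (fun v => unitaryMatrix D H q v z) v +
        formPart10 (fun v => psiMatrix D H q v z) v) i j := by
  have hy := (chartAt V q).map_target hz.1
  have hyE : (chartAt V q).symm z ∈ (trivializationAt F E q).baseSet := hz.2
  rw [dSecond₀, frameCoord_add hyE,
    frameCoord_part01 hy hyE (β := fun j => unitaryPart D H (frame F E q j) ((chartAt V q).symm z))
      (frameCoord_unitaryPart D H hz) v i j]
  exact congrArg (_ + ·) (congrFun (congrFun (endMatrix_part10 hy hyE
    (β := psi D H ((chartAt V q).symm z)) (M := fun v => psiMatrix D H q v z)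
    (fun v => rfl) v) i) j)

/-- Identifies the $(1,0)$-part of $D''_Hs$ as $\psi^{1,0}s$, to which $\bar\partial_H$ is applied
next. -/
theorem formPart10_formPart01_add
    {N ψ : V → Matrix (Fin (Module.finrank ℂ F)) (Fin (Module.finrank ℂ F)) ℂ}
    (hN : IsLinearMap ℝ N) (hψ : IsLinearMap ℝ ψ) (v : V) :
    formPart10 (fun v => formPart01 N v + formPart10 ψ v) v = formPart10 ψ v := by
  change (1 / 2 : ℂ) • ((formPart01 N v + formPart10 ψ v) - Complex.I •
    (formPart01 N (Complex.I • v) + formPart10 ψ (Complex.I • v))) = _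
  rw [formPart01_smul_I hN, formPart10_smul_I hψ]
  ext i j
  simp only [Matrix.smul_apply, Matrix.add_apply, Matrix.sub_apply, Matrix.neg_apply, smul_eq_mul]
  linear_combination (1 / 2) * (formPart01 N v i j - formPart10 ψ v i j) * Complex.I_mul_I

theorem formPart01_formPart01_add
    {N ψ : V → Matrix (Fin (Module.finrank ℂ F)) (Fin (Module.finrank ℂ F)) ℂ}
    (hN : IsLinearMap ℝ N) (hψ : IsLinearMap ℝ ψ) (v : V) :
    formPart01 (fun v => formPart01 N v + formPart10 ψ v) v = formPart01 N v := by
  change (1 / 2 : ℂ) • ((formPart01 N v + formPart10 ψ v) + Complex.I •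
    (formPart01 N (Complex.I • v) + formPart10 ψ (Complex.I • v))) = _
  rw [formPart01_smul_I hN, formPart10_smul_I hψ]
  ext i j
  simp only [Matrix.smul_apply, Matrix.add_apply, Matrix.neg_apply, smul_eq_mul]
  linear_combination (1 / 2) * (formPart10 ψ v i j - formPart01 N v i j) * Complex.I_mul_I

theorem frameCoord_extDerivForm_unitaryPart (D : ComplexConnection V F E) (H : HermitianMetric V F E)
    {β : Fin (Module.finrank ℂ F) → Π y : X, TangentSpace 𝓘(ℝ, V) y → E y}
    {M : V → V → Matrix (Fin (Module.finrank ℂ F)) (Fin (Module.finrank ℂ F)) ℂ}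
    (hβ : ∀ v, ∀ z ∈ frameDomain V F E q, ∀ i j, frameCoord F q ((chartAt V q).symm z)
      (β j ((chartAt V q).symm z) (constField q v ((chartAt V q).symm z))) i = M v z i j)
    (hM : ∀ v, MatrixDifferentiableAt (M v) (chartAt V q q)) (hM0 : M 0 (chartAt V q q) = 0)
    (u v : V) (i j : Fin (Module.finrank ℂ F)) :
    frameCoord F q q (extDerivForm (unitaryPart D H) (β j) q u v) i =
      (matrixDeriv (M v) (chartAt V q q) u +
        unitaryMatrix D H q u (chartAt V q q) * M v (chartAt V q q) -
        (matrixDeriv (M u) (chartAt V q q) v +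
          unitaryMatrix D H q v (chartAt V q q) * M u (chartAt V q q))) i j := by
  have hqE := FiberBundle.mem_baseSet_trivializationAt F E q
  refine frameCoord_extDerivForm (nabla := unitaryPart D H)
    (K := fun u => unitaryMatrix D H q u (chartAt V q q)) ?_ hβ hM hM0 u v i j
  intro σ hσ v i
  have h1 := frameCoord_connection D (mem_chart_source V q) hqE hσ v i
  rw [constField_self] at h1
  have h2 := frameCoord_apply hqE (psi D H q v) (σ q) i
  have h3 : endMatrix F q q (psi D H q v) = psiMatrix D H q v (chartAt V q q) := by
    have := psiMatrix_chart (F := F) D H (mem_chart_source V q) v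
    rw [constField_self] at this
    exact this.symm
  rw [h3] at h2
  refine (frameCoord_sub hqE _ _ i).trans ?_
  refine (congrArg₂ (· - ·) h1 h2).trans ?_
  rw [add_sub_assoc, ← Finset.sum_sub_distrib]
  simp only [← sub_mul]
  rfl

theorem isLinearMap_unitaryMatrix (D : ComplexConnection V F E) (H : HermitianMetric V F E) {z : V}
    (hz : z ∈ frameDomain V F E q) : IsLinearMap ℝ fun v => unitaryMatrix D H q v z := by
  have hA := isLinearMap_connMatrix D hz
  have hψ := isLinearMap_psiMatrix D H hz
  constructor
  · intro u v
    simp only [unitaryMatrix, hA.map_add, hψ.map_add]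
    abel
  · intro r v
    simp only [unitaryMatrix, hA.map_smul, hψ.map_smul, smul_sub]

theorem pseudoCurvature_frame (D : ComplexConnection V F E) (H : HermitianMetric V F E) (q : X)
    (u v : TangentSpace 𝓘(ℝ, V) q) (j : Fin (Module.finrank ℂ F)) :
    pseudoCurvature D H q u v (frame F E q j q) =
      dSecond₁ D H (dSecond₀ D H (frame F E q j)) q u v := by
  unfold pseudoCurvature
  rw [← fiberBasis_eq, Module.Basis.constr_basis, fiberBasis_eq, extend_frame]

theorem frameCoord_dSecond₁ (D : ComplexConnection V F E) (H : HermitianMetric V F E)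
    (β : Π y : X, TangentSpace 𝓘(ℝ, V) y → E y) (u v : TangentSpace 𝓘(ℝ, V) q)
    (i : Fin (Module.finrank ℂ F)) :
    frameCoord F q q (dSecond₁ D H β q u v) i =
      1 / 2 * (frameCoord F q q (extDerivForm (unitaryPart D H) (fun y => part10 (β y)) q u v) i +
        frameCoord F q q (extDerivForm (unitaryPart D H) (fun y => part10 (β y)) q
          (complexStructure q u) (complexStructure q v)) i) +
      1 / 4 * (frameCoord F q q (extDerivForm (unitaryPart D H) (fun y => part01 (β y)) q u v) i -
        frameCoord F q q (extDerivForm (unitaryPart D H) (fun y => part01 (β y)) q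
          (complexStructure q u) (complexStructure q v)) i + Complex.I *
        (frameCoord F q q (extDerivForm (unitaryPart D H) (fun y => part01 (β y)) q
            (complexStructure q u) v) i +
          frameCoord F q q (extDerivForm (unitaryPart D H) (fun y => part01 (β y)) q u
            (complexStructure q v)) i)) +
      (frameCoord F q q (part10 (psi D H q) u (β q v)) i -
        frameCoord F q q (part10 (psi D H q) v (β q u)) i) := by
  have hqE := FiberBundle.mem_baseSet_trivializationAt F E q
  unfold dSecond₁ delbar₁ part11 part02
  simp only [frameCoord_add hqE, frameCoord_sub hqE, frameCoord_smul hqE]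

/-- Applying $D''_H$ twice to the frame at `q` gives exactly the expression of
`kahlerTrace_pseudoCurvature`, whose hypothesis `h0` is the NHYM consequence $\Lambda D_H\psi_H=0$.
-/
theorem endMatrix_contract_pseudoCurvature (g : KahlerMetric V X) {D : ComplexConnection V F E}
    (hD : IsNHYM g D) (H : HermitianMetric V F E) (q : X) :
    endMatrix F q q (contract g q (pseudoCurvature D H q)) = (-(Complex.I / 2)) • kahlerTrace g q
      (covExt (fun v => unitaryMatrix D H q v (chartAt V q q))
        (fun u v => matrixDeriv (psiMatrix D H q (Complex.I • v)) (chartAt V q q) u)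
        fun v => psiMatrix D H q (Complex.I • v) (chartAt V q q)) := by
  have hqE := FiberBundle.mem_baseSet_trivializationAt F E q
  have hz := chart_self_mem_frameDomain (V := V) (F := F) (E := E) q
  have hU := (isOpen_frameDomain (V := V) (F := F) (E := E) q).mem_nhds hz
  have hN := isLinearMap_unitaryMatrix (q := q) D H hz
  have hψ := isLinearMap_psiMatrix (q := q) D H hz
  have hψd : ∀ v, MatrixDifferentiableAt (psiMatrix D H q v) (chartAt V q q) := fun v =>
    (matrixContDiff_psiMatrix D H hz v).differentiableAt (by simp)
  have hNd : ∀ v, MatrixDifferentiableAt (unitaryMatrix D H q v) (chartAt V q q) := fun v =>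
    ((matrixContDiff_connMatrix D v hz).differentiableAt (by simp)).sub (hψd v)
  have hP : IsBilinearMap ℝ fun u v => matrixDeriv (psiMatrix D H q v) (chartAt V q q) u :=
    isBilinearMap_matrixDeriv hU (fun w hw => isLinearMap_psiMatrix D H hw) hψd
  set z₀ := chartAt V q q with hz₀
  set N := fun v => unitaryMatrix D H q v z₀ with hNdef
  set ψ := fun v => psiMatrix D H q v z₀ with hψdef
  set P := fun u v => matrixDeriv (psiMatrix D H q v) z₀ u with hPdef
  set M01 : V → V → Matrix (Fin (Module.finrank ℂ F)) (Fin (Module.finrank ℂ F)) ℂ := fun v z =>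
    formPart01 (fun v => unitaryMatrix D H q v z) v with hM01
  set M10 : V → V → Matrix (Fin (Module.finrank ℂ F)) (Fin (Module.finrank ℂ F)) ℂ := fun v z =>
    formPart10 (fun v => psiMatrix D H q v z) v with hM10
  have hM01d : ∀ v, MatrixDifferentiableAt (M01 v) z₀ := fun v =>
    ((hNd v).add ((hNd (Complex.I • v)).const_smul Complex.I)).const_smul (1 / 2 : ℂ)
  have hM10d : ∀ v, MatrixDifferentiableAt (M10 v) z₀ := fun v =>
    ((hψd v).sub ((hψd (Complex.I • v)).const_smul Complex.I)).const_smul (1 / 2 : ℂ)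
  have hM10P : ∀ u v, matrixDeriv (M10 v) z₀ u =
      (1 / 2 : ℂ) • (P u v - Complex.I • P u (Complex.I • v)) := fun u v => by
    refine (matrixDeriv_const_smul (1 / 2 : ℂ)
      ((hψd v).sub ((hψd (Complex.I • v)).const_smul Complex.I)) u).trans ?_
    rw [matrixDeriv_sub (hψd v) ((hψd (Complex.I • v)).const_smul Complex.I),
      matrixDeriv_const_smul _ (hψd (Complex.I • v))]
  -- This is $D_H$ applied to the $(0,1)$-part. Only its bilinearity matters, since its $(0,2)$-part
  -- has zero contraction.
  set γ : V → V → Matrix (Fin (Module.finrank ℂ F)) (Fin (Module.finrank ℂ F)) ℂ := fun u v =>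
    matrixDeriv (M01 v) z₀ u + N u * M01 v z₀ - (matrixDeriv (M01 u) z₀ v + N v * M01 u z₀) with hγdef
  have hγ : IsBilinearMap ℝ γ := by
    have h1 : IsBilinearMap ℝ fun u v => matrixDeriv (M01 v) z₀ u :=
      isBilinearMap_matrixDeriv hU
        (fun w hw => isLinearMap_formPart01 (isLinearMap_unitaryMatrix D H hw)) hM01d
    have h2 := isBilinearMap_add h1 (isBilinearMap_mul hN (isLinearMap_formPart01 hN))
    exact isBilinearMap_sub h2 (isBilinearMap_swap h2)
  set β : Fin (Module.finrank ℂ F) → Π y : X, TangentSpace 𝓘(ℝ, V) y → E y :=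
    fun j => dSecond₀ D H (frame F E q j) with hβdef
  have hβ10 : ∀ v, ∀ z ∈ frameDomain V F E q, ∀ i j, frameCoord F q ((chartAt V q).symm z)
      (part10 (β j ((chartAt V q).symm z)) (constField q v ((chartAt V q).symm z))) i =
      M10 v z i j := by
    intro v z hz i j
    refine (frameCoord_part10 ((chartAt V q).map_target hz.1) hz.2
      (β := fun j => β j ((chartAt V q).symm z)) (frameCoord_dSecond₀ D H hz) v i j).trans ?_
    exact congrFun (congrFun (formPart10_formPart01_add (isLinearMap_unitaryMatrix D H hz)
      (isLinearMap_psiMatrix D H hz) v) i) j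
  have hβ01 : ∀ v, ∀ z ∈ frameDomain V F E q, ∀ i j, frameCoord F q ((chartAt V q).symm z)
      (part01 (β j ((chartAt V q).symm z)) (constField q v ((chartAt V q).symm z))) i =
      M01 v z i j := by
    intro v z hz i j
    refine (frameCoord_part01 ((chartAt V q).map_target hz.1) hz.2
      (β := fun j => β j ((chartAt V q).symm z)) (frameCoord_dSecond₀ D H hz) v i j).trans ?_
    exact congrFun (congrFun (formPart01_formPart01_add (isLinearMap_unitaryMatrix D H hz)
      (isLinearMap_psiMatrix D H hz) v) i) j
  have h10 := frameCoord_extDerivForm_unitaryPart D H (β := fun j y => part10 (β j y)) hβ10 hM10d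
    (isLinearMap_formPart10 hψ).map_zero
  have h01 := frameCoord_extDerivForm_unitaryPart D H (β := fun j y => part01 (β j y)) hβ01 hM01d
    (isLinearMap_formPart01 hN).map_zero
  have hψ10 : ∀ u : V, endMatrix F q q (part10 (psi D H q) u) = formPart10 ψ u := by
    intro u
    have h := endMatrix_part10 (mem_chart_source V q) hqE (β := psi D H q) (M := ψ)
      (fun v => (psiMatrix_chart D H (mem_chart_source V q) v).symm) u
    exact (congrArg (fun w => endMatrix F q q (part10 (psi D H q) w))
      (constField_self (V := V) q u)).symm.trans h
  have hβq : ∀ (v : V) i j, frameCoord F q q (β j q v) i = (formPart01 N v + formPart10 ψ v) i j := by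
    intro v i j
    have h : ∀ y, y = q → frameCoord F q y (β j y (constField (V := V) q v y)) i =
        frameCoord F q q (β j q (constField (V := V) q v q)) i := by rintro _ rfl; rfl
    have h2 := (h _ ((chartAt V q).left_inv (mem_chart_source V q))).symm.trans
      (frameCoord_dSecond₀ D H hz v i j)
    exact (congrArg (fun w => frameCoord F q q (β j q w) i)
      (constField_self (V := V) q v)).symm.trans h2
  have hmat : ∀ u v : V, endMatrix F q q (pseudoCurvature D H q u v) =
      (1 / 2 : ℂ) • (((1 / 2 : ℂ) • (P u v - Complex.I • P u (Complex.I • v)) +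
            N u * formPart10 ψ v - ((1 / 2 : ℂ) • (P v u - Complex.I • P v (Complex.I • u)) +
            N v * formPart10 ψ u)) +
          ((1 / 2 : ℂ) • (P (Complex.I • u) (Complex.I • v) -
              Complex.I • P (Complex.I • u) (Complex.I • Complex.I • v)) +
            N (Complex.I • u) * formPart10 ψ (Complex.I • v) -
            ((1 / 2 : ℂ) • (P (Complex.I • v) (Complex.I • u) -
              Complex.I • P (Complex.I • v) (Complex.I • Complex.I • u)) +
            N (Complex.I • v) * formPart10 ψ (Complex.I • u)))) +
        (1 / 4 : ℂ) • (γ u v - γ (Complex.I • u) (Complex.I • v) +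
          Complex.I • (γ (Complex.I • u) v + γ u (Complex.I • v))) +
        (formPart10 ψ u * (formPart01 N v + formPart10 ψ v) -
          formPart10 ψ v * (formPart01 N u + formPart10 ψ u)) := by
    intro u v
    ext i j
    have h1 : endMatrix F q q (pseudoCurvature D H q u v) i j =
        frameCoord F q q (dSecond₁ D H (β j) q u v) i :=
      congrArg (fun e => frameCoord F q q e i) (pseudoCurvature_frame D H q u v j)
    have h2 : ∀ u v : V, frameCoord F q q (part10 (psi D H q) u (β j q v)) i =
        (formPart10 ψ u * (formPart01 N v + formPart10 ψ v)) i j := by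
      intro u v
      refine (frameCoord_apply hqE _ _ i).trans ?_
      refine Eq.trans ?_ (Matrix.mul_apply (M := formPart10 ψ u)
        (N := formPart01 N v + formPart10 ψ v)).symm
      exact Finset.sum_congr rfl fun k _ => congrArg₂ (· * ·)
        (congrFun (congrFun (hψ10 u) i) k) (hβq v k j)
    have e10 : ∀ u v : V, frameCoord F q q
        (extDerivForm (unitaryPart D H) (fun y => part10 (β j y)) q u v) i =
        ((1 / 2 : ℂ) • (P u v - Complex.I • P u (Complex.I • v)) + N u * formPart10 ψ v -
          ((1 / 2 : ℂ) • (P v u - Complex.I • P v (Complex.I • u)) + N v * formPart10 ψ u)) i j :=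
      fun u v => (h10 u v i j).trans (congrFun (congrFun (congrArg₂
        (fun a b => a + N u * formPart10 ψ v - (b + N v * formPart10 ψ u))
        (hM10P u v) (hM10P v u)) i) j)
    have e01 : ∀ u v : V, frameCoord F q q
        (extDerivForm (unitaryPart D H) (fun y => part01 (β j y)) q u v) i = γ u v i j :=
      fun u v => h01 u v i j
    have h3 := frameCoord_dSecond₁ (q := q) D H (β j) u v i
    refine (h1.trans h3).trans ?_
    refine (congrArg₂ (· + ·) (congrArg₂ (· + ·) (congrArg₂ (fun a b => 1 / 2 * (a + b))
      (e10 _ _) (e10 _ _)) (congrArg (1 / 4 * ·) (congrArg₂ (· + ·)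
      (congrArg₂ (· - ·) (e01 _ _) (e01 _ _)) (congrArg₂ (fun a b => Complex.I * (a + b))
        (e01 _ _) (e01 _ _))))) (congrArg₂ (· - ·) (h2 _ _) (h2 _ _))).trans ?_
    rfl
  have hlin : ∀ T, endMatrix F q q T =
      (LinearMap.toMatrix (frameBasis F E hqE) (frameBasis F E hqE)).toLinearMap T :=
    fun T => endMatrix_eq_toMatrix hqE T
  refine (hlin _).trans ((congrArg _ (contract_eq_kahlerTrace g q _)).trans ?_)
  refine (kahlerTrace_map g q _ _).symm.trans ?_
  refine Eq.trans ?_ (kahlerTrace_pseudoCurvature g q N ψ P hN hψ hP γ hγ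
    (kahlerTrace_covExt_psi g hD H q))
  congr 1
  funext u v
  exact (hlin _).symm.trans (hmat u v)

/-- Integration by parts against `T` replaces second-order information on the metric by $D_HT$
paired with $\psi_H$; the discarded exact term is $d$ of the transgression form. -/
theorem trace_pseudoCurvature_comp (g : KahlerMetric V X) {D : ComplexConnection V F E}
    (hD : IsNHYM g D) (H : HermitianMetric V F E) {T : Π y : X, E y →ₗ[ℂ] E y}
    (hT : IsC1Field V F T) (q : X) :
    LinearMap.trace ℂ (E q)
      (((-4 * Complex.I) • contract g q (pseudoCurvature D H q)) ∘ₗ T q) =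
    contract g q (dform (V := V) (transgression D H T) q) - 2 * metricTrace g q fun u v =>
      ((matrixDeriv (fieldMatrix F q T) (chartAt V q q) u +
        (unitaryMatrix D H q u (chartAt V q q) * fieldMatrix F q T (chartAt V q q) -
          fieldMatrix F q T (chartAt V q q) * unitaryMatrix D H q u (chartAt V q q))) *
        psiMatrix D H q v (chartAt V q q)).trace := by
  have hqE := FiberBundle.mem_baseSet_trivializationAt F E q
  have hz := chart_self_mem_frameDomain (V := V) (F := F) (E := E) q
  have hN := isLinearMap_unitaryMatrix (q := q) D H hz
  have hψ := isLinearMap_psiMatrix (q := q) D H hz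
  have hTd : MatrixDifferentiableAt (fieldMatrix F q T) (chartAt V q q) :=
    (hT q _ hz).differentiableAt one_ne_zero
  have hk : IsLinearMap ℝ fun u => matrixDeriv (fieldMatrix F q T) (chartAt V q q) u := by
    constructor <;> intros <;> ext i j <;> simp [matrixDeriv_apply]
  have h := trace_covExt_mul g q (fun v => unitaryMatrix D H q v (chartAt V q q))
    (fun v => psiMatrix D H q v (chartAt V q q)) (matrixDeriv (fieldMatrix F q T) (chartAt V q q))
    (fun u v => matrixDeriv (psiMatrix D H q v) (chartAt V q q) u)
    (fieldMatrix F q T (chartAt V q q)) hN hψ hk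
  rw [trace_eq_trace_endMatrix hqE, endMatrix_comp hqE, endMatrix_smul hqE,
    endMatrix_contract_pseudoCurvature g hD, ← fieldMatrix_chart T (mem_chart_source V q),
    smul_smul]
  -- The normalization $-4\sqrt{-1}$ of the functional meets the factor $-\sqrt{-1}/2$ of the
  -- contracted pseudo-curvature; this is the $-2$ in the transgression form.
  have h4 : -4 * Complex.I * -(Complex.I / 2) = -2 := by
    linear_combination 2 * Complex.I_mul_I
  rw [h4]
  refine h.trans ?_
  refine congrArg (· - _) (Eq.trans ?_ (contract_eq_kahlerTrace g q _).symm)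
  congr 1
  funext u v
  exact (dform_transgression D H hT q u v).symm

end StaticIdentity

/-! ### Partial derivatives on a closed interval times an open set -/

section ProductCalculus

variable {V W : Type*} [NormedAddCommGroup V] [NormedSpace ℝ V] [NormedAddCommGroup W]
  [NormedSpace ℝ W] {ι : Type*} [Fintype ι] [DecidableEq ι] {f : ℝ × V → W} {a b s : ℝ} {z : V}
  {U : Set V}

theorem uniqueDiffOn_Icc_prod (hab : a < b) (hU : IsOpen U) :
    UniqueDiffOn ℝ (Icc a b ×ˢ U) :=
  (uniqueDiffOn_Icc hab).prod hU.uniqueDiffOn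

theorem fderivWithin_prod_snd (hf : DifferentiableWithinAt ℝ f (Icc a b ×ˢ U) (s, z))
    (hs : s ∈ Icc a b) (hz : U ∈ 𝓝 z) (v : V) :
    fderiv ℝ (fun z => f (s, z)) z v = fderivWithin ℝ f (Icc a b ×ˢ U) (s, z) (0, v) := by
  have h1 : HasFDerivAt (fun z : V => (s, z)) (ContinuousLinearMap.inr ℝ ℝ V) z :=
    hasFDerivAt_prodMk_right s z
  have h2 := hf.hasFDerivWithinAt.comp z h1.hasFDerivWithinAt
    (s := U) fun w hw => ⟨hs, hw⟩
  exact congrArg (fun L => L v) (h2.hasFDerivAt hz).fderiv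

theorem hasDerivWithinAt_prod_fst (hf : DifferentiableWithinAt ℝ f (Icc a b ×ˢ U) (s, z))
    (hz : z ∈ U) :
    HasDerivWithinAt (fun r => f (r, z)) (fderivWithin ℝ f (Icc a b ×ˢ U) (s, z) (1, 0))
      (Icc a b) s := by
  have h1 : HasFDerivAt (fun r : ℝ => (r, z)) (ContinuousLinearMap.inl ℝ ℝ V) s :=
    hasFDerivAt_prodMk_left s z
  have h2 := hf.hasFDerivWithinAt.comp s h1.hasFDerivWithinAt
    (s := Icc a b) (fun w hw => show (w, z) ∈ Icc a b ×ˢ U from ⟨hw, hz⟩)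
  have h3 := h2.hasDerivWithinAt
  simp only [ContinuousLinearMap.comp_apply, ContinuousLinearMap.inl_apply] at h3
  exact h3

theorem contDiffOn_fderiv_snd (hf : ContDiffOn ℝ ∞ f (Icc a b ×ˢ U)) (hab : a < b) (hU : IsOpen U)
    (v : V) : ContDiffOn ℝ ∞ (fun p : ℝ × V => fderiv ℝ (fun z => f (p.1, z)) p.2 v)
      (Icc a b ×ˢ U) := by
  have h := (hf.fderivWithin (m := ∞) (uniqueDiffOn_Icc_prod hab hU) (by simp)).clm_apply
    (contDiffOn_const (c := ((0 : ℝ), v)))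
  refine h.congr fun p hp => ?_
  exact fderivWithin_prod_snd ((hf p hp).differentiableWithinAt (by simp)) hp.1
    (hU.mem_nhds hp.2) v

theorem matrixDeriv_prod_snd {A : ℝ × V → Matrix ι ι ℂ} (hA : MatrixDifferentiableAt A (s, z))
    (v : V) : matrixDeriv (fun z => A (s, z)) z v = matrixDeriv A (s, z) (0, v) := by
  ext i j
  have h1 : HasFDerivAt (fun z : V => (s, z)) (ContinuousLinearMap.inr ℝ ℝ V) z :=
    hasFDerivAt_prodMk_right s z
  have h2 := (hA i j).hasFDerivAt.comp z h1
  exact congrArg (fun L => L v) h2.fderiv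

theorem hasDerivAt_matrix_fst {A : ℝ × V → Matrix ι ι ℂ} (hA : MatrixDifferentiableAt A (s, z))
    (i j : ι) : HasDerivAt (fun r => A (r, z) i j) (matrixDeriv A (s, z) (1, 0) i j) s := by
  have h1 : HasFDerivAt (fun r : ℝ => (r, z)) (ContinuousLinearMap.inl ℝ ℝ V) s :=
    hasFDerivAt_prodMk_left s z
  have h2 := ((hA i j).hasFDerivAt.comp s h1).hasDerivAt
  simp only [ContinuousLinearMap.comp_apply, ContinuousLinearMap.inl_apply] at h2
  exact h2

theorem MatrixContDiffWithinAt.prod_snd {n : ℕ∞ω} {A : ℝ × V → Matrix ι ι ℂ}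
    (hA : MatrixContDiffWithinAt n A univ (s, z)) :
    MatrixContDiffWithinAt n (fun z => A (s, z)) univ z := fun i j =>
  (hA i j).comp z (contDiffWithinAt_const.prodMk contDiffWithinAt_id) (mapsTo_univ _ _)

theorem MatrixContDiffWithinAt.comp_snd {n : ℕ∞ω} {A : V → Matrix ι ι ℂ} {S : Set (ℝ × V)}
    (hA : MatrixContDiffWithinAt n A univ z) :
    MatrixContDiffWithinAt n (fun p : ℝ × V => A p.2) S (s, z) := fun i j =>
  (hA i j).comp (s, z) contDiffWithinAt_snd (mapsTo_univ _ _)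

end ProductCalculus

/-! ### Joint smoothness of $\psi$ and of the energy density in the parameter and the point -/

section Pieces

variable {V : Type*} [NormedAddCommGroup V] [NormedSpace ℂ V] [FiniteDimensional ℂ V]
  {X : Type*} [TopologicalSpace X] [ChartedSpace V X] [T2Space X]
  {F : Type*} [NormedAddCommGroup F] [NormedSpace ℂ F]
  {E : X → Type*} [∀ x, AddCommGroup (E x)] [∀ x, Module ℂ (E x)]
  [∀ x, TopologicalSpace (E x)] [∀ x, IsTopologicalAddGroup (E x)] [∀ x, ContinuousSMul ℂ (E x)]
  [TopologicalSpace (TotalSpace F E)] [FiberBundle F E]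
  [FiniteDimensional ℂ F] [VectorBundle ℂ F E] [IsManifold 𝓘(ℂ, V) ω X]
  [ContMDiffVectorBundle ∞ F E 𝓘(ℝ, V)] {q : X}

/-- A family of Hermitian metrics which is smooth in `(s, x)` on `I × X`. -/
def IsSmoothFamily (Hs : ℝ → HermitianMetric V F E) (I : Set ℝ) : Prop :=
  ∀ s ∈ I, ∀ (x : X) (σ τ : Π y, E y),
    ContMDiffAt 𝓘(ℝ, V) (𝓘(ℝ, V).prod 𝓘(ℝ, F)) ∞ (fun y => TotalSpace.mk' F y (σ y)) x →
    ContMDiffAt 𝓘(ℝ, V) (𝓘(ℝ, V).prod 𝓘(ℝ, F)) ∞ (fun y => TotalSpace.mk' F y (τ y)) x →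
    ContMDiffWithinAt (𝓘(ℝ, ℝ).prod 𝓘(ℝ, V)) 𝓘(ℝ, ℂ) ∞
      (fun p : ℝ × X => (Hs p.1).form p.2 (σ p.2) (τ p.2)) (I ×ˢ Set.univ) (s, x)

/-- The matrix of a family of metrics in the local frame and chart at `q`. -/
def familyMatrix (Hs : ℝ → HermitianMetric V F E) (q : X) (p : ℝ × V) :
    Matrix (Fin (Module.finrank ℂ F)) (Fin (Module.finrank ℂ F)) ℂ := metricMatrix (Hs p.1) q p.2

variable {Hs : ℝ → HermitianMetric V F E} {a b s : ℝ} {z : V}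

theorem IsSmoothFamily.familyMatrix (hH : IsSmoothFamily Hs (Icc a b)) (hs : s ∈ Icc a b)
    (hz : z ∈ frameDomain V F E q) :
    MatrixContDiffWithinAt ∞ (familyMatrix Hs q) (Icc a b ×ˢ frameDomain V F E q) (s, z) := by
  intro i j
  have h := hH s hs ((chartAt V q).symm z) (frame F E q j) (frame F E q i)
    (contMDiffAt_frame (n := ⊤) hz.2 j) (contMDiffAt_frame (n := ⊤) hz.2 i)
  have h1 := contMDiffOn_extChartAt_symm (I := 𝓘(ℝ, V)) (n := ∞) q
  have ht : (extChartAt 𝓘(ℝ, V) q).target = (chartAt V q).target := by simp [mfld_simps]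
  rw [ht] at h1
  have h2 : ContMDiffWithinAt 𝓘(ℝ, V) 𝓘(ℝ, V) ∞ (chartAt V q).symm (frameDomain V F E q) z :=
    (h1 z hz.1).mono inter_subset_left
  have h3 : ContMDiffWithinAt (𝓘(ℝ, ℝ).prod 𝓘(ℝ, V)) (𝓘(ℝ, ℝ).prod 𝓘(ℝ, V)) ∞
      (fun p : ℝ × V => (p.1, (chartAt V q).symm p.2)) (Icc a b ×ˢ frameDomain V F E q) (s, z) :=
    contMDiffWithinAt_fst.prodMk (h2.comp (s, z) contMDiffWithinAt_snd fun p hp => hp.2)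
  have h4 := h.comp (s, z) h3 (fun p hp => mk_mem_prod hp.1 (mem_univ _))
  rw [← modelWithCornersSelf_prod, chartedSpaceSelf_prod] at h4
  exact contMDiffWithinAt_iff_contDiffWithinAt.1 h4

/-- The matrix of `ψ` for a family of metrics. -/
def familyPsi (D : ComplexConnection V F E) (Hs : ℝ → HermitianMetric V F E) (q : X) (v : V)
    (p : ℝ × V) : Matrix (Fin (Module.finrank ℂ F)) (Fin (Module.finrank ℂ F)) ℂ :=
  psiMatrix D (Hs p.1) q v p.2

/-- The formula for $\psi$ involves only $A$, $H$ and the spatial derivative of $H$, all jointly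
smooth up to the ends of the parameter interval. -/
theorem IsSmoothFamily.familyPsi (D : ComplexConnection V F E) (hH : IsSmoothFamily Hs (Icc a b))
    (hab : a < b) (hs : s ∈ Icc a b) (hz : z ∈ frameDomain V F E q) (v : V) :
    MatrixContDiffWithinAt ∞ (familyPsi D Hs q v) (Icc a b ×ˢ frameDomain V F E q) (s, z) := by
  have hHm := hH.familyMatrix hs hz
  have hA : MatrixContDiffWithinAt ∞ (fun p : ℝ × V => connMatrix D q v p.2)
      (Icc a b ×ˢ frameDomain V F E q) (s, z) := (matrixContDiff_connMatrix D v hz).comp_snd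
  have hd : MatrixContDiffWithinAt ∞ (fun p : ℝ × V => matrixDeriv (metricMatrix (Hs p.1) q) p.2 v)
      (Icc a b ×ˢ frameDomain V F E q) (s, z) := fun i j =>
    contDiffOn_fderiv_snd (f := fun p => NHYM.familyMatrix Hs q p i j)
      (fun p hp => hH.familyMatrix hp.1 hp.2 i j) hab (isOpen_frameDomain q) v (s, z) ⟨hs, hz⟩
  have h := (hHm.inv (det_metricMatrix_ne_zero (Hs s) hz)).mul ((((hHm.mul hA).add
    (hA.conjTranspose.mul hHm)).sub hd).const_smul (1 / 2 : ℂ))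
  intro i j
  refine (h i j).congr_of_mem (fun p hp => ?_) ⟨hs, hz⟩
  refine congrFun (congrFun (?_ : psiMatrix D (Hs p.1) q v p.2 = (metricMatrix (Hs p.1) q p.2)⁻¹ *
      (1 / 2 : ℂ) • (metricMatrix (Hs p.1) q p.2 * connMatrix D q v p.2 +
        (connMatrix D q v p.2).conjTranspose * metricMatrix (Hs p.1) q p.2 -
        matrixDeriv (metricMatrix (Hs p.1) q) p.2 v)) i) j
  rw [← metricMatrix_mul_psiMatrix D (Hs p.1) hp.2 v, ← Matrix.mul_assoc, Matrix.nonsing_inv_mul _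
    (isUnit_iff_ne_zero.2 (det_metricMatrix_ne_zero (Hs p.1) hp.2)), one_mul]

/-- The energy density `2 tr_g tr(ψ ⊗ ψ)`. -/
def energyDensity (g : KahlerMetric V X) (D : ComplexConnection V F E) (H : HermitianMetric V F E)
    (x : X) : ℂ :=
  2 * metricTrace g x fun u v : V => LinearMap.trace ℂ (E x)
    (psi D H x (show TangentSpace 𝓘(ℝ, V) x from u) ∘ₗ
      psi D H x (show TangentSpace 𝓘(ℝ, V) x from v))

theorem energyDensity_chart_symm (g : KahlerMetric V X) (D : ComplexConnection V F E)
    (H : HermitianMetric V F E) (hz : z ∈ frameDomain V F E q) :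
    energyDensity g D H ((chartAt V q).symm z) = 2 * ∑ a, ∑ b,
      ((gram g q ((chartAt V q).symm z))⁻¹ a b) •
        (psiMatrix D H q (modelBasis V a) z * psiMatrix D H q (modelBasis V b) z).trace := by
  have hyE : (chartAt V q).symm z ∈ (trivializationAt F E q).baseSet := hz.2
  have hb : IsBilinearMap ℝ fun u v : V => LinearMap.trace ℂ (E ((chartAt V q).symm z))
    (psi D H ((chartAt V q).symm z) (show TangentSpace 𝓘(ℝ, V) ((chartAt V q).symm z) from u) ∘ₗ
      psi D H ((chartAt V q).symm z)
        (show TangentSpace 𝓘(ℝ, V) ((chartAt V q).symm z) from v)) := by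
    constructor
    · intro u u' v
      rw [← map_add, ← LinearMap.add_comp, ← psi_add]; rfl
    · intro r u v
      refine (congrArg (fun S => LinearMap.trace ℂ _ (S ∘ₗ _)) (psi_smul D H _ r u)).trans ?_
      rw [LinearMap.smul_comp, map_smul, Complex.coe_smul]
    · intro u v v'
      rw [← map_add, ← LinearMap.comp_add, ← psi_add]; rfl
    · intro r u v
      refine (congrArg (fun S => LinearMap.trace ℂ _ (_ ∘ₗ S)) (psi_smul D H _ r v)).trans ?_
      rw [LinearMap.comp_smul, map_smul, Complex.coe_smul]
  rw [energyDensity]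
  refine congrArg (2 * ·) ((metricTrace_eq_chart g ((chartAt V q).map_target hz.1) _ hb).trans ?_)
  refine Finset.sum_congr rfl fun a _ => Finset.sum_congr rfl fun b _ => congrArg _ ?_
  rw [trace_eq_trace_endMatrix hyE, endMatrix_comp hyE]
  rfl

theorem IsSmoothFamily.energyDensity (g : KahlerMetric V X) (D : ComplexConnection V F E)
    (hH : IsSmoothFamily Hs (Icc a b)) (hab : a < b) :
    ContDiffOn ℝ ∞ (fun p : ℝ × V => energyDensity g D (Hs p.1) ((chartAt V q).symm p.2))
      (Icc a b ×ˢ frameDomain V F E q) := by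
  rintro ⟨s, z⟩ ⟨hs, hz⟩
  have hg : MatrixContDiffWithinAt ∞ (fun z => gram g q ((chartAt V q).symm z))
      (frameDomain V F E q) z := fun a b =>
    (contDiffOn_gram g q a b z hz.1).mono inter_subset_left
  have hgi := hg.inv (gram_posDef g ((chartAt V q).map_target hz.1)).det_pos.ne'
  have hG : ∀ a' b', ContDiffWithinAt ℝ ∞
      (fun p : ℝ × V => (gram g q ((chartAt V q).symm p.2))⁻¹ a' b')
      (Icc a b ×ˢ frameDomain V F E q) (s, z) := fun a' b' =>
    (hgi a' b').comp (s, z) contDiffWithinAt_snd fun p hp => hp.2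
  have h : ContDiffWithinAt ℝ ∞ (fun p : ℝ × V => 2 * ∑ a, ∑ b,
      ((gram g q ((chartAt V q).symm p.2))⁻¹ a b) •
        (NHYM.familyPsi D Hs q (modelBasis V a) p * NHYM.familyPsi D Hs q (modelBasis V b) p).trace)
      (Icc a b ×ˢ frameDomain V F E q) (s, z) := by
    refine contDiffWithinAt_const.mul (ContDiffWithinAt.sum fun a' _ => ContDiffWithinAt.sum
      fun b' _ => (hG a' b').smul ((hH.familyPsi D hab hs hz _).mul
        (hH.familyPsi D hab hs hz _)).trace)
  exact h.congr_of_mem (fun p hp => energyDensity_chart_symm g D (Hs p.1) hp.2) ⟨hs, hz⟩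

end Pieces

/-! ### First variation of $\psi$ and of the energy density -/

section Variation

variable {V : Type*} [NormedAddCommGroup V] [NormedSpace ℂ V] [FiniteDimensional ℂ V]
  {X : Type*} [TopologicalSpace X] [ChartedSpace V X] [T2Space X]
  {F : Type*} [NormedAddCommGroup F] [NormedSpace ℂ F]
  {E : X → Type*} [∀ x, AddCommGroup (E x)] [∀ x, Module ℂ (E x)]
  [∀ x, TopologicalSpace (E x)] [∀ x, IsTopologicalAddGroup (E x)] [∀ x, ContinuousSMul ℂ (E x)]
  [TopologicalSpace (TotalSpace F E)] [FiberBundle F E]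
  [FiniteDimensional ℂ F] [VectorBundle ℂ F E] [IsManifold 𝓘(ℂ, V) ω X]
  [ContMDiffVectorBundle ∞ F E 𝓘(ℝ, V)] {q : X}
  {Hs : ℝ → HermitianMetric V F E} {a b s : ℝ} {z : V}

theorem MatrixContDiffWithinAt.univ_of_mem {W ι : Type*} [NormedAddCommGroup W] [NormedSpace ℝ W]
    {n : ℕ∞ω} {A : W → Matrix ι ι ℂ} {S : Set W} {p : W}
    [Fintype ι] [DecidableEq ι] (hA : MatrixContDiffWithinAt n A S p)
    (hS : S ∈ 𝓝 p) : MatrixContDiffWithinAt n A univ p := fun i j =>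
  contDiffWithinAt_univ.2 ((hA i j).contDiffAt hS)

theorem Icc_prod_frameDomain_mem_nhds (hs : s ∈ Ioo a b) (hz : z ∈ frameDomain V F E q) :
    Icc a b ×ˢ frameDomain V F E q ∈ 𝓝 (s, z) :=
  prod_mem_nhds (Icc_mem_nhds hs.1 hs.2) ((isOpen_frameDomain q).mem_nhds hz)

/-- The endomorphism field `H⁻¹ ∂H/∂s` of a family of metrics. -/
def logField (Hs : ℝ → HermitianMetric V F E) (s : ℝ) (y : X) : E y →ₗ[ℂ] E y :=
  invMul (Hs s) y fun e f => deriv (fun r => (Hs r).form y e f) s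

theorem IsSmoothFamily.familyMatrix_univ (hH : IsSmoothFamily Hs (Icc a b)) (hs : s ∈ Ioo a b)
    (hz : z ∈ frameDomain V F E q) :
    MatrixContDiffWithinAt ∞ (NHYM.familyMatrix Hs q) univ (s, z) :=
  (hH.familyMatrix (Ioo_subset_Icc_self hs) hz).univ_of_mem (Icc_prod_frameDomain_mem_nhds hs hz)

theorem IsSmoothFamily.familyPsi_univ (D : ComplexConnection V F E)
    (hH : IsSmoothFamily Hs (Icc a b)) (hs : s ∈ Ioo a b)
    (hz : z ∈ frameDomain V F E q) (v : V) :
    MatrixContDiffWithinAt ∞ (NHYM.familyPsi D Hs q v) univ (s, z) :=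
  (hH.familyPsi D (hs.1.trans hs.2) (Ioo_subset_Icc_self hs) hz v).univ_of_mem
    (Icc_prod_frameDomain_mem_nhds hs hz)

theorem isUnit_det_familyMatrix (hz : z ∈ frameDomain V F E q) :
    IsUnit (familyMatrix Hs q (s, z)).det :=
  isUnit_iff_ne_zero.2 (det_metricMatrix_ne_zero (Hs s) hz)

/-- The change from the distinguished basis of the fibre to the frame does not depend on the
parameter, so it commutes with $\partial_s$. -/
theorem IsSmoothFamily.familyMatrix_mul_fieldMatrix_logField (hH : IsSmoothFamily Hs (Icc a b))
    (hs : s ∈ Ioo a b) (hz : z ∈ frameDomain V F E q) :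
    NHYM.familyMatrix Hs q (s, z) * fieldMatrix F q (logField Hs s) z =
      matrixDeriv (NHYM.familyMatrix Hs q) (s, z) (1, 0) := by
  have hHd : MatrixDifferentiableAt (NHYM.familyMatrix Hs q) (s, z) :=
    (hH.familyMatrix_univ hs hz).differentiableAt (by simp)
  set y := (chartAt V q).symm z with hyd
  have hy : y ∈ (chartAt V q).source := (chartAt V q).map_target hz.1
  have hyE : y ∈ (trivializationAt F E q).baseSet := hz.2
  have hzy : chartAt V q y = z := (chartAt V q).right_inv hz.1
  have h := metricMatrix_mul_endMatrix_invMul (Hs s) hy hyE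
    (fun e f => deriv (fun r => (Hs r).form y e f) s)
    (matrixDeriv (NHYM.familyMatrix Hs q) (s, z) (1, 0)) (fun i j => ?_)
  · rw [hzy] at h
    exact h
  · set C := (frameBasis F E hyE).toMatrix (fiberBasis F E y) with hC
    have hcoord : ∀ k i, C k i = frameCoord F q y (fiberBasis F E y i) k := fun k i => by
      rw [hC, Module.Basis.toMatrix_apply, frameBasis_repr]
    have hform : ∀ r, (Hs r).form y (fiberBasis F E y j) (fiberBasis F E y i) =
        ∑ l, star (C l i) * ∑ k, NHYM.familyMatrix Hs q (r, z) l k * C k j := by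
      intro r
      rw [form_eq_sum (Hs r) hy hyE, hzy]
      simp only [hcoord]
      rfl
    have hd : HasDerivAt (fun r => ∑ l, star (C l i) *
        ∑ k, NHYM.familyMatrix Hs q (r, z) l k * C k j) (∑ l, star (C l i) *
        ∑ k, matrixDeriv (NHYM.familyMatrix Hs q) (s, z) (1, 0) l k * C k j) s :=
      HasDerivAt.fun_sum fun l _ => (HasDerivAt.fun_sum fun k _ =>
        (hasDerivAt_matrix_fst hHd l k).mul_const _).const_mul _
    simp only [hform]
    rw [hd.deriv, Matrix.mul_assoc, Matrix.mul_apply]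
    simp only [Matrix.mul_apply, Matrix.conjTranspose_apply]

/-- The matrix of `H⁻¹ ∂H/∂s` as a function of the parameter and the point. -/
def familyLog (Hs : ℝ → HermitianMetric V F E) (q : X) (p : ℝ × V) :
    Matrix (Fin (Module.finrank ℂ F)) (Fin (Module.finrank ℂ F)) ℂ :=
  (familyMatrix Hs q p)⁻¹ * matrixDeriv (familyMatrix Hs q) p (1, 0)

theorem IsSmoothFamily.familyLog (hH : IsSmoothFamily Hs (Icc a b)) (hs : s ∈ Ioo a b)
    (hz : z ∈ frameDomain V F E q) : MatrixContDiffWithinAt ∞ (familyLog Hs q) univ (s, z) :=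
  ((hH.familyMatrix_univ hs hz).inv (det_metricMatrix_ne_zero (Hs s) hz)).mul
    ((hH.familyMatrix_univ hs hz).matrixDeriv (m := ∞) (by simp) _)

theorem IsSmoothFamily.fieldMatrix_logField (hH : IsSmoothFamily Hs (Icc a b))
    (hs : s ∈ Ioo a b) (hz : z ∈ frameDomain V F E q) :
    fieldMatrix F q (logField Hs s) z = NHYM.familyLog Hs q (s, z) := by
  rw [NHYM.familyLog, ← hH.familyMatrix_mul_fieldMatrix_logField hs hz, ← Matrix.mul_assoc,
    Matrix.nonsing_inv_mul _ (isUnit_det_familyMatrix hz), one_mul]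

theorem IsSmoothFamily.isC1Field_logField (hH : IsSmoothFamily Hs (Icc a b)) (hs : s ∈ Ioo a b) :
    IsC1Field V F (logField Hs s) := by
  intro q z hz i j
  have h := ((hH.familyLog hs hz).prod_snd i j).of_le (by simp : (1 : ℕ∞ω) ≤ ∞)
  refine contDiffWithinAt_univ.2 ((contDiffWithinAt_univ.1 h).congr_of_eventuallyEq ?_)
  filter_upwards [(isOpen_frameDomain q).mem_nhds hz] with w hw
  exact congrFun (congrFun (hH.fieldMatrix_logField hs hw) i) j

/-- Let $h=H^{-1}\partial_sH$ and $B=A-2\psi$, so that $HB=\partial_vH-A^{*}H$. Differentiating in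
$s$ with $\partial_sH=Hh$, the terms with $A^{*}$ cancel and $-2\,\partial_s\psi=\partial_vh+[B,h]$
remains; $B=N-\psi$ with $N$ the matrix of $D_H$ gives the form stated. -/
theorem IsSmoothFamily.matrixDeriv_familyPsi (D : ComplexConnection V F E)
    (hH : IsSmoothFamily Hs (Icc a b)) (hs : s ∈ Ioo a b)
    (hz : z ∈ frameDomain V F E q) (v : V) :
    (2 : ℂ) • matrixDeriv (NHYM.familyPsi D Hs q v) (s, z) (1, 0) =
      -(matrixDeriv (fieldMatrix F q (logField Hs s)) z v +
        (unitaryMatrix D (Hs s) q v z * fieldMatrix F q (logField Hs s) z -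
          fieldMatrix F q (logField Hs s) z * unitaryMatrix D (Hs s) q v z) -
        (psiMatrix D (Hs s) q v z * fieldMatrix F q (logField Hs s) z -
          fieldMatrix F q (logField Hs s) z * psiMatrix D (Hs s) q v z)) := by
  have hHc := hH.familyMatrix_univ hs hz
  have hHd : MatrixDifferentiableAt (NHYM.familyMatrix Hs q) (s, z) :=
    hHc.differentiableAt (by simp)
  have hψd : MatrixDifferentiableAt (NHYM.familyPsi D Hs q v) (s, z) :=
    (hH.familyPsi_univ D hs hz v).differentiableAt (by simp)
  have hhd : MatrixDifferentiableAt (NHYM.familyLog Hs q) (s, z) :=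
    (hH.familyLog hs hz).differentiableAt (by simp)
  have hAc : MatrixContDiffWithinAt ∞ (fun p : ℝ × V => connMatrix D q v p.2) univ (s, z) :=
    (matrixContDiff_connMatrix D v hz).comp_snd
  have hAd : MatrixDifferentiableAt (fun p : ℝ × V => connMatrix D q v p.2) (s, z) :=
    hAc.differentiableAt (by simp)
  have hnhds : Ioo a b ×ˢ frameDomain V F E q ∈ 𝓝 (s, z) :=
    prod_mem_nhds (Ioo_mem_nhds hs.1 hs.2) ((isOpen_frameDomain q).mem_nhds hz)
  -- The connection `D` is fixed along the family.
  have hA0 : matrixDeriv (fun p : ℝ × V => connMatrix D q v p.2) (s, z) (1, 0) = 0 := by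
    ext i j
    have h1 := (hasDerivAt_matrix_fst hAd i j).unique (hasDerivAt_const s (connMatrix D q v z i j))
    exact h1
  set Hm := NHYM.familyMatrix Hs q with hHm
  set h := NHYM.familyLog Hs q with hh
  set A : ℝ × V → Matrix (Fin (Module.finrank ℂ F)) (Fin (Module.finrank ℂ F)) ℂ :=
    fun p => connMatrix D q v p.2 with hA
  set ψ := NHYM.familyPsi D Hs q v with hψ
  have hBd : MatrixDifferentiableAt (fun p => A p - (2 : ℂ) • ψ p) (s, z) :=
    hAd.sub (hψd.const_smul 2)
  have hHB : ∀ p ∈ Ioo a b ×ˢ frameDomain V F E q, Hm p * (A p - (2 : ℂ) • ψ p) =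
      matrixDeriv Hm p (0, v) - (A p).conjTranspose * Hm p := by
    intro p hp
    have h1 := metricMatrix_mul_psiMatrix D (Hs p.1) hp.2 v
    have h2 : matrixDeriv (metricMatrix (Hs p.1) q) p.2 v = matrixDeriv Hm p (0, v) :=
      matrixDeriv_prod_snd (A := Hm) ((hH.familyMatrix_univ hp.1 hp.2).differentiableAt (by simp)) v
    rw [h2] at h1
    rw [mul_sub, Matrix.mul_smul]
    refine (congrArg (fun M => Hm p * A p - (2 : ℂ) • M) h1).trans ?_
    simp only [smul_smul]
    norm_num
    change Hm p * A p - (Hm p * A p + (A p).conjTranspose * Hm p - matrixDeriv Hm p (0, v)) = _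
    abel
  have hHh : ∀ p ∈ Ioo a b ×ˢ frameDomain V F E q, matrixDeriv Hm p (1, 0) = Hm p * h p := by
    intro p hp
    rw [hh, NHYM.familyLog, ← Matrix.mul_assoc, Matrix.mul_nonsing_inv _
      (isUnit_det_familyMatrix hp.2), one_mul]
  have hmem : (s, z) ∈ Ioo a b ×ˢ frameDomain V F E q := ⟨hs, hz⟩
  have e1 : matrixDeriv Hm (s, z) (1, 0) * (A (s, z) - (2 : ℂ) • ψ (s, z)) +
      Hm (s, z) * matrixDeriv (fun p => A p - (2 : ℂ) • ψ p) (s, z) (1, 0) =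
      matrixDeriv (fun p => matrixDeriv Hm p (0, v)) (s, z) (1, 0) -
        ((A (s, z)).conjTranspose * matrixDeriv Hm (s, z) (1, 0)) := by
    have e := matrixDeriv_congr (A := fun p => Hm p * (A p - (2 : ℂ) • ψ p))
      (B := fun p => matrixDeriv Hm p (0, v) - (A p).conjTranspose * Hm p)
      (by filter_upwards [hnhds] with p hp using hHB p hp) ((1 : ℝ), (0 : V))
    rw [matrixDeriv_mul hHd hBd, matrixDeriv_sub
      ((hHc.matrixDeriv (m := ∞) (by simp) _).differentiableAt (by simp))
      (hAd.conjTranspose.mul hHd), matrixDeriv_mul hAd.conjTranspose hHd,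
      matrixDeriv_conjTranspose hAd, hA0, Matrix.conjTranspose_zero, zero_mul, zero_add] at e
    exact e
  -- Exchange the two derivatives of $H$ and differentiate $\partial_sH=Hh$ in the direction `v`.
  have e2 : matrixDeriv (fun p => matrixDeriv Hm p (0, v)) (s, z) (1, 0) =
      matrixDeriv Hm (s, z) (0, v) * h (s, z) + Hm (s, z) * matrixDeriv h (s, z) (0, v) := by
    rw [matrixDeriv_comm (fun i j => (hHc i j).of_le (WithTop.coe_le_coe.2
      (le_top : (2 : ℕ∞) ≤ ⊤))), ← matrixDeriv_mul hHd hhd]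
    exact matrixDeriv_congr (by filter_upwards [hnhds] with p hp using hHh p hp) _
  have e3 : matrixDeriv Hm (s, z) (0, v) =
      Hm (s, z) * (A (s, z) - (2 : ℂ) • ψ (s, z)) + (A (s, z)).conjTranspose * Hm (s, z) := by
    rw [hHB _ hmem]; abel
  have e4 : matrixDeriv (fun p => A p - (2 : ℂ) • ψ p) (s, z) (1, 0) =
      -((2 : ℂ) • matrixDeriv ψ (s, z) (1, 0)) := by
    rw [matrixDeriv_sub hAd (hψd.const_smul 2), hA0, matrixDeriv_const_smul _ hψd, zero_sub]
  have e5 : matrixDeriv (fieldMatrix F q (logField Hs s)) z v = matrixDeriv h (s, z) (0, v) := by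
    rw [← matrixDeriv_prod_snd hhd]
    refine matrixDeriv_congr ?_ v
    filter_upwards [(isOpen_frameDomain q).mem_nhds hz] with w hw
    exact hH.fieldMatrix_logField hs hw
  have hunit : IsUnit (Hm (s, z)) := (Matrix.isUnit_iff_isUnit_det _).2 (isUnit_det_familyMatrix hz)
  rw [e5, hH.fieldMatrix_logField hs hz]
  rw [e2, e3, hHh _ hmem, e4] at e1
  have e6 : Hm (s, z) * ((2 : ℂ) • matrixDeriv ψ (s, z) (1, 0)) = Hm (s, z) *
      -(matrixDeriv h (s, z) (0, v) + ((A (s, z) - (2 : ℂ) • ψ (s, z)) * h (s, z) -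
        h (s, z) * (A (s, z) - (2 : ℂ) • ψ (s, z)))) := by
    rw [mul_neg, ← sub_eq_add_neg, sub_eq_iff_eq_add] at e1
    rw [mul_neg, mul_add, mul_sub, ← Matrix.mul_assoc, ← Matrix.mul_assoc, e1]
    noncomm_ring
  have e7 := hunit.mul_left_cancel e6
  rw [e7]
  change _ = -(matrixDeriv h (s, z) (0, v) + ((A (s, z) - ψ (s, z)) * h (s, z) -
    h (s, z) * (A (s, z) - ψ (s, z))) - (ψ (s, z) * h (s, z) - h (s, z) * ψ (s, z)))
  rw [two_smul]
  noncomm_ring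

/-- By symmetry of the metric trace and cyclicity, the two terms of the product rule agree, and
$\mathrm{tr}_g\,\mathrm{tr}([\psi,h]\psi)=0$. -/
theorem metricTrace_trace_variation {ι : Type*} [Fintype ι] (g : KahlerMetric V X) (q : X)
    {ψ ψ' κ : V → Matrix ι ι ℂ} {h : Matrix ι ι ℂ}
    (hvar : ∀ u, (2 : ℂ) • ψ' u = -(κ u - (ψ u * h - h * ψ u))) :
    2 * metricTrace g q (fun u v => (ψ' u * ψ v).trace + (ψ u * ψ' v).trace) =
      -(2 * metricTrace g q fun u v => (κ u * ψ v).trace) := by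
  have hsw : metricTrace g q (fun u v => (ψ u * ψ' v).trace) =
      metricTrace g q fun u v => (ψ' u * ψ v).trace := by
    rw [← metricTrace_swap]
    congr 1
    funext u v
    exact Matrix.trace_mul_comm _ _
  have hcomm : metricTrace g q (fun u v => ((ψ u * h - h * ψ u) * ψ v).trace) = 0 := by
    have h1 : (fun u v => ((ψ u * h - h * ψ u) * ψ v).trace) = fun u v =>
        (h * ψ v * ψ u).trace - (h * ψ u * ψ v).trace := by
      funext u v
      rw [sub_mul, Matrix.trace_sub, Matrix.mul_assoc, Matrix.trace_mul_comm]
    rw [h1, metricTrace_sub, metricTrace_swap g q fun u v => (h * ψ u * ψ v).trace, sub_self]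
  have h2 : 2 * metricTrace g q (fun u v => (ψ' u * ψ v).trace) =
      -metricTrace g q fun u v => (κ u * ψ v).trace := by
    have h3 : ∀ u v, (2 : ℂ) • (ψ' u * ψ v).trace =
        -((κ u * ψ v).trace - ((ψ u * h - h * ψ u) * ψ v).trace) := by
      intro u v
      rw [← Matrix.trace_smul, ← Matrix.smul_mul, hvar, ← Matrix.trace_sub, ← sub_mul,
        ← Matrix.trace_neg, neg_mul]
    have h4 := metricTrace_map g q ((2 : ℂ) • (LinearMap.id : ℂ →ₗ[ℂ] ℂ))
      (fun u v => (ψ' u * ψ v).trace)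
    simp only [LinearMap.smul_apply, LinearMap.id_apply, h3, metricTrace_neg, metricTrace_sub,
      hcomm, sub_zero] at h4
    exact h4.symm
  rw [metricTrace_add, hsw, mul_add, h2]
  ring

theorem hasDerivAt_sum_trace {ι κ : Type*} [Fintype ι] [DecidableEq ι] [Fintype κ]
    {Ψ : κ → ℝ × V → Matrix ι ι ℂ} (hΨ : ∀ a, MatrixDifferentiableAt (Ψ a) (s, z))
    (G : κ → κ → ℝ) :
    HasDerivAt (fun r => 2 * ∑ a, ∑ b, G a b • (Ψ a (r, z) * Ψ b (r, z)).trace)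
      (2 * ∑ a, ∑ b, G a b • ((matrixDeriv (Ψ a) (s, z) (1, 0) * Ψ b (s, z)).trace +
        (Ψ a (s, z) * matrixDeriv (Ψ b) (s, z) (1, 0)).trace)) s := by
  refine (HasDerivAt.fun_sum fun a _ => HasDerivAt.fun_sum fun b _ => ?_).const_mul _
  have h : HasDerivAt (fun r => ∑ i, ∑ j, Ψ a (r, z) i j * Ψ b (r, z) j i)
      (∑ i, ∑ j, (matrixDeriv (Ψ a) (s, z) (1, 0) i j * Ψ b (s, z) j i +
        Ψ a (s, z) i j * matrixDeriv (Ψ b) (s, z) (1, 0) j i)) s :=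
    HasDerivAt.fun_sum fun i _ => HasDerivAt.fun_sum fun j _ =>
      (hasDerivAt_matrix_fst (hΨ a) i j).mul (hasDerivAt_matrix_fst (hΨ b) j i)
  simp only [Finset.sum_add_distrib] at h
  exact h.const_smul (G a b)

theorem IsSmoothFamily.hasDerivAt_energyDensity (g : KahlerMetric V X) (D : ComplexConnection V F E)
    (hH : IsSmoothFamily Hs (Icc a b)) (hs : s ∈ Ioo a b) (q : X) :
    HasDerivAt (fun r => NHYM.energyDensity g D (Hs r) q) (-(2 * metricTrace g q fun u v =>
      ((matrixDeriv (fieldMatrix F q (logField Hs s)) (chartAt V q q) u +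
        (unitaryMatrix D (Hs s) q u (chartAt V q q) *
            fieldMatrix F q (logField Hs s) (chartAt V q q) -
          fieldMatrix F q (logField Hs s) (chartAt V q q) *
            unitaryMatrix D (Hs s) q u (chartAt V q q))) *
        psiMatrix D (Hs s) q v (chartAt V q q)).trace)) s := by
  have hz := chart_self_mem_frameDomain (V := V) (F := F) (E := E) q
  have hqq : (chartAt V q).symm (chartAt V q q) = q := (chartAt V q).left_inv (mem_chart_source V q)
  have hder := hasDerivAt_sum_trace (z := chartAt V q q) (s := s)
    (Ψ := fun a => NHYM.familyPsi D Hs q (modelBasis V a))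
    (fun a => (hH.familyPsi_univ D hs hz _).differentiableAt (by simp))
    (fun a b => (gram g q q)⁻¹ a b)
  have he : (fun r => NHYM.energyDensity g D (Hs r) q) = fun r => 2 * ∑ a, ∑ b,
      ((gram g q q)⁻¹ a b) • (NHYM.familyPsi D Hs q (modelBasis V a) (r, chartAt V q q) *
        NHYM.familyPsi D Hs q (modelBasis V b) (r, chartAt V q q)).trace := by
    funext r
    have h1 := energyDensity_chart_symm g D (Hs r) hz
    rw [hqq] at h1
    exact h1
  rw [he]
  refine hder.congr_deriv ?_
  exact metricTrace_trace_variation g q (ψ := fun u => psiMatrix D (Hs s) q u (chartAt V q q))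
    (ψ' := fun u => matrixDeriv (NHYM.familyPsi D Hs q u) (s, chartAt V q q) (1, 0))
    fun u => hH.matrixDeriv_familyPsi D hs hz u

/-- The key pointwise identity. The static identity for `T` equal to $H^{-1}\partial_sH$ and the
first variation of the energy density contain the same term
$-2\,\mathrm{tr}_g\,\mathrm{tr}(D_Hh\,\psi_H)$. -/
theorem IsSmoothFamily.trace_pseudoCurvature_comp_logField (g : KahlerMetric V X)
    {D : ComplexConnection V F E} (hD : IsNHYM g D) (hH : IsSmoothFamily Hs (Icc a b))
    (hs : s ∈ Ioo a b) (q : X) :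
    LinearMap.trace ℂ (E q)
      (((-4 * Complex.I) • contract g q (pseudoCurvature D (Hs s) q)) ∘ₗ logField Hs s q) =
    contract g q (dform (V := V) (transgression D (Hs s) (logField Hs s)) q) +
      deriv (fun r => NHYM.energyDensity g D (Hs r) q) s := by
  rw [trace_pseudoCurvature_comp g hD (Hs s) (hH.isC1Field_logField hs) q,
    (hH.hasDerivAt_energyDensity g D hs q).deriv]
  rfl

end Variation

/-! ### Integrals over a compact space depending on a parameter -/

section ParametricIntegral

variable {X : Type*} [TopologicalSpace X] [CompactSpace X] [MeasurableSpace X] [BorelSpace X]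
  {a b : ℝ} {φ d : ℝ → X → ℂ}

theorem continuous_slice (hφ : ContinuousOn (fun p : ℝ × X => φ p.1 p.2) (Icc a b ×ˢ univ)) {s : ℝ}
    (hs : s ∈ Icc a b) : Continuous (φ s) :=
  continuousOn_univ.1 (hφ.comp (f := fun x => (s, x)) (by fun_prop) fun x _ => ⟨hs, mem_univ _⟩)

theorem continuousOn_integral (μ : Measure X) [IsFiniteMeasure μ]
    (hφ : ContinuousOn (fun p : ℝ × X => φ p.1 p.2) (Icc a b ×ˢ univ)) :
    ContinuousOn (fun s => ∫ x, φ s x ∂μ) (Icc a b) := by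
  obtain ⟨C, hC⟩ := (isCompact_Icc.prod isCompact_univ).exists_bound_of_continuousOn hφ
  refine continuousOn_of_dominated (bound := fun _ => C)
    (fun s hs => (continuous_slice hφ hs).aestronglyMeasurable)
    (fun s hs => ae_of_all _ fun x => hC (s, x) ⟨hs, mem_univ _⟩) (integrable_const C)
    (ae_of_all _ fun x => ?_)
  exact hφ.comp (f := fun s => (s, x)) (by fun_prop) fun s hs => ⟨hs, mem_univ _⟩

/-- Continuity on the compact product bounds the derivative by a constant, which is integrable for a
finite measure; this allows differentiation under the integral, and the fundamental theorem of
calculus applies. -/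
theorem integral_integral_eq_sub (μ : Measure X) [IsFiniteMeasure μ] (hab : a < b)
    (hφ : ContinuousOn (fun p : ℝ × X => φ p.1 p.2) (Icc a b ×ˢ univ))
    (hd : ContinuousOn (fun p : ℝ × X => d p.1 p.2) (Icc a b ×ˢ univ))
    (hder : ∀ s ∈ Ioo a b, ∀ x, HasDerivAt (fun r => φ r x) (d s x) s) :
    IntervalIntegrable (fun s => ∫ x, d s x ∂μ) volume a b ∧
      ∫ s in a..b, ∫ x, d s x ∂μ = ∫ x, φ b x ∂μ - ∫ x, φ a x ∂μ := by
  have hint : IntervalIntegrable (fun s => ∫ x, d s x ∂μ) volume a b :=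
    ContinuousOn.intervalIntegrable_of_Icc hab.le (continuousOn_integral μ hd)
  refine ⟨hint, ?_⟩
  obtain ⟨C, hC⟩ := (isCompact_Icc.prod isCompact_univ).exists_bound_of_continuousOn hd
  refine intervalIntegral.integral_eq_sub_of_hasDerivAt_of_le hab.le (continuousOn_integral μ hφ)
    (fun s hs => ?_) hint
  refine (hasDerivAt_integral_of_dominated_loc_of_deriv_le (bound := fun _ => C)
    (Ioo_mem_nhds hs.1 hs.2) ?_ ?_ ?_ ?_ (integrable_const C) ?_).2
  · filter_upwards [Ioo_mem_nhds hs.1 hs.2] with r hr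
    exact (continuous_slice hφ (Ioo_subset_Icc_self hr)).aestronglyMeasurable
  · exact (continuous_slice hφ (Ioo_subset_Icc_self hs)).integrable_of_hasCompactSupport
      (HasCompactSupport.of_compactSpace _)
  · exact (continuous_slice hd (Ioo_subset_Icc_self hs)).aestronglyMeasurable
  · exact ae_of_all _ fun x r hr => hC (r, x) ⟨Ioo_subset_Icc_self hr, mem_univ _⟩
  · exact ae_of_all _ fun x r hr => hder r hr x

end ParametricIntegral

/-! ### The functional as a difference of energies -/

section Functional

variable {V : Type*} [NormedAddCommGroup V] [NormedSpace ℂ V] [FiniteDimensional ℂ V]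
  [MeasurableSpace V] [BorelSpace V]
  {X : Type*} [TopologicalSpace X] [ChartedSpace V X] [T2Space X] [CompactSpace X]
  [MeasurableSpace X] [BorelSpace X]
  {F : Type*} [NormedAddCommGroup F] [NormedSpace ℂ F]
  {E : X → Type*} [∀ x, AddCommGroup (E x)] [∀ x, Module ℂ (E x)]
  [∀ x, TopologicalSpace (E x)] [∀ x, IsTopologicalAddGroup (E x)] [∀ x, ContinuousSMul ℂ (E x)]
  [TopologicalSpace (TotalSpace F E)] [FiberBundle F E]
  [FiniteDimensional ℂ F] [VectorBundle ℂ F E] [IsManifold 𝓘(ℂ, V) ω X]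
  [ContMDiffVectorBundle ∞ F E 𝓘(ℝ, V)] {q : X}
  {Hs : ℝ → HermitianMetric V F E} {a b s : ℝ}

variable (V F E) in
theorem continuousOn_of_frameDomain {φ : ℝ → X → ℂ} {f : X → ℝ × V → ℂ}
    (hf : ∀ q, ContinuousOn (f q) (Icc a b ×ˢ frameDomain V F E q))
    (hφ : ∀ q, ∀ s ∈ Icc a b, ∀ z ∈ frameDomain V F E q, φ s ((chartAt V q).symm z) = f q (s, z)) :
    ContinuousOn (fun p : ℝ × X => φ p.1 p.2) (Icc a b ×ˢ univ) := by
  rintro ⟨s, q⟩ ⟨hs, -⟩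
  set O : Set X := (chartAt V q).source ∩ (trivializationAt F E q).baseSet
  have hO : O ∈ 𝓝 q := inter_mem ((chartAt V q).open_source.mem_nhds (mem_chart_source V q))
    ((trivializationAt F E q).open_baseSet.mem_nhds
      (FiberBundle.mem_baseSet_trivializationAt F E q))
  have hmaps : MapsTo (fun p : ℝ × X => (p.1, chartAt V q p.2)) (Icc a b ×ˢ O)
      (Icc a b ×ˢ frameDomain V F E q) := fun p hp =>
    ⟨hp.1, chart_mem_frameDomain hp.2.1 hp.2.2⟩
  have hmem : (s, q) ∈ Icc a b ×ˢ O := ⟨hs, mem_of_mem_nhds hO⟩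
  have hc : ContinuousWithinAt (fun p : ℝ × X => (p.1, chartAt V q p.2)) (Icc a b ×ˢ O) (s, q) :=
    continuousWithinAt_fst.prodMk (((chartAt V q).continuousAt (mem_chart_source V q)).comp
      continuousAt_snd).continuousWithinAt
  have h1 : ContinuousWithinAt (fun p : ℝ × X => φ p.1 p.2) (Icc a b ×ˢ O) (s, q) := by
    refine (ContinuousWithinAt.comp (x := (s, q)) (f := fun p : ℝ × X => (p.1, chartAt V q p.2))
      (g := f q) (hf q _ (hmaps hmem)) hc hmaps).congr_of_mem (fun p hp => ?_) hmem
    have h2 := hφ q p.1 hp.1 _ (hmaps hp).2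
    rw [(chartAt V q).left_inv hp.2.1] at h2
    exact h2
  refine h1.mono_of_mem_nhdsWithin ?_
  rw [nhdsWithin_prod_eq, nhdsWithin_univ]
  exact prod_mem_prod self_mem_nhdsWithin hO

theorem IsSmoothFamily.continuousOn_energyDensity (g : KahlerMetric V X)
    (D : ComplexConnection V F E) (hH : IsSmoothFamily Hs (Icc a b)) (hab : a < b) :
    ContinuousOn (fun p : ℝ × X => NHYM.energyDensity g D (Hs p.1) p.2) (Icc a b ×ˢ univ) :=
  continuousOn_of_frameDomain V F E (φ := fun s x => NHYM.energyDensity g D (Hs s) x)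
    (fun q => (hH.energyDensity (q := q) g D hab).continuousOn) fun _ _ _ _ _ => rfl

/-- The one-sided derivative is used so that continuity holds on the closed interval; compactness
then provides the uniform bound needed under the integral. -/
theorem IsSmoothFamily.continuousOn_derivWithin_energyDensity (g : KahlerMetric V X)
    (D : ComplexConnection V F E) (hH : IsSmoothFamily Hs (Icc a b)) (hab : a < b) :
    ContinuousOn (fun p : ℝ × X =>
      derivWithin (fun r => NHYM.energyDensity g D (Hs r) p.2) (Icc a b) p.1)
      (Icc a b ×ˢ univ) := by
  refine continuousOn_of_frameDomain V F E
    (φ := fun s x => derivWithin (fun r => NHYM.energyDensity g D (Hs r) x) (Icc a b) s)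
    (f := fun q p => fderivWithin ℝ
      (fun p : ℝ × V => NHYM.energyDensity g D (Hs p.1) ((chartAt V q).symm p.2))
      (Icc a b ×ˢ frameDomain V F E q) p (1, 0)) (fun q => ?_) fun q s hs z hz => ?_
  · exact ((hH.energyDensity (q := q) g D hab).continuousOn_fderivWithin
      (uniqueDiffOn_Icc_prod hab (isOpen_frameDomain q)) (by simp)).clm_apply continuousOn_const
  · have hd := (hH.energyDensity (q := q) g D hab (s, z) ⟨hs, hz⟩).differentiableWithinAt (by simp)
    exact (hasDerivWithinAt_prod_fst hd hz).derivWithin (uniqueDiffOn_Icc hab s hs)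

/-- The potential of the Donaldson functional. -/
def energy (g : KahlerMetric V X) (D : ComplexConnection V F E) (H : HermitianMetric V F E) : ℂ :=
  ∫ x, energyDensity g D H x ∂(kahlerVolume g)

/-- The integrand of the Donaldson functional for a differentiable family of metrics. -/
def familyIntegrand (g : KahlerMetric V X) (D : ComplexConnection V F E)
    (Hs : ℝ → HermitianMetric V F E) (s : ℝ) (x : X) : ℂ :=
  LinearMap.trace ℂ (E x)
    (((-4 * Complex.I) • contract g x (pseudoCurvature D (Hs s) x)) ∘ₗ logField Hs s x)

/-- The exact term of the pointwise identity is continuous and has integral zero by Stokes' theorem.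
-/
theorem IsSmoothFamily.integral_familyIntegrand (g : KahlerMetric V X)
    {D : ComplexConnection V F E} (hD : IsNHYM g D) (hH : IsSmoothFamily Hs (Icc a b))
    (hs : s ∈ Ioo a b) :
    Integrable (familyIntegrand g D Hs s) (kahlerVolume g) ∧
      ∫ x, familyIntegrand g D Hs s x ∂(kahlerVolume g) =
        ∫ x, derivWithin (fun r => NHYM.energyDensity g D (Hs r) x) (Icc a b) s
          ∂(kahlerVolume g) := by
  have hab := hs.1.trans hs.2
  have hβ := isC1Form_transgression D (Hs s) (hH.isC1Field_logField hs)
  have hd := continuous_slice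
    (φ := fun s x => derivWithin (fun r => NHYM.energyDensity g D (Hs r) x) (Icc a b) s) (hH.continuousOn_derivWithin_energyDensity g D hab)
    (Ioo_subset_Icc_self hs)
  have heq : familyIntegrand g D Hs s = fun x =>
      contract g x (dform (V := V) (transgression D (Hs s) (logField Hs s)) x) +
        derivWithin (fun r => NHYM.energyDensity g D (Hs r) x) (Icc a b) s := by
    funext x
    rw [derivWithin_of_mem_nhds (Icc_mem_nhds hs.1 hs.2)]
    exact hH.trace_pseudoCurvature_comp_logField g hD hs x
  have h1 : Integrable (fun x => contract g x (dform (V := V)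
      (transgression D (Hs s) (logField Hs s)) x)) (kahlerVolume g) :=
    (continuous_contract_dform g hβ).integrable_of_hasCompactSupport
      (HasCompactSupport.of_compactSpace _)
  have h2 : Integrable (fun x => derivWithin (fun r => NHYM.energyDensity g D (Hs r) x)
      (Icc a b) s) (kahlerVolume g) :=
    hd.integrable_of_hasCompactSupport (HasCompactSupport.of_compactSpace _)
  rw [heq]
  exact ⟨h1.add h2, by rw [integral_add h1 h2, integral_contract_dform g hβ, zero_add]⟩

/-- Agreement of `f` on the open interval suffices, since endpoints are null. At the ends of a
smooth piece the path may have a corner, and the actual integrand need not be the one of the family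
there. -/
theorem IsSmoothFamily.intervalIntegral_familyIntegrand (g : KahlerMetric V X)
    {D : ComplexConnection V F E} (hD : IsNHYM g D) (hH : IsSmoothFamily Hs (Icc a b))
    (hab : a < b) {f : ℝ → ℂ}
    (hf : ∀ s ∈ Ioo a b, f s = ∫ x, familyIntegrand g D Hs s x ∂(kahlerVolume g)) :
    IntervalIntegrable f volume a b ∧
      ∫ s in a..b, f s = energy g D (Hs b) - energy g D (Hs a) := by
  obtain ⟨hint, hval⟩ := integral_integral_eq_sub
    (φ := fun s x => NHYM.energyDensity g D (Hs s) x)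
    (d := fun s x => derivWithin (fun r => NHYM.energyDensity g D (Hs r) x) (Icc a b) s)
    (kahlerVolume g) hab
    (hH.continuousOn_energyDensity g D hab) (hH.continuousOn_derivWithin_energyDensity g D hab)
    (fun s hs x => by
      rw [derivWithin_of_mem_nhds (Icc_mem_nhds hs.1 hs.2)]
      exact (hH.hasDerivAt_energyDensity g D hs x).differentiableAt.hasDerivAt)
  have hae : (fun s => ∫ x, derivWithin (fun r => NHYM.energyDensity g D (Hs r) x) (Icc a b) s
      ∂(kahlerVolume g)) =ᵐ[volume.restrict (uIoc a b)] f := by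
    rw [uIoc_of_le hab.le, ← restrict_Ioo_eq_restrict_Ioc]
    refine (ae_restrict_iff' measurableSet_Ioo).2 (ae_of_all _ fun s hs => ?_)
    rw [hf s hs, (hH.integral_familyIntegrand g hD hs).2]
  refine ⟨hint.congr_ae hae, ?_⟩
  rw [← intervalIntegral.integral_congr_ae_restrict hae]
  exact hval

variable {K L : HermitianMetric V F E}

theorem donaldsonIntegrand_eq_familyIntegrand (g : KahlerMetric V X) (D : ComplexConnection V F E)
    (γ : MetricPath K L) (hs : s ∈ Ioo (0 : ℝ) 1) :
    donaldsonIntegrand g D γ s = familyIntegrand g D γ.metric s := by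
  funext x
  have h : logDeriv γ s x = logField γ.metric s x := by
    unfold logDeriv logField
    congr 1
    funext e f
    exact derivWithin_of_mem_nhds (Icc_mem_nhds hs.1 hs.2)
  rw [donaldsonIntegrand, h]
  rfl

theorem exists_mem_Ioo_of_monotone {m : ℕ} {t : ℕ → ℝ} {s : ℝ} (h0 : t 0 ≤ s) (hm : s < t m)
    (hs : ∀ i, t i ≠ s) : ∃ i < m, s ∈ Ioo (t i) (t (i + 1)) := by
  induction m with
  | zero => exact absurd hm (not_lt.2 h0)
  | succ k ih =>
    rcases lt_or_ge s (t k) with h | h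
    · obtain ⟨i, hi, his⟩ := ih h
      exact ⟨i, hi.trans k.lt_succ_self, his⟩
    · exact ⟨k, k.lt_succ_self, lt_of_le_of_ne h (hs k), hm⟩

/-- On each smooth piece the integral is the increment of the energy, and the increments telescope
because consecutive pieces share the metric at their common node. -/
theorem donaldsonAlong_eq_sub (g : KahlerMetric V X) {D : ComplexConnection V F E}
    (hD : IsNHYM g D) (γ : MetricPath K L) :
    (∀ᵐ s ∂(volume.restrict (Set.Icc (0 : ℝ) 1)),
      Integrable (donaldsonIntegrand g D γ s) (kahlerVolume g)) ∧
    IntervalIntegrable (fun s => ∫ x, donaldsonIntegrand g D γ s x ∂(kahlerVolume g)) volume 0 1 ∧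
    donaldsonAlong g D γ = energy g D L - energy g D K := by
  obtain ⟨m, t, hmono, h0, h1, hsm⟩ := γ.piecewise_smooth
  have hsub : ∀ i < m, Ioo (t i) (t (i + 1)) ⊆ Ioo (0 : ℝ) 1 := fun i hi s hs =>
    ⟨lt_of_le_of_lt (h0 ▸ hmono (Nat.zero_le i)) hs.1, lt_of_lt_of_le hs.2 (h1 ▸ hmono hi)⟩
  have hpiece : ∀ i < m, IntervalIntegrable
      (fun s => ∫ x, donaldsonIntegrand g D γ s x ∂(kahlerVolume g)) volume (t i) (t (i + 1)) ∧
      ∫ s in (t i)..(t (i + 1)), ∫ x, donaldsonIntegrand g D γ s x ∂(kahlerVolume g) =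
        energy g D (γ.metric (t (i + 1))) - energy g D (γ.metric (t i)) := by
    intro i hi
    -- The subdivision is only weakly monotone; a degenerate piece contributes zero on both sides.
    rcases (hmono i.le_succ).eq_or_lt with h | h
    · rw [← Nat.succ_eq_add_one, ← h]
      simp
    · refine IsSmoothFamily.intervalIntegral_familyIntegrand g hD (hsm i hi) h fun s hs => ?_
      rw [donaldsonIntegrand_eq_familyIntegrand g D γ (hsub i hi hs)]
  refine ⟨?_, ?_, ?_⟩
  -- Away from the countably many nodes, the parameter lies in the interior of a smooth piece.
  · have hnull : ∀ᵐ s ∂(volume : Measure ℝ), s ∉ range t :=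
      (countable_range t).ae_notMem volume
    refine (ae_restrict_iff' measurableSet_Icc).2 ?_
    filter_upwards [hnull] with s hs hs01
    have hne : ∀ i, t i ≠ s := fun i hi => hs ⟨i, hi⟩
    obtain ⟨i, hi, his⟩ := exists_mem_Ioo_of_monotone (h0 ▸ hs01.1)
      (lt_of_le_of_ne (h1 ▸ hs01.2) (hne m).symm) hne
    rw [donaldsonIntegrand_eq_familyIntegrand g D γ (hsub i hi his)]
    exact (IsSmoothFamily.integral_familyIntegrand g hD (hsm i hi) his).1
  · have h := IntervalIntegrable.trans_iterate fun k hk => (hpiece k hk).1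
    rwa [h0, h1] at h
  · have h := intervalIntegral.sum_integral_adjacent_intervals fun k hk => (hpiece k hk).1
    rw [h0, h1] at h
    rw [donaldsonAlong, ← h, Finset.sum_congr rfl fun k hk => (hpiece k (Finset.mem_range.1 hk)).2,
      Finset.sum_range_sub (fun k => energy g D (γ.metric (t k))), h0, h1, γ.source, γ.target]

end Functional

/-! ### Existence of paths by convexity of the space of Hermitian metrics -/

section Paths

variable {V : Type*} [NormedAddCommGroup V] [NormedSpace ℂ V]
  {X : Type*} [TopologicalSpace X] [ChartedSpace V X]
  {F : Type*} [NormedAddCommGroup F] [NormedSpace ℂ F]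
  {E : X → Type*} [∀ x, AddCommGroup (E x)] [∀ x, Module ℂ (E x)]
  [∀ x, TopologicalSpace (E x)] [TopologicalSpace (TotalSpace F E)] [FiberBundle F E]

/-- Convex combinations of Hermitian metrics. -/
def HermitianMetric.convexComb (K L : HermitianMetric V F E) (c : ℝ) (hc : c ∈ Icc (0 : ℝ) 1) :
    HermitianMetric V F E where
  form x := ((1 - c : ℝ) : ℂ) • K.form x + (c : ℂ) • L.form x
  conj_symm x e f := by
    simp only [LinearMap.add_apply, LinearMap.smul_apply, smul_eq_mul, map_add, map_mul,
      Complex.conj_ofReal, K.conj_symm, L.conj_symm]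
  pos x e he := by
    simp only [LinearMap.add_apply, LinearMap.smul_apply, smul_eq_mul, Complex.add_re,
      Complex.re_ofReal_mul]
    have hK := K.pos x e he
    have hL := L.pos x e he
    rcases hc.1.eq_or_lt with h | h
    · rw [← h]; simpa using hK
    · exact add_pos_of_nonneg_of_pos (mul_nonneg (sub_nonneg.2 hc.2) hK.le) (mul_pos h hL)
  smooth x σ τ hσ hτ := by
    have hK := (contMDiffAt_const (I := 𝓘(ℝ, V)) (I' := 𝓘(ℝ, ℝ)) (c := 1 - c)).smul
      (K.smooth x σ τ hσ hτ)
    have hL := (contMDiffAt_const (I := 𝓘(ℝ, V)) (I' := 𝓘(ℝ, ℝ)) (c := c)).smul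
      (L.smooth x σ τ hσ hτ)
    refine (hK.add hL).congr_of_eventuallyEq (Eventually.of_forall fun y => ?_)
    simp

theorem nonempty_metricPath (K L : HermitianMetric V F E) : Nonempty (MetricPath K L) := by
  -- The segment $(1-s)K+sL$, with the parameter clamped to $[0,1]$ because a path is a function on
  -- all of $\mathbb R$. The nodes $\min(k,1)$ give a single piece.
  refine ⟨⟨fun s => K.convexComb L (projIcc 0 1 zero_le_one s) (projIcc 0 1 zero_le_one s).2,
    ?_, ?_, 1, fun k => min k 1, ?_, by simp, by simp, ?_⟩⟩
  · simp [HermitianMetric.convexComb]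
  · simp [HermitianMetric.convexComb]
  · intro i j hij
    exact min_le_min_right _ (by exact_mod_cast hij)
  · intro i hi s hs x σ τ hσ hτ
    obtain rfl : i = 0 := by omega
    have hI : Icc (min ((0 : ℕ) : ℝ) 1) (min ((0 + 1 : ℕ) : ℝ) 1) = Icc (0 : ℝ) 1 := by norm_num
    rw [hI] at hs ⊢
    have hs1 : ContMDiffWithinAt (𝓘(ℝ, ℝ).prod 𝓘(ℝ, V)) 𝓘(ℝ, ℝ) ∞
        (fun p : ℝ × X => p.1) (Icc (0 : ℝ) 1 ×ˢ univ) (s, x) := contMDiffWithinAt_fst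
    have hK : ContMDiffWithinAt (𝓘(ℝ, ℝ).prod 𝓘(ℝ, V)) 𝓘(ℝ, ℂ) ∞
        (fun p : ℝ × X => K.form p.2 (σ p.2) (τ p.2)) (Icc (0 : ℝ) 1 ×ˢ univ) (s, x) :=
      (K.smooth x σ τ hσ hτ).comp_contMDiffWithinAt (s, x) contMDiffWithinAt_snd
    have hL : ContMDiffWithinAt (𝓘(ℝ, ℝ).prod 𝓘(ℝ, V)) 𝓘(ℝ, ℂ) ∞
        (fun p : ℝ × X => L.form p.2 (σ p.2) (τ p.2)) (Icc (0 : ℝ) 1 ×ˢ univ) (s, x) :=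
      (L.smooth x σ τ hσ hτ).comp_contMDiffWithinAt (s, x) contMDiffWithinAt_snd
    refine (((contMDiffWithinAt_const (c := (1 : ℝ))).sub hs1).smul hK |>.add
      (hs1.smul hL)).congr_of_mem (fun p hp => ?_) ⟨hs, mem_univ _⟩
    have hp1 : (projIcc (0 : ℝ) 1 zero_le_one p.1 : ℝ) = p.1 := by
      rw [projIcc_of_mem zero_le_one hp.1]
    simp [HermitianMetric.convexComb, hp1]

end Paths

end NHYM

end

/-! ### Path independence and the cocycle identity -/

theorem proposition3p1
    {V : Type*} [NormedAddCommGroup V] [NormedSpace ℂ V] [FiniteDimensional ℂ V]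
    [MeasurableSpace V] [BorelSpace V]
    {X : Type*} [TopologicalSpace X] [ChartedSpace V X] [IsManifold 𝓘(ℂ, V) ω X]
    [T2Space X] [CompactSpace X] [MeasurableSpace X] [BorelSpace X]
    (g : NHYM.KahlerMetric V X)
    {F : Type*} [NormedAddCommGroup F] [NormedSpace ℂ F] [FiniteDimensional ℂ F]
    {E : X → Type*} [∀ x, AddCommGroup (E x)] [∀ x, Module ℂ (E x)]
    [∀ x, TopologicalSpace (E x)] [∀ x, IsTopologicalAddGroup (E x)]
    [∀ x, ContinuousSMul ℂ (E x)]
    [TopologicalSpace (TotalSpace F E)] [FiberBundle F E] [VectorBundle ℂ F E]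
    [ContMDiffVectorBundle ∞ F E 𝓘(ℝ, V)]
    (D : NHYM.ComplexConnection V F E) (hD : NHYM.IsNHYM g D) :
    -- any two Hermitian metrics are joined by a path
    (∀ K L : NHYM.HermitianMetric V F E, Nonempty (NHYM.MetricPath K L)) ∧
    -- the integrals along a path converge
    (∀ (K L : NHYM.HermitianMetric V F E) (γ : NHYM.MetricPath K L),
      (∀ᵐ s ∂(volume.restrict (Set.Icc (0 : ℝ) 1)),
        Integrable (NHYM.donaldsonIntegrand g D γ s) (NHYM.kahlerVolume g)) ∧
      IntervalIntegrable
        (fun s => ∫ x, NHYM.donaldsonIntegrand g D γ s x ∂(NHYM.kahlerVolume g)) volume 0 1) ∧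
    -- independence of the path
    (∀ (K L : NHYM.HermitianMetric V F E) (γ γ' : NHYM.MetricPath K L),
      NHYM.donaldsonAlong g D γ = NHYM.donaldsonAlong g D γ') ∧
    -- the resulting functional is well defined and satisfies the cocycle identity
    (∃! M : NHYM.HermitianMetric V F E → NHYM.HermitianMetric V F E → ℂ,
      ∀ (K L : NHYM.HermitianMetric V F E) (γ : NHYM.MetricPath K L),
        NHYM.donaldsonAlong g D γ = M K L) ∧
    (∀ M : NHYM.HermitianMetric V F E → NHYM.HermitianMetric V F E → ℂ,
      (∀ (K L : NHYM.HermitianMetric V F E) (γ : NHYM.MetricPath K L),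
        NHYM.donaldsonAlong g D γ = M K L) →
      ∀ K J L : NHYM.HermitianMetric V F E, M K J + M J L = M K L) := by
  refine ⟨NHYM.nonempty_metricPath, fun K L γ => ?_, fun K L γ γ' => ?_, ?_, fun M hM K J L => ?_⟩
  · obtain ⟨h1, h2, -⟩ := NHYM.donaldsonAlong_eq_sub g hD γ
    exact ⟨h1, h2⟩
  · rw [(NHYM.donaldsonAlong_eq_sub g hD γ).2.2, (NHYM.donaldsonAlong_eq_sub g hD γ').2.2]
  · refine ⟨fun K L => NHYM.energy g D L - NHYM.energy g D K,
      fun K L γ => (NHYM.donaldsonAlong_eq_sub g hD γ).2.2, fun M hM => ?_⟩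
    funext K L
    -- Existence of a path is what pins down `M K L`; without one, the condition on `M` would be
    -- vacuous for this pair.
    obtain ⟨γ⟩ := NHYM.nonempty_metricPath K L
    rw [← hM K L γ, (NHYM.donaldsonAlong_eq_sub g hD γ).2.2]
  · have h : ∀ K L, M K L = NHYM.energy g D L - NHYM.energy g D K := fun K L => by
      obtain ⟨γ⟩ := NHYM.nonempty_metricPath K L
      rw [← hM K L γ, (NHYM.donaldsonAlong_eq_sub g hD γ).2.2]
    rw [h, h, h]
    ring
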